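/- **Conventions.** All objects are families indexed by the security parameter $\kappa$. *Efficient quantum operation* means a family of polynomial-size quantum circuits (over Hadamard, $T$, $X$, CNOT and Toffoli gates) that act on the input register and on an auxiliary register of polynomially many qubits in an advice state, followed by tracing out all non-output qubits. $\mathsf{negl}$ denotes a negligible function. A relation $R:\{0,1\}^n\times\{0,1\}^m\to\{0,1\}$ is given by a Boolean circuit of size $s$; the sizes $n,m,s$ are polynomially bounded functions of $\kappa$. **Protocols and soundness.** In a classical protocol about a relation, the client has an input $x\in\{0,1\}^n$, and $R$ is public. The parties exchange classical messages and at the end the client accepts or rejects. A malicious server $\mathsf{Adv}$ consists of efficient quantum operations, one for every round; it starts with a register $\boldsymbol S$ in a state $\rho_0$, and its answers are measured. The input $x$ may be public (the server gets $R$ and $x$ at the start) or client-side (the server gets only $R$ at the start). For $\delta,\varepsilon\in\mathbb R$ the protocol is *$(\delta,\varepsilon)$-sound* if for all polynomially bounded sizes $n,m,s$ and every efficient $\mathsf{Adv}$ there is an efficient quantum operation $\mathsf{Ext}$, which is applied to $\boldsymbol S$, gets the public input ($R$ and, only if $x$ is public, also $x$), and outputs $m$ bits, such that for all $R$ of size $s$,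 all $x\in\{0,1\}^n$ and all density operators $\rho_0$ on $\boldsymbol S$ (families in $\kappa$): if the client accepts in the interaction with $\mathsf{Adv}$ started in $\rho_0$ with probability at least $1-\delta$, then $$\operatorname{tr}\bigl(\Pi_{w:\,R(x,w)=1}\,\mathsf{Ext}(\rho_0)\bigr)\ \ge\ 1-\varepsilon-\mathsf{negl}(\kappa).$$ In particular, if $x$ is client-side, $\mathsf{Ext}$ does not depend on $x$. The protocol is *$(\delta,O(\delta))$-sound for all $\delta>0$* if there is a constant $C>0$ such that it is $(\delta,C\delta)$-sound for every $\delta>0$. **Ingredients.** * $\mathsf{Hash}$ is a family of collapsing hash functions: an efficient procedure $\mathsf{Hash}(1^m,1^\kappa)$ that samples descriptions, of length $\mathsf{poly}(\kappa)$, of efficiently computable functions $h:\{0,1\}^m\to\{0,1\}^\kappa$, such that for every $m=\mathsf{poly}(\kappa)$ and every efficient two-stage quantum adversary the following two games return $0$ with probabilities that differ by at most $\mathsf{negl}(\kappa)$. Sample $h$; the first stage gets $h$ and prepares a state on an $m$-qubit register $\boldsymbol X$ and a further register $\boldsymbol S'$; then either $h(\boldsymbol X)$ is measured and the result discarded, or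 $\boldsymbol X$ is measured in the computational basis; the second stage gets $h,\boldsymbol X,\boldsymbol S'$ and returns a bit. * $\mathsf{SAoK}$ is an argument of knowledge protocol with public input for all efficient relations: both honest parties are classical and efficient; it is complete (an honest server holding $w$ with $R(x,w)=1$ is accepted with probability at least $1-\mathsf{negl}(\kappa)$); and it is $(\delta,O(\delta))$-sound for all $\delta>0$. In the succinct testing protocol a *succinct* such argument is used; succinctness is not needed for the soundness below. **The protocol $\mathsf{succTest}$** (relation $R$ public, $x\in\{0,1\}^n$ client-side, the honest server holds $w\in\{0,1\}^m$): 1. The client samples $h\leftarrow\mathsf{Hash}(1^m,1^\kappa)$ and sends $h$ to the server. 2. The server sends $c=h(w)$ to the client. 3. Using $\mathsf{SAoK}$, the server proves to the client: $\exists w:\ h(w)=c$, with instance $(h,c)$. 4. The client reveals $x$ to the server. 5. Using $\mathsf{SAoK}$, the server proves to the client: $\exists w:\ R(x,w)=1\wedge h(w)=c$, with instance $(x,h,c)$. The client accepts if and only if it accepts in both step 3 and step 5. **Theorem 5.1.** For all $\mathsf{Hash}$ and $\mathsf{SAoK}$ as above, $\mathsf{succTest}$ (with client-side input $x$) is $(\delta,O(\delta))$-sound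 for every $\delta>0$: there is a constant $C>0$ such that for every $\delta>0$ the protocol is $(\delta,C\delta)$-sound. -/

import Mathlib

open Matrix
open scoped ComplexOrder

namespace SuccTest

/-! ## Growth of functions, bit strings -/

/-- A function of the security parameter that is bounded by a polynomial. -/
def PolyBounded (f : ℕ → ℕ) : Prop := ∃ c : ℕ, ∀ κ, f κ ≤ (κ + 2) ^ c

/-- A negligible function: it tends to `0` faster than every inverse polynomial. -/
def Negligible (μ : ℕ → ℝ) : Prop :=
  Asymptotics.SuperpolynomialDecay Filter.atTop (fun κ : ℕ => (κ : ℝ)) μ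

/-- Bit strings indexed by a type `ι`; a string of length `n` is an element of `Bits (Fin n)`. -/
abbrev Bits (ι : Type) : Type := ι → Bool

/-- A string of exactly `n` bits read from a list (cut off, or padded with `false`). -/
def toBits (n : ℕ) (l : List Bool) : Bits (Fin n) := fun j => l.getD j false

/-- A list, cut off or padded to length `n`. -/
def fit (n : ℕ) (l : List Bool) : List Bool := List.ofFn (toBits n l)

/-! ## Boolean circuits -/

/-- The sources a gate can read in a circuit with inputs `ι` and `s` gates:
a constant, an input bit, or the output of a gate. -/
abbrev Wire (ι : Type) (s : ℕ) : Type := Bool ⊕ ι ⊕ Fin s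

/-- A gate of fan-in two, computing an arbitrary function of two bits. -/
structure BoolGate (ι : Type) (s : ℕ) where
  op : Bool → Bool → Bool
  left : Wire ι s
  right : Wire ι s

/-- A Boolean circuit of size `s` with inputs `ι` and outputs `ο`.  The gates are evaluated in
the order of their indices; a gate that has not been evaluated yet is read as `false`. -/
structure Circuit (ι ο : Type) (s : ℕ) where
  gate : Fin s → BoolGate ι s
  out : ο → Wire ι s

/-- The value on a wire, given the input and the current values of the gates. -/
def Wire.read {ι : Type} {s : ℕ} (x : Bits ι) (v : Fin s → Bool) : Wire ι s → Bool
  | .inl b => b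
  | .inr (.inl i) => x i
  | .inr (.inr k) => v k

namespace Circuit

/-- The values of the gates after the first `k` of them have been evaluated. -/
def stage {ι ο : Type} {s : ℕ} (C : Circuit ι ο s) (x : Bits ι) : ℕ → Fin s → Bool
  | 0 => fun _ => false
  | k + 1 =>
    let v := C.stage x k
    if h : k < s then
      Function.update v ⟨k, h⟩
        ((C.gate ⟨k, h⟩).op (Wire.read x v (C.gate ⟨k, h⟩).left)
          (Wire.read x v (C.gate ⟨k, h⟩).right))
    else v

/-- The function computed by a circuit. -/
def eval {ι ο : Type} {s : ℕ} (C : Circuit ι ο s) (x : Bits ι) : Bits ο :=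
  fun o => Wire.read x (C.stage x s) (C.out o)

/-- Redirect the sources of a gate. -/
def _root_.SuccTest.BoolGate.redirect {ι ι' : Type} {s s' : ℕ} (f : Wire ι s → Wire ι' s')
    (g : BoolGate ι s) : BoolGate ι' s' where
  op := g.op
  left := f g.left
  right := f g.right

/-- A circuit without gates whose outputs are some of its inputs. -/
def select {ι ο : Type} (f : ο → ι) : Circuit ι ο 0 where
  gate := fun k => k.elim0
  out := fun o => .inr (.inl (f o))

/-- The circuit `C` with its inputs taken from other wires. -/
def relabel {ι ι' ο : Type} {s : ℕ} (f : ι → ι') (C : Circuit ι ο s) : Circuit ι' ο s where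
  gate := fun k => (C.gate k).redirect (Sum.map id (Sum.map f id))
  out := fun o => Sum.map id (Sum.map f id) (C.out o)

/-- Two circuits side by side on the same inputs. -/
def pair {ι ο ο' : Type} {s t : ℕ} (C : Circuit ι ο s) (D : Circuit ι ο' t) :
    Circuit ι (ο ⊕ ο') (s + t) where
  gate := Fin.append
    (fun k => (C.gate k).redirect (Sum.map id (Sum.map id (Fin.castAdd t))))
    (fun k => (D.gate k).redirect (Sum.map id (Sum.map id (Fin.natAdd s))))
  out := Sum.elim
    (fun o => Sum.map id (Sum.map id (Fin.castAdd t)) (C.out o))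
    (fun o => Sum.map id (Sum.map id (Fin.natAdd s)) (D.out o))

/-- The circuit `D` applied to the output of the circuit `C`. -/
def comp {ι ο π : Type} {s t : ℕ} (C : Circuit ι ο s) (D : Circuit ο π t) :
    Circuit ι π (s + t) :=
  let thru : Wire ο t → Wire ι (s + t) :=
    Sum.elim Sum.inl (Sum.elim (fun o => Sum.map id (Sum.map id (Fin.castAdd t)) (C.out o))
      (fun k => .inr (.inr (Fin.natAdd s k))))
  { gate := Fin.append
      (fun k => (C.gate k).redirect (Sum.map id (Sum.map id (Fin.castAdd t))))
      (fun k => (D.gate k).redirect thru)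
    out := fun o => thru (D.out o) }

/-- The conjunction of two bits. -/
def both : Circuit (Unit ⊕ Unit) Unit 1 where
  gate := fun _ => ⟨and, .inr (.inl (.inl ())), .inr (.inl (.inr ()))⟩
  out := fun _ => .inr (.inr 0)

/-- The conjunction of `k` bits. -/
def all : (k : ℕ) → Circuit (Fin k) Unit k
  | 0 => { gate := fun k => k.elim0, out := fun _ => .inl true }
  | k + 1 =>
    (((all k).relabel Fin.castSucc).pair (select fun _ : Unit => Fin.last k)).comp both

/-- The equality test for two strings of length `k`: compare bitwise, then take the conjunction. -/
def equal (k : ℕ) : Circuit (Fin k ⊕ Fin k) Unit (k + k) :=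
  Circuit.comp
    { gate := fun j => ⟨fun a b => a == b, .inr (.inl (.inl j)), .inr (.inl (.inr j))⟩
      out := fun j => .inr (.inr j) } (all k)

end Circuit

/-! ## Relations -/

/-- An efficient relation `{0,1}^n × {0,1}^m → {0,1}`, given by a circuit with `s` gates. -/
abbrev Relation (n m s : ℕ) : Type := Circuit (Fin n ⊕ Fin m) Unit s

/-- `R(x, w) = 1`. -/
def Relation.Holds {n m s : ℕ} (R : Relation n m s) (x : Bits (Fin n)) (w : Bits (Fin m)) :
    Prop :=
  R.eval (Sum.elim x w) () = true

instance {n m s : ℕ} (R : Relation n m s) (x : Bits (Fin n)) (w : Bits (Fin m)) :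
    Decidable (R.Holds x w) :=
  inferInstanceAs (Decidable (_ = true))

/-- The positions in the description of a gate: the truth table of its operation, and the
indicator vectors of its left (`false`) and right (`true`) source. -/
def GateIndex (ι : Type) (s : ℕ) : Type := (Bool × Bool) ⊕ (Bool × Wire ι s)

instance (ι : Type) [DecidableEq ι] (s : ℕ) : DecidableEq (GateIndex ι s) :=
  inferInstanceAs (DecidableEq ((Bool × Bool) ⊕ (Bool × Wire ι s)))

instance (ι : Type) [Fintype ι] (s : ℕ) : Fintype (GateIndex ι s) :=
  inferInstanceAs (Fintype ((Bool × Bool) ⊕ (Bool × Wire ι s)))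

/-- The positions in the binary description of a relation: those of its gates, and the indicator
vector of its output. -/
def DescIndex (n m s : ℕ) : Type :=
  (Fin s × GateIndex (Fin n ⊕ Fin m) s) ⊕ Wire (Fin n ⊕ Fin m) s

instance (n m s : ℕ) : DecidableEq (DescIndex n m s) :=
  inferInstanceAs (DecidableEq ((Fin s × GateIndex (Fin n ⊕ Fin m) s) ⊕ Wire (Fin n ⊕ Fin m) s))

instance (n m s : ℕ) : Fintype (DescIndex n m s) :=
  inferInstanceAs (Fintype ((Fin s × GateIndex (Fin n ⊕ Fin m) s) ⊕ Wire (Fin n ⊕ Fin m) s))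

/-- The binary description of a relation. -/
def Relation.desc {n m s : ℕ} (R : Relation n m s) : Bits (DescIndex n m s)
  | Sum.inl (k, Sum.inl (a, b)) => (R.gate k).op a b
  | Sum.inl (k, Sum.inr (false, p)) => decide ((R.gate k).left = p)
  | Sum.inl (k, Sum.inr (true, p)) => decide ((R.gate k).right = p)
  | Sum.inr p => decide (R.out () = p)

/-! ## Quantum states, circuits and efficient operations -/

/-- Operators on the qubits labelled by `ι`, as matrices in the computational basis. -/
abbrev Op (ι : Type) : Type := Matrix (Bits ι) (Bits ι) ℂ

/-- Density operators. -/
def IsDensity {ι : Type} [Fintype ι] [DecidableEq ι] (ρ : Op ι) : Prop :=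
  ρ.PosSemidef ∧ ρ.trace = 1

/-- The pure state `|a⟩⟨a|` of the computational basis. -/
def basisState {ι : Type} [DecidableEq ι] [Fintype ι] (a : Bits ι) : Op ι :=
  Matrix.single a a 1

/-- The tensor product of operators on two registers. -/
def tensor {ι ι' : Type} (ρ : Op ι) (σ : Op ι') : Op (ι ⊕ ι') :=
  fun f g => ρ (f ∘ Sum.inl) (g ∘ Sum.inl) * σ (f ∘ Sum.inr) (g ∘ Sum.inr)

/-- The partial trace onto the qubits selected by `e`: all the other qubits are traced out. -/
noncomputable def reduce {W ο : Type} [Fintype W] [DecidableEq W] [Fintype ο] [DecidableEq ο]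
    (e : ο ↪ W) (M : Op W) : Op ο :=
  fun a b => ∑ f : Bits W, ∑ g : Bits W,
    if f ∘ e = a ∧ g ∘ e = b ∧ ∀ i, (∀ o, e o ≠ i) → f i = g i then M f g else 0

/-- The elementary quantum gates on the qubits `W`: Hadamard, `T`, `X`, controlled-`X`
(control first) and doubly controlled `X` (target last). -/
inductive QGate (W : Type) where
  | had (i : W)
  | tee (i : W)
  | flip (i : W)
  | cnot (i j : W) (hij : i ≠ j)
  | toffoli (i j k : W) (hij : i ≠ j) (hik : i ≠ k) (hjk : j ≠ k)

/-- The unitary matrix of an elementary gate. -/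
noncomputable def QGate.matrix {W : Type} [Fintype W] [DecidableEq W] : QGate W → Op W
  | .had i => fun f g =>
      if ∀ j, j ≠ i → f j = g j then
        (if f i && g i then (-1 : ℂ) else 1) / (Real.sqrt 2 : ℂ) else 0
  | .tee i => Matrix.diagonal fun f =>
      if f i then Complex.exp (Complex.I * (Real.pi / 4 : ℝ)) else 1
  | .flip i => fun f g => if f = Function.update g i (!(g i)) then 1 else 0
  | .cnot i j _ => fun f g => if f = Function.update g j (xor (g j) (g i)) then 1 else 0
  | .toffoli i j k _ _ _ => fun f g =>
      if f = Function.update g k (xor (g k) (g i && g j)) then 1 else 0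

/-- The unitary matrix of a sequence of gates; the head of the list is applied first. -/
noncomputable def circuitMatrix {W : Type} [Fintype W] [DecidableEq W] : List (QGate W) → Op W
  | [] => 1
  | g :: l => circuitMatrix l * g.matrix

/-- A quantum operation from the qubits `ι` to the qubits `ο` given by a quantum circuit: join
auxiliary qubits in an advice state (which covers ancillas in the state `|0⟩`), apply elementary
gates, and trace out all but the output qubits. -/
structure QOp (ι ο : Type) where
  aux : ℕ
  advice : Op (Fin aux)
  advice_isDensity : IsDensity advice
  gates : List (QGate (ι ⊕ Fin aux))
  out : ο ↪ ι ⊕ Fin aux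

/-- The size of a quantum operation. -/
def QOp.size {ι ο : Type} (Q : QOp ι ο) : ℕ := Q.aux + Q.gates.length

/-- The channel defined by a quantum operation. -/
noncomputable def QOp.apply {ι ο : Type} [Fintype ι] [DecidableEq ι] [Fintype ο] [DecidableEq ο]
    (Q : QOp ι ο) (ρ : Op ι) : Op ο :=
  reduce Q.out (circuitMatrix Q.gates * tensor ρ Q.advice * (circuitMatrix Q.gates)ᴴ)

/-- The average of a function of uniformly random bits. -/
noncomputable def average {ι : Type} [Fintype ι] [DecidableEq ι] (p : Bits ι → ℝ) : ℝ :=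
  (∑ r : Bits ι, p r) / 2 ^ Fintype.card ι

/-! ## Collapsing hash functions -/

/-- An efficient procedure that samples functions from `{0,1}^n` to `{0,1}^κ` with descriptions of
length polynomial in `κ`.  The arguments of the fields are `n` and `κ`, in this order. -/
structure HashFamily where
  /-- the number of random bits of the sampling procedure -/
  coins : ℕ → ℕ → ℕ
  /-- the length of the description of a sampled function -/
  descLen : ℕ → ℕ → ℕ
  sampleSize : ℕ → ℕ → ℕ
  evalSize : ℕ → ℕ → ℕ
  sample : ∀ n κ, Circuit (Fin (coins n κ)) (Fin (descLen n κ)) (sampleSize n κ)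
  /-- evaluates the described function on an input -/
  evaluate : ∀ n κ, Circuit (Fin (descLen n κ) ⊕ Fin n) (Fin κ) (evalSize n κ)
  descLen_poly : ∃ c : ℕ, ∀ n κ, descLen n κ ≤ (κ + 2) ^ c
  efficient : ∃ c : ℕ, ∀ n κ, coins n κ ≤ (n + κ + 2) ^ c ∧
    sampleSize n κ ≤ (n + κ + 2) ^ c ∧ evalSize n κ ≤ (n + κ + 2) ^ c

namespace HashFamily

/-- `h(w)` for the function described by `h`. -/
def hash (H : HashFamily) {n κ : ℕ} (h : Bits (Fin (H.descLen n κ))) (w : Bits (Fin n)) :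
    Bits (Fin κ) :=
  (H.evaluate n κ).eval (Sum.elim h w)

/-- Evaluate `h` on the first register, measure and discard the result. -/
def measureHash (H : HashFamily) {n κ q : ℕ} (h : Bits (Fin (H.descLen n κ)))
    (ρ : Op (Fin n ⊕ Fin q)) : Op (Fin n ⊕ Fin q) :=
  fun f g => if H.hash h (f ∘ Sum.inl) = H.hash h (g ∘ Sum.inl) then ρ f g else 0

/-- Measure the first register in the computational basis. -/
def collapse {n q : ℕ} (ρ : Op (Fin n ⊕ Fin q)) : Op (Fin n ⊕ Fin q) :=
  fun f g => if f ∘ Sum.inl = g ∘ Sum.inl then ρ f g else 0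

/-- The probability that the second stage `D` of the adversary outputs `0`, when the first stage
`A` prepares a state on the registers `X` (`n` qubits) and `S` (`q` qubits) from `h`, and the
operation `M h` is applied in between. -/
noncomputable def gameProb (H : HashFamily) {n κ q : ℕ}
    (A : QOp (Fin (H.descLen n κ)) (Fin n ⊕ Fin q))
    (D : QOp (Fin (H.descLen n κ) ⊕ (Fin n ⊕ Fin q)) Unit)
    (M : Bits (Fin (H.descLen n κ)) → Op (Fin n ⊕ Fin q) → Op (Fin n ⊕ Fin q)) : ℝ :=
  average fun r : Bits (Fin (H.coins n κ)) =>
    let h := (H.sample n κ).eval r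
    (D.apply (tensor (basisState h) (M h (A.apply (basisState h))))
      (fun _ => false) (fun _ => false)).re

/-- The collapsing property, against efficient two-stage quantum adversaries with advice. -/
def IsCollapsing (H : HashFamily) : Prop :=
  ∀ n : ℕ → ℕ, PolyBounded n → ∀ q : ℕ → ℕ,
  ∀ A : ∀ κ, QOp (Fin (H.descLen (n κ) κ)) (Fin (n κ) ⊕ Fin (q κ)),
  ∀ D : ∀ κ, QOp (Fin (H.descLen (n κ) κ) ⊕ (Fin (n κ) ⊕ Fin (q κ))) Unit,
  PolyBounded (fun κ => (A κ).size) → PolyBounded (fun κ => (D κ).size) →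
  ∃ μ : ℕ → ℝ, Negligible μ ∧ ∀ κ,
    |H.gameProb (A κ) (D κ) (fun h => H.measureHash h)
      - H.gameProb (A κ) (D κ) (fun _ => collapse)| ≤ μ κ

end HashFamily

/-! ## Classical interactive protocols and quantum servers -/

/-- The format of an interaction.  In every round the client sends a message and the server
answers; `sendLen i` and `recvLen i` are the lengths of the messages that the client sends and
receives in round `i`. -/
structure Shape where
  rounds : ℕ
  clientCoins : ℕ
  serverCoins : ℕ
  sendLen : ℕ → ℕ
  recvLen : ℕ → ℕ

/-- A classical client.  Its message depends on its random bits and the list of the server's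
messages so far (their number is the current round); so does its final decision. -/
structure Client (σ : Shape) where
  send : Bits (Fin σ.clientCoins) → List (List Bool) → List Bool
  accept : Bits (Fin σ.clientCoins) → List (List Bool) → Bool

/-- A classical server.  Its message depends on its random bits and the list of the client's
messages so far, including that of the current round. -/
structure Server (σ : Shape) where
  reply : Bits (Fin σ.serverCoins) → List (List Bool) → List Bool

/-- The server's messages in the first `k` rounds between a classical client and a classical
server, together with the client's messages. -/
def classicalRun {σ : Shape} (C : Client σ) (S : Server σ) (r : Bits (Fin σ.clientCoins))
    (t : Bits (Fin σ.serverCoins)) : ℕ → List (List Bool) × List (List Bool)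
  | 0 => ([], [])
  | k + 1 =>
    let (fromServer, fromClient) := classicalRun C S r t k
    let fromClient' := fromClient ++ [fit (σ.sendLen k) (C.send r fromServer)]
    (fromServer ++ [fit (σ.recvLen k) (S.reply t fromClient')], fromClient')

/-- The probability that the client accepts in the interaction with a classical server. -/
noncomputable def classicalAcceptProb {σ : Shape} (C : Client σ) (S : Server σ) : ℝ :=
  average fun r : Bits (Fin σ.clientCoins) => average fun t : Bits (Fin σ.serverCoins) =>
    if C.accept r (classicalRun C S r t σ.rounds).1 then 1 else 0

/-- A quantum server.  It starts with `reg` qubits in an arbitrary state; `load` gives it the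
public input (bits labelled by `pub`); `step i` is its operation in round `i`, which acts on its
memory and the message received and leaves its memory and an answer, which is then measured. -/
structure Adversary (σ : Shape) (pub : Type) where
  reg : ℕ
  mem : ℕ → ℕ
  load : QOp (Fin reg ⊕ pub) (Fin (mem 0))
  step : ∀ i, QOp (Fin (mem i) ⊕ Fin (σ.sendLen i)) (Fin (mem (i + 1)) ⊕ Fin (σ.recvLen i))

/-- The size of a quantum server. -/
def Adversary.size {σ : Shape} {pub : Type} (A : Adversary σ pub) : ℕ :=
  A.reg + A.load.size + ∑ i ∈ Finset.range σ.rounds, (A.step i).size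

/-- The unnormalized state of the first register after the second has been measured with
outcome `b`. -/
def outcome {ι ι' : Type} (b : Bits ι') (ρ : Op (ι ⊕ ι')) : Op ι :=
  fun f g => ρ (Sum.elim f b) (Sum.elim g b)

/-- The probability that the client (with random bits `r`) accepts after `k` more rounds, when
the rounds `0, …, i - 1` are over with the messages `hist` from the server, and `ρ` is the
unnormalized state of the memory of the server, its trace being the probability of `hist`. -/
noncomputable def acceptFrom {σ : Shape} {pub : Type} (C : Client σ) (A : Adversary σ pub)
    (r : Bits (Fin σ.clientCoins)) :
    (k i : ℕ) → List (List Bool) → Op (Fin (A.mem i)) → ℝ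
  | 0, _, hist, ρ => if C.accept r hist then ρ.trace.re else 0
  | k + 1, i, hist, ρ =>
    ∑ b : Bits (Fin (σ.recvLen i)),
      acceptFrom C A r k (i + 1) (hist ++ [List.ofFn b])
        (outcome b ((A.step i).apply
          (tensor ρ (basisState (toBits (σ.sendLen i) (C.send r hist))))))

/-- The probability that the client accepts in the interaction with a quantum server that is
given the public input `p` and starts in the state `ρ`. -/
noncomputable def acceptProb {σ : Shape} {pub : Type} [Fintype pub] [DecidableEq pub]
    (C : Client σ) (A : Adversary σ pub) (p : Bits pub) (ρ : Op (Fin A.reg)) : ℝ :=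
  average fun r : Bits (Fin σ.clientCoins) =>
    acceptFrom C A r σ.rounds 0 [] (A.load.apply (tensor ρ (basisState p)))

/-- Whether the input `x` is public or known to the client only. -/
inductive Visibility where
  | publicInput
  | clientInput

/-- The number of bits of the input of length `n` that the server is given. -/
def Visibility.len : Visibility → ℕ → ℕ
  | .publicInput, n => n
  | .clientInput, _ => 0

/-- The part of the input that the server is given. -/
def Visibility.view {n : ℕ} : (v : Visibility) → Bits (Fin n) → Bits (Fin (v.len n))
  | .publicInput, x => x
  | .clientInput, _ => Fin.elim0

/-- The positions of the public input: the description of the relation, and `x` if it is public. -/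
abbrev PubIndex (v : Visibility) (n m s : ℕ) : Type := DescIndex n m s ⊕ Fin (v.len n)

/-- The public input. -/
def pubInput (v : Visibility) {n m s : ℕ} (R : Relation n m s) (x : Bits (Fin n)) :
    Bits (PubIndex v n m s) :=
  Sum.elim R.desc (v.view x)

/-- A classical two-party protocol about a relation `R`.  The client has the input `x`, the
(honest) server has a witness `w`, and `x` is public or known to the client only.
The parameters are `κ`, `n`, `m` and the size `s` of the relation. -/
structure Protocol (v : Visibility) where
  shape : (κ n m s : ℕ) → Shape
  client : ∀ κ {n m s}, Relation n m s → Bits (Fin n) → Client (shape κ n m s)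
  server : ∀ κ {n m s}, Relation n m s → Bits (Fin (v.len n)) → Bits (Fin m) →
    Server (shape κ n m s)

namespace Protocol

variable {v : Visibility}

/-- Both parties run in polynomial time: the number of rounds, the numbers of random bits and the
lengths of the messages are polynomial, and all messages and the decision are computed by circuits
of polynomial size. -/
def IsEfficient (P : Protocol v) : Prop :=
  ∃ c : ℕ, ∀ κ n m s : ℕ,
    (P.shape κ n m s).rounds ≤ (κ + n + m + s + 2) ^ c ∧
    (P.shape κ n m s).clientCoins ≤ (κ + n + m + s + 2) ^ c ∧
    (P.shape κ n m s).serverCoins ≤ (κ + n + m + s + 2) ^ c ∧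
    (∀ i < (P.shape κ n m s).rounds,
      (P.shape κ n m s).sendLen i ≤ (κ + n + m + s + 2) ^ c ∧
      (P.shape κ n m s).recvLen i ≤ (κ + n + m + s + 2) ^ c) ∧
    ∀ R : Relation n m s,
      (∀ i < (P.shape κ n m s).rounds, ∃ t ≤ (κ + n + m + s + 2) ^ c,
        ∃ C : Circuit (Fin n ⊕ Fin (P.shape κ n m s).clientCoins ⊕
              (Σ j : Fin i, Fin ((P.shape κ n m s).recvLen j)))
            (Fin ((P.shape κ n m s).sendLen i)) t,
          ∀ x r (b : ∀ j : Fin i, Bits (Fin ((P.shape κ n m s).recvLen j))),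
            C.eval (Sum.elim x (Sum.elim r fun p => b p.1 p.2)) =
              toBits _ ((P.client κ R x).send r (List.ofFn fun j => List.ofFn (b j)))) ∧
      (∃ t ≤ (κ + n + m + s + 2) ^ c,
        ∃ C : Circuit (Fin n ⊕ Fin (P.shape κ n m s).clientCoins ⊕
              (Σ j : Fin (P.shape κ n m s).rounds, Fin ((P.shape κ n m s).recvLen j))) Unit t,
          ∀ x r (b : ∀ j : Fin (P.shape κ n m s).rounds,
              Bits (Fin ((P.shape κ n m s).recvLen j))),
            C.eval (Sum.elim x (Sum.elim r fun p => b p.1 p.2)) () =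
              (P.client κ R x).accept r (List.ofFn fun j => List.ofFn (b j))) ∧
      (∀ i < (P.shape κ n m s).rounds, ∃ t ≤ (κ + n + m + s + 2) ^ c,
        ∃ C : Circuit (Fin (v.len n) ⊕ Fin m ⊕ Fin (P.shape κ n m s).serverCoins ⊕
              (Σ j : Fin (i + 1), Fin ((P.shape κ n m s).sendLen j)))
            (Fin ((P.shape κ n m s).recvLen i)) t,
          ∀ y w r (b : ∀ j : Fin (i + 1), Bits (Fin ((P.shape κ n m s).sendLen j))),
            C.eval (Sum.elim y (Sum.elim w (Sum.elim r fun p => b p.1 p.2))) =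
              toBits _ ((P.server κ R y w).reply r (List.ofFn fun j => List.ofFn (b j))))

/-- Completeness: on inputs of polynomial size with `R(x, w) = 1`, the honest server is accepted
with probability `1 - negl(κ)`. -/
def IsComplete (P : Protocol v) : Prop :=
  ∀ n m s : ℕ → ℕ, PolyBounded n → PolyBounded m → PolyBounded s →
  ∀ (R : ∀ κ, Relation (n κ) (m κ) (s κ)) (x : ∀ κ, Bits (Fin (n κ)))
    (w : ∀ κ, Bits (Fin (m κ))),
  ∃ μ : ℕ → ℝ, Negligible μ ∧ ∀ κ, (R κ).Holds (x κ) (w κ) →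
    1 - μ κ ≤ classicalAcceptProb (P.client κ (R κ) (x κ)) (P.server κ (R κ) (v.view (x κ)) (w κ))

/-- `(δ, ε)`-soundness: for every efficient quantum server there is an efficient extractor, which
is given the public input and the initial state of the server, such that for all relations and
inputs of polynomial size and all initial states, if the client accepts with probability at least
`1 - δ`, then the extractor outputs some `w` with `R(x, w) = 1` with probability at least
`1 - ε - negl(κ)`.  If `x` is known to the client only, the extractor is not given `x`. -/
def IsSound (P : Protocol v) (δ ε : ℝ) : Prop :=
  ∀ n m s : ℕ → ℕ, PolyBounded n → PolyBounded m → PolyBounded s →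
  ∀ A : ∀ κ, Adversary (P.shape κ (n κ) (m κ) (s κ)) (PubIndex v (n κ) (m κ) (s κ)),
  PolyBounded (fun κ => (A κ).size) →
  ∃ Ext : ∀ κ, QOp (Fin (A κ).reg ⊕ PubIndex v (n κ) (m κ) (s κ)) (Fin (m κ)),
    PolyBounded (fun κ => (Ext κ).size) ∧
    ∀ (R : ∀ κ, Relation (n κ) (m κ) (s κ)) (x : ∀ κ, Bits (Fin (n κ)))
      (ρ : ∀ κ, Op (Fin (A κ).reg)), (∀ κ, IsDensity (ρ κ)) →
    ∃ μ : ℕ → ℝ, Negligible μ ∧ ∀ κ,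
      1 - δ ≤ acceptProb (P.client κ (R κ) (x κ)) (A κ) (pubInput v (R κ) (x κ)) (ρ κ) →
      1 - ε - μ κ ≤ ∑ w : Bits (Fin (m κ)), if (R κ).Holds (x κ) w then
        ((Ext κ).apply (tensor (ρ κ) (basisState (pubInput v (R κ) (x κ)))) w w).re else 0

/-- The protocol is `(δ, O(δ))`-sound for all `δ > 0`. -/
def IsLinearlySound (P : Protocol v) : Prop :=
  ∃ C : ℝ, 0 < C ∧ ∀ δ : ℝ, 0 < δ → P.IsSound δ (C * δ)

end Protocol

/-! ## The succinct testing protocol -/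

section Construction

variable (H : HashFamily)

/-- The relation `h(w) = c` between the instance `(h, c)` and the witness `w`. -/
def commitRelation (m κ : ℕ) :
    Relation (H.descLen m κ + κ) m (H.evalSize m κ + 0 + (κ + κ)) :=
  (((H.evaluate m κ).relabel (Sum.map (Fin.castAdd κ) id)).pair
    (Circuit.select fun j => .inl (Fin.natAdd (H.descLen m κ) j))).comp (Circuit.equal κ)

/-- The relation `R(x, w) = 1 ∧ h(w) = c` between the instance `(x, h, c)` and the witness `w`. -/
def openRelation (κ : ℕ) {n m s : ℕ} (R : Relation n m s) :
    Relation (n + (H.descLen m κ + κ)) m (s + (H.evalSize m κ + 0 + (κ + κ)) + 1) :=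
  ((R.relabel (Sum.map (Fin.castAdd (H.descLen m κ + κ)) id)).pair
    ((commitRelation H m κ).relabel (Sum.map (Fin.natAdd n) id))).comp Circuit.both

variable (P : Protocol .publicInput)

/-- The format of the argument of knowledge for `h(w) = c`. -/
def commitShape (κ m : ℕ) : Shape :=
  P.shape κ (H.descLen m κ + κ) m (H.evalSize m κ + 0 + (κ + κ))

/-- The format of the argument of knowledge for `R(x, w) = 1 ∧ h(w) = c`. -/
def openShape (κ n m s : ℕ) : Shape :=
  P.shape κ (n + (H.descLen m κ + κ)) m (s + (H.evalSize m κ + 0 + (κ + κ)) + 1)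

/-- The format of the succinct testing protocol.  In round `0` the client sends `h` and receives
`c`; then come the `k` rounds of the first argument; in round `k + 1` the client sends `x` (the
server sends nothing); then come the rounds of the second argument. -/
def testShape (κ n m s : ℕ) : Shape where
  rounds := 1 + (commitShape H P κ m).rounds + 1 + (openShape H P κ n m s).rounds
  clientCoins := H.coins m κ +
    ((commitShape H P κ m).clientCoins + (openShape H P κ n m s).clientCoins)
  serverCoins := (commitShape H P κ m).serverCoins + (openShape H P κ n m s).serverCoins
  sendLen i :=
    if i = 0 then H.descLen m κ
    else if i ≤ (commitShape H P κ m).rounds then (commitShape H P κ m).sendLen (i - 1)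
    else if i = (commitShape H P κ m).rounds + 1 then n
    else (openShape H P κ n m s).sendLen (i - ((commitShape H P κ m).rounds + 2))
  recvLen i :=
    if i = 0 then κ
    else if i ≤ (commitShape H P κ m).rounds then (commitShape H P κ m).recvLen (i - 1)
    else if i = (commitShape H P κ m).rounds + 1 then 0
    else (openShape H P κ n m s).recvLen (i - ((commitShape H P κ m).rounds + 2))

/-- The client of the succinct testing protocol.  It accepts if both arguments are accepted. -/
def testClient (κ : ℕ) {n m s : ℕ} (R : Relation n m s) (x : Bits (Fin n)) :
    Client (testShape H P κ n m s) :=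
  let k := (commitShape H P κ m).rounds
  let h (r : Bits (Fin (testShape H P κ n m s).clientCoins)) : Bits (Fin (H.descLen m κ)) :=
    (H.sample m κ).eval fun j => r (Fin.castAdd _ j)
  let r₁ (r : Bits (Fin (testShape H P κ n m s).clientCoins)) :
      Bits (Fin (commitShape H P κ m).clientCoins) :=
    fun j => r (Fin.natAdd _ (Fin.castAdd _ j))
  let r₂ (r : Bits (Fin (testShape H P κ n m s).clientCoins)) :
      Bits (Fin (openShape H P κ n m s).clientCoins) :=
    fun j => r (Fin.natAdd _ (Fin.natAdd _ j))
  let c (hist : List (List Bool)) : Bits (Fin κ) := toBits κ (hist.getD 0 [])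
  let client₁ r hist := P.client κ (commitRelation H m κ) (Fin.append (h r) (c hist))
  let client₂ r hist :=
    P.client κ (openRelation H κ R) (Fin.append x (Fin.append (h r) (c hist)))
  { send := fun r hist =>
      if hist.length = 0 then List.ofFn (h r)
      else if hist.length ≤ k then (client₁ r hist).send (r₁ r) (hist.drop 1)
      else if hist.length = k + 1 then List.ofFn x
      else (client₂ r hist).send (r₂ r) (hist.drop (k + 2))
    accept := fun r hist =>
      (client₁ r hist).accept (r₁ r) ((hist.drop 1).take k) &&
        (client₂ r hist).accept (r₂ r) (hist.drop (k + 2)) }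

/-- The honest server of the succinct testing protocol, with the witness `w`. -/
def testServer (κ : ℕ) {n m s : ℕ} (R : Relation n m s) (w : Bits (Fin m)) :
    Server (testShape H P κ n m s) :=
  let k := (commitShape H P κ m).rounds
  let h (hist : List (List Bool)) : Bits (Fin (H.descLen m κ)) := toBits _ (hist.getD 0 [])
  let x (hist : List (List Bool)) : Bits (Fin n) := toBits n (hist.getD (k + 1) [])
  { reply := fun t hist =>
      let c : Bits (Fin κ) := H.hash (h hist) w
      if hist.length = 1 then List.ofFn c
      else if hist.length ≤ k + 1 then
        (P.server κ (commitRelation H m κ) (Fin.append (h hist) c) w).reply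
          (fun j => t (Fin.castAdd _ j)) (hist.drop 1)
      else if hist.length = k + 2 then []
      else
        (P.server κ (openRelation H κ R) (Fin.append (x hist) (Fin.append (h hist) c)) w).reply
          (fun j => t (Fin.natAdd _ j)) (hist.drop (k + 2)) }

/-- The succinct testing protocol built from a hash family and an argument of knowledge. -/
def succTest : Protocol .clientInput where
  shape := testShape H P
  client := fun κ {_ _ _} R x => testClient H P κ R x
  server := fun κ {_ _ _} R _ w => testServer H P κ R w

end Construction

end SuccTest

/-!
The extractor of the test samples a hash function `h`, lets the server commit to some `c`, and runs
the extractor of the first argument on the state that the server is in afterwards.  It never sees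
the input `x` of the client.  Its output `w` satisfies `h(w) = c`, and it remains to see that
`R(x, w) = 1`.  For this the string `w` is compared with the string `w'` that the extractor of the
second argument finds; that extractor depends on `x`, but it occurs in the analysis only.

*One extractor with linear error.*  Soundness speaks of servers that are accepted with probability
at least `1 - δ`, whereas the state after a commitment is unnormalized and the acceptance
probability on it is arbitrary.  From soundness and completeness one gets, for a fixed server, a
single extractor that fails on every positive operator `ρ` with probability at most
`2C (δ tr ρ + rejection probability) + negl · tr ρ` (`exists_linear_extractor`).  Indeed, let `f` be
the rejection probability in a given state.  Give this state the weight `δ / (2 (f + δ))`, and mix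
it with an honest server: the server `switch` plays one of two strategies, as a flag tells, and the
honest one is a `classicalAdversary`.  The mixture is accepted with probability at least `1 - δ`, so
the extractor for the switching server succeeds on it up to an error `C δ`, hence on the given state
up to this error over the weight (`fail_le_of_mixture`).  If there is no witness to be honest with,
soundness at `1 / (2C)` shows that `f` is at least `1 / (2C)`, and there is nothing to prove.  The
negligible error is uniform in the instances, since one may choose for every `κ` an instance whose
error is at least half of the supremum (`exists_negligible_bound`).

*Consistency.*  The first extractor is run coherently, and the test `h(w) = c` is measured.  By the
operator inequality `P ω P ≤ 2 ω + 2 Q ω Q`, where `Q = 1 - P`, this disturbs the state by no more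
than the failure probability (`gentle_test`).  Then the extractor is undone, the first argument is
simulated, `x` is revealed, and the second extractor is run (`runThen`).  It therefore finds a `w'`
with `R(x, w') = 1` and `h(w') = c` almost as often as it would without the detour.  By collapsing,
the same holds if `w` is measured as well.  If then `w' ≠ w`, a collision has been found, and with
it a state in superposition of `w` and `w'` whose measurement a Hadamard test detects
(`coherenceTest`); so collapsing bounds the probability of this event, too, and `w' = w` otherwise.
This is `exists_collapsing_games` and, asymptotically, `HashFamily.IsCollapsing.consistent`.  Adding
up the errors in `success_of_consistent` gives the constant `20 C`.

*Efficiency.*  `Eff Φ N` says that a quantum operation of size at most `N` realizes the channel `Φ`,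
and `EffC` is the variant for channels with classical parameters.  They are closed under the
constructions above: composition, reversible evaluation of Boolean circuits (`Eff.xorInto`), reading
a register out into the parameters, and interaction with a client (`EffC.interact`).  The rounds of
the test split into commitment, first argument, revelation of `x` and second argument, each of them
a window of the whole interaction (`interact_window`, `acceptProb_testClient`).
-/


set_option linter.unusedSectionVars false

namespace SuccTest

/-! ### Registers: relabelling, partial trace, tensor products -/

section Registers

variable {ι ι' ο Z A B W : Type}

/-- Renaming the qubits of a register along a bijection. -/
def relabel (e : ι ≃ ι') (M : Op ι) : Op ι' := fun f g => M (f ∘ e) (g ∘ e)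

/-- Strings are transported backwards along a bijection of their index types. -/
def bitsEquiv (e : ι ≃ ι') : Bits ι' ≃ Bits ι where
  toFun f := f ∘ e
  invFun f := f ∘ e.symm
  left_inv f := by ext; simp
  right_inv f := by ext; simp

/-- A string on two registers is a pair of strings. -/
def splitEquiv (ι ι' : Type) : Bits (ι ⊕ ι') ≃ Bits ι × Bits ι' :=
  Equiv.sumArrowEquivProdArrow ι ι' Bool

theorem tensor_eq_kronecker (ρ : Op ι) (σ : Op ι') :
    tensor ρ σ = (Matrix.kroneckerMap (· * ·) ρ σ).submatrix (splitEquiv ι ι')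
      (splitEquiv ι ι') := rfl

theorem relabel_eq_submatrix (e : ι ≃ ι') (M : Op ι) :
    relabel e M = M.submatrix (bitsEquiv e) (bitsEquiv e) := rfl

theorem sum_bits_sum [Fintype ι] [Fintype ι'] [DecidableEq ι] [DecidableEq ι'] {R : Type*}
    [AddCommMonoid R] (F : Bits (ι ⊕ ι') → R) :
    ∑ f, F f = ∑ a, ∑ b, F (Sum.elim a b) := by
  rw [← (splitEquiv ι ι').symm.sum_comp, Fintype.sum_prod_type]
  rfl

theorem sum_bits_relabel [Fintype ι] [Fintype ι'] [DecidableEq ι] [DecidableEq ι'] {R : Type*}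
    [AddCommMonoid R] (e : ι ≃ ι') (F : Bits ι → R) :
    ∑ f : Bits ι', F (f ∘ e) = ∑ f, F f :=
  (bitsEquiv e).sum_comp F

/-- The partial trace over the second register. -/
def ptr [Fintype Z] [DecidableEq Z] (M : Op (ο ⊕ Z)) : Op ο :=
  fun a b => ∑ z : Bits Z, M (Sum.elim a z) (Sum.elim b z)

/-- Conjugation by a matrix. -/
def conjBy [Fintype ι] [DecidableEq ι] (U M : Op ι) : Op ι := U * M * Uᴴ

/-- The block `(1 ⊗ ⟨y|) M (1 ⊗ |z⟩)` of an operator on two registers. -/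
def block (M : Op (ι ⊕ Z)) (y z : Bits Z) : Op ι := fun a b => M (Sum.elim a y) (Sum.elim b z)

theorem block_apply (M : Op (ι ⊕ Z)) (y z : Bits Z) (a b : Bits ι) :
    block M y z a b = M (Sum.elim a y) (Sum.elim b z) := rfl

/-- A map on operators, applied to the first of two registers. -/
def ext (Φ : Op ι → Op ο) (M : Op (ι ⊕ Z)) : Op (ο ⊕ Z) :=
  fun f g => Φ (block M (f ∘ Sum.inr) (g ∘ Sum.inr)) (f ∘ Sum.inl) (g ∘ Sum.inl)

variable [Fintype ι] [DecidableEq ι] [Fintype ι'] [DecidableEq ι'] [Fintype ο] [DecidableEq ο]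
  [Fintype Z] [DecidableEq Z] [Fintype A] [DecidableEq A] [Fintype B] [DecidableEq B]
  [Fintype W] [DecidableEq W]

theorem relabel_relabel {κ : Type} (e : ι ≃ ι') (e' : ι' ≃ κ) (M : Op ι) :
    relabel e' (relabel e M) = relabel (e.trans e') M := rfl

theorem relabel_mul (e : ι ≃ ι') (M N : Op ι) :
    relabel e (M * N) = relabel e M * relabel e N := by
  simp only [relabel_eq_submatrix]
  rw [Matrix.submatrix_mul_equiv]

theorem relabel_one (e : ι ≃ ι') : relabel e (1 : Op ι) = 1 := by
  rw [relabel_eq_submatrix, Matrix.submatrix_one_equiv]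

theorem tensor_mul (M N : Op ι) (M' N' : Op ι') :
    tensor (M * N) (M' * N') = tensor M M' * tensor N N' := by
  simp only [tensor_eq_kronecker]
  rw [Matrix.submatrix_mul_equiv, ← Matrix.mul_kronecker_mul]

theorem tensor_one : tensor (1 : Op ι) (1 : Op ι') = 1 := by
  rw [tensor_eq_kronecker, Matrix.one_kronecker_one, Matrix.submatrix_one_equiv]

theorem tensor_conjTranspose (M : Op ι) (N : Op ι') : tensor Mᴴ Nᴴ = (tensor M N)ᴴ := by
  simp only [tensor_eq_kronecker, Matrix.conjTranspose_submatrix, Matrix.conjTranspose_kronecker]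

theorem relabel_conjBy (e : ι ≃ ι') (U M : Op ι) :
    relabel e (conjBy U M) = conjBy (relabel e U) (relabel e M) := by
  simp only [conjBy, relabel_mul]
  rfl

theorem conjBy_tensor_one (U M : Op ι) (σ : Op ι') :
    tensor (conjBy U M) σ = conjBy (tensor U 1) (tensor M σ) := by
  rw [conjBy, conjBy, ← tensor_conjTranspose, ← tensor_mul, ← tensor_mul]
  simp

theorem conjBy_mul (U V M : Op ι) : conjBy (U * V) M = conjBy U (conjBy V M) := by
  simp only [conjBy, Matrix.conjTranspose_mul, Matrix.mul_assoc]

theorem conjBy_apply (U M : Op ι) (f g : Bits ι) :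
    conjBy U M f g = ∑ a, ∑ b, U f a * M a b * star (U g b) := by
  simp only [conjBy, Matrix.mul_apply, Matrix.conjTranspose_apply, Finset.sum_mul]
  rw [Finset.sum_comm]

theorem tensor_relabel (e : ι ≃ ι') (M : Op ι) (σ : Op A) :
    tensor (relabel e M) σ = relabel (Equiv.sumCongr e (Equiv.refl A)) (tensor M σ) := rfl

/-- Exchanging the last two of three registers. -/
def swapLast (ο Z A : Type) : (ο ⊕ Z) ⊕ A ≃ (ο ⊕ A) ⊕ Z where
  toFun := Sum.elim (Sum.elim (fun o => .inl (.inl o)) .inr) (fun a => .inl (.inr a))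
  invFun := Sum.elim (Sum.elim (fun o => .inl (.inl o)) .inr) (fun a => .inl (.inr a))
  left_inv := by rintro ((_ | _) | _) <;> rfl
  right_inv := by rintro ((_ | _) | _) <;> rfl

theorem tensor_ptr (M : Op (ο ⊕ Z)) (σ : Op A) :
    tensor (ptr M) σ = ptr (relabel (swapLast ο Z A) (tensor M σ)) := by
  ext f g
  simp only [tensor, ptr, relabel, Finset.sum_mul]
  refine Finset.sum_congr rfl fun z _ => ?_
  congr 2 <;> · ext (_ | _) <;> rfl

theorem tensor_assoc (ρ : Op ι) (σ : Op A) (τ : Op B) :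
    tensor (tensor ρ σ) τ = relabel (Equiv.sumAssoc ι A B).symm (tensor ρ (tensor σ τ)) := by
  ext f g
  simp only [tensor, relabel, mul_assoc]
  rfl

theorem relabel_ptr (e : ο ≃ ι) (M : Op (ο ⊕ Z)) :
    relabel e (ptr M) = ptr (relabel (Equiv.sumCongr e (Equiv.refl Z)) M) := by
  ext f g
  simp only [ptr, relabel]
  refine Finset.sum_congr rfl fun z _ => ?_
  congr 1 <;> · ext (_ | _) <;> rfl

theorem ptr_ptr (M : Op ((ο ⊕ Z) ⊕ A)) :
    ptr (ptr M) = ptr (relabel (Equiv.sumAssoc ο Z A) M) := by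
  ext f g
  simp only [ptr, relabel]
  rw [sum_bits_sum]
  refine Finset.sum_congr rfl fun z _ => Finset.sum_congr rfl fun a _ => ?_
  congr 1 <;> · ext ((_ | _) | _) <;> rfl

theorem conjBy_ptr (U : Op ο) (M : Op (ο ⊕ Z)) :
    conjBy U (ptr M) = ptr (conjBy (tensor U 1) M) := by
  ext f g
  simp only [conjBy_apply, ptr, sum_bits_sum, tensor, Matrix.one_apply, Finset.sum_mul,
    Finset.mul_sum, Sum.elim_comp_inl, Sum.elim_comp_inr]
  have h : ∀ z : Bits Z, ∑ a : Bits ο, ∑ y : Bits Z, ∑ b : Bits ο, ∑ y' : Bits Z,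
      U f a * (if z = y then 1 else 0) * M (Sum.elim a y) (Sum.elim b y') *
        star (U g b * if z = y' then (1 : ℂ) else 0) =
      ∑ a, ∑ b, U f a * M (Sum.elim a z) (Sum.elim b z) * star (U g b) := by
    intro z
    refine Finset.sum_congr rfl fun a _ => ?_
    rw [Finset.sum_eq_single z]
    · refine Finset.sum_congr rfl fun b _ => ?_
      rw [Finset.sum_eq_single z]
      · simp
      · intro y _ hy; simp [Ne.symm hy]
      · simp
    · intro y _ hy; simp [Ne.symm hy]
    · simp
  refine Eq.trans ?_ (Finset.sum_congr rfl fun z _ => (h z).symm)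
  refine (Finset.sum_congr rfl fun a _ => Finset.sum_comm).trans ?_
  rw [Finset.sum_comm]

theorem reduce_eq_ptr (e : ο ↪ W) (w : W ≃ ο ⊕ Z) (hw : ∀ o, w (e o) = Sum.inl o) (M : Op W) :
    reduce e M = ptr (relabel w M) := by
  have hinl : ∀ (a : Bits ο) (z : Bits Z), (Sum.elim a z ∘ w) ∘ e = a := by
    intro a z; ext o; simp [hw]
  have hinr : ∀ (a : Bits ο) (z : Bits Z) y, (Sum.elim a z ∘ w) (w.symm (.inr y)) = z y := by
    intro a z y; simp
  have hag : ∀ (a b : Bits ο) (z z' : Bits Z),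
      (∀ i, (∀ o, e o ≠ i) → (Sum.elim a z ∘ w) i = (Sum.elim b z' ∘ w) i) ↔ z = z' := by
    intro a b z z'
    constructor
    · intro h
      ext y
      have := h (w.symm (.inr y)) (by
        intro o ho
        have := congrArg w ho
        simp [hw] at this)
      simpa using this
    · rintro rfl i hi
      rcases hc : w i with o | y
      · exact absurd (w.injective (by rw [hw, hc])) (hi o)
      · simp [hc]
  ext a b
  simp only [reduce, ptr, relabel]
  rw [← sum_bits_relabel w, sum_bits_sum, Finset.sum_comm]
  refine Finset.sum_congr rfl fun z _ => ?_
  have key : ∀ a' : Bits ο, (∑ g : Bits W,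
      if ((Sum.elim a' z ∘ w) ∘ e = a ∧ g ∘ e = b ∧
        ∀ i, (∀ o, e o ≠ i) → (Sum.elim a' z ∘ w) i = g i)
      then M (Sum.elim a' z ∘ w) g else 0) =
      if a' = a then M (Sum.elim a z ∘ w) (Sum.elim b z ∘ w) else 0 := by
    intro a'
    rw [← sum_bits_relabel w, sum_bits_sum]
    simp only [hinl, hag]
    rw [Finset.sum_eq_single b, Finset.sum_eq_single z]
    · by_cases h : a' = a
      · subst h; simp
      · simp [h]
    · intro y _ hy; simp [Ne.symm hy]
    · simp
    · intro b' _ hb; simp [hb]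
    · simp
  refine (Finset.sum_congr rfl fun a' _ => key a').trans ?_
  simp

end Registers

/-! ### Maps on the first of two registers, positivity and traces -/

section Extension

variable {ι ι' ο Z A B W π : Type}
  [Fintype ι] [DecidableEq ι] [Fintype ι'] [DecidableEq ι'] [Fintype ο] [DecidableEq ο]
  [Fintype Z] [DecidableEq Z] [Fintype A] [DecidableEq A] [Fintype B] [DecidableEq B]
  [Fintype W] [DecidableEq W]

theorem ext_comp (Φ : Op ι → Op ο) (Ψ : Op ο → Op π) (M : Op (ι ⊕ Z)) :
    ext Ψ (ext Φ M) = ext (fun ρ => Ψ (Φ ρ)) M := rfl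

theorem ext_tensor (σ : Op A) (M : Op (ι ⊕ Z)) :
    ext (fun ρ => tensor ρ σ) M = relabel (swapLast ι Z A) (tensor M σ) := by
  funext f g
  simp only [ext, block, tensor, relabel]
  congr 2 <;> · ext (_ | _) <;> rfl

theorem ext_relabel (e : ι ≃ ο) (M : Op (ι ⊕ Z)) :
    ext (relabel e) M = relabel (Equiv.sumCongr e (Equiv.refl Z)) M := by
  funext f g
  simp only [ext, block, relabel]
  congr 1 <;> · ext (_ | _) <;> rfl

theorem ext_ptr (M : Op ((ο ⊕ A) ⊕ Z)) :
    ext ptr M = ptr (relabel (swapLast ο A Z) M) := by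
  funext f g
  simp only [ext, block, relabel, ptr]
  refine Finset.sum_congr rfl fun z _ => ?_
  congr 1 <;> · ext ((_ | _) | _) <;> rfl

theorem ext_conjBy (U : Op ι) (M : Op (ι ⊕ Z)) :
    ext (conjBy U) M = conjBy (tensor U 1) M := by
  funext f g
  rw [ext, conjBy_apply, conjBy_apply]
  simp only [sum_bits_sum, tensor, Matrix.one_apply, Sum.elim_comp_inl, Sum.elim_comp_inr,
    block_apply]
  refine Finset.sum_congr rfl fun a _ => ?_
  symm
  refine (Finset.sum_eq_single (f ∘ Sum.inr) ?_ ?_).trans ?_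
  · intro y _ hy; simp [Ne.symm hy]
  · simp
  · refine Finset.sum_congr rfl fun b _ => ?_
    refine (Finset.sum_eq_single (g ∘ Sum.inr) ?_ ?_).trans ?_
    · intro y _ hy; simp [Ne.symm hy]
    · simp
    · simp

theorem relabel_posSemidef (e : ι ≃ ι') {M : Op ι} (hM : M.PosSemidef) :
    (relabel e M).PosSemidef := hM.submatrix _

theorem tensor_posSemidef {M : Op ι} {N : Op ι'} (hM : M.PosSemidef) (hN : N.PosSemidef) :
    (tensor M N).PosSemidef := by
  rw [tensor_eq_kronecker]
  exact (hM.kronecker hN).submatrix _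

theorem conjBy_posSemidef (U : Op ι) {M : Op ι} (hM : M.PosSemidef) :
    (conjBy U M).PosSemidef := hM.mul_mul_conjTranspose_same U

theorem ptr_eq_sum (M : Op (ο ⊕ Z)) :
    ptr M = ∑ z : Bits Z, M.submatrix (fun a => Sum.elim a z) (fun a => Sum.elim a z) := by
  funext a b
  rw [Matrix.sum_apply]
  rfl

theorem ptr_posSemidef {M : Op (ο ⊕ Z)} (hM : M.PosSemidef) : (ptr M).PosSemidef := by
  rw [ptr_eq_sum]
  exact Matrix.posSemidef_sum _ fun z _ => hM.submatrix _

theorem trace_relabel (e : ι ≃ ι') (M : Op ι) : (relabel e M).trace = M.trace :=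
  (bitsEquiv e).sum_comp fun f => M f f

theorem trace_ptr (M : Op (ο ⊕ Z)) : (ptr M).trace = M.trace := by
  simp only [Matrix.trace, Matrix.diag, ptr]
  exact (sum_bits_sum fun f => M f f).symm

theorem trace_tensor (M : Op ι) (N : Op ι') : (tensor M N).trace = M.trace * N.trace := by
  simp only [Matrix.trace, Matrix.diag, sum_bits_sum, tensor, Finset.sum_mul_sum,
    Sum.elim_comp_inl, Sum.elim_comp_inr]

theorem trace_conjBy {U : Op ι} (hU : Uᴴ * U = 1) (M : Op ι) : (conjBy U M).trace = M.trace := by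
  rw [conjBy, Matrix.trace_mul_comm, ← Matrix.mul_assoc, hU, Matrix.one_mul]

theorem ptr_tensor (M : Op ι) (N : Op ι') : ptr (tensor M N) = N.trace • M := by
  funext f g
  simp only [ptr, tensor, Sum.elim_comp_inl, Sum.elim_comp_inr, Matrix.trace, Matrix.diag]
  rw [← Finset.mul_sum, mul_comm]
  rfl

theorem ext_tensor_left {Φ : Op ι → Op ο} (hΦ : ∀ (c : ℂ) ρ, Φ (c • ρ) = c • Φ ρ)
    (ρ : Op ι) (σ : Op Z) : ext Φ (tensor ρ σ) = tensor (Φ ρ) σ := by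
  funext f g
  have h : block (tensor ρ σ) (f ∘ Sum.inr) (g ∘ Sum.inr) =
      σ (f ∘ Sum.inr) (g ∘ Sum.inr) • ρ := by
    funext a b
    simp only [block, tensor, Sum.elim_comp_inl, Sum.elim_comp_inr]
    exact mul_comm _ _
  simp only [ext]
  rw [h, hΦ]
  exact mul_comm _ _

end Extension

/-! ### Gates on larger registers, inverses of circuits -/

section Gates

variable {W W' Z : Type}

/-- A gate acting on renamed qubits. -/
def QGate.map (φ : W ↪ W') : QGate W → QGate W'
  | .had i => .had (φ i)
  | .tee i => .tee (φ i)
  | .flip i => .flip (φ i)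
  | .cnot i j h => .cnot (φ i) (φ j) (φ.injective.ne h)
  | .toffoli i j k h₁ h₂ h₃ =>
    .toffoli (φ i) (φ j) (φ k) (φ.injective.ne h₁) (φ.injective.ne h₂) (φ.injective.ne h₃)

variable [Fintype W] [DecidableEq W] [Fintype W'] [DecidableEq W'] [Fintype Z] [DecidableEq Z]

theorem eq_update_comp_iff (e : W ≃ W') (f g : Bits W') (i : W) (b : Bool) :
    f ∘ e = Function.update (g ∘ e) i b ↔ f = Function.update g (e i) b := by
  rw [← Function.update_comp_eq_of_injective g e.injective]
  exact e.surjective.injective_comp_right.eq_iff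

theorem QGate.matrix_map_equiv (e : W ≃ W') (g : QGate W) :
    (g.map e.toEmbedding).matrix = relabel e g.matrix := by
  funext f f'
  cases g with
  | had i =>
    simp only [QGate.map, QGate.matrix, relabel, Equiv.coe_toEmbedding]
    refine if_congr ⟨fun h j hj => h _ (e.injective.ne hj), fun h j hj => ?_⟩ rfl rfl
    have := h (e.symm j) (fun hc => hj (by rw [← hc]; simp))
    simpa using this
  | tee i =>
    simp only [QGate.map, QGate.matrix, relabel, Equiv.coe_toEmbedding, Matrix.diagonal_apply]
    exact if_congr e.surjective.injective_comp_right.eq_iff.symm rfl rfl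
  | flip i => exact if_congr (eq_update_comp_iff e _ _ _ _).symm rfl rfl
  | cnot i j h => exact if_congr (eq_update_comp_iff e _ _ _ _).symm rfl rfl
  | toffoli i j k h₁ h₂ h₃ => exact if_congr (eq_update_comp_iff e _ _ _ _).symm rfl rfl

theorem eq_update_inl_iff (f g : Bits (W ⊕ Z)) (i : W) (b : Bool) :
    f = Function.update g (Sum.inl i) b ↔
      f ∘ Sum.inl = Function.update (g ∘ Sum.inl) i b ∧ f ∘ Sum.inr = g ∘ Sum.inr := by
  constructor
  · rintro rfl
    refine ⟨Function.update_comp_eq_of_injective g Sum.inl_injective i b, ?_⟩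
    ext z; simp
  · rintro ⟨h₁, h₂⟩
    ext (w | z)
    · have := congrFun h₁ w
      by_cases hw : w = i
      · subst hw; simpa using this
      · simpa [hw] using this
    · simpa using congrFun h₂ z

theorem QGate.matrix_map_inl (g : QGate W) :
    (g.map (Function.Embedding.inl : W ↪ W ⊕ Z)).matrix = tensor g.matrix 1 := by
  funext f f'
  simp only [tensor, Matrix.one_apply, mul_ite, mul_one, mul_zero]
  cases g with
  | had i =>
    simp only [QGate.map, QGate.matrix, Function.Embedding.inl_apply]
    rw [← ite_and]
    refine if_congr ⟨fun h => ⟨?_, fun j hj => h _ (by simpa using hj)⟩, ?_⟩ rfl rfl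
    · ext z; exact h _ (by simp)
    · rintro ⟨h₁, h₂⟩ (j | j) hj
      · exact h₂ _ (by simpa using hj)
      · exact congrFun h₁ j
  | tee i =>
    simp only [QGate.map, QGate.matrix, Function.Embedding.inl_apply, Matrix.diagonal_apply]
    rw [← ite_and]
    refine if_congr ⟨?_, ?_⟩ rfl rfl
    · rintro rfl; exact ⟨rfl, rfl⟩
    · rintro ⟨h₁, h₂⟩
      ext (j | j)
      · exact congrFun h₂ j
      · exact congrFun h₁ j
  | flip i =>
    simp only [QGate.map, QGate.matrix, Function.Embedding.inl_apply, eq_update_inl_iff]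
    rw [← ite_and]; exact if_congr and_comm rfl rfl
  | cnot i j h =>
    simp only [QGate.map, QGate.matrix, Function.Embedding.inl_apply, eq_update_inl_iff]
    rw [← ite_and]; exact if_congr and_comm rfl rfl
  | toffoli i j k h₁ h₂ h₃ =>
    simp only [QGate.map, QGate.matrix, Function.Embedding.inl_apply, eq_update_inl_iff]
    rw [← ite_and]; exact if_congr and_comm rfl rfl

theorem circuitMatrix_append (l l' : List (QGate W)) :
    circuitMatrix (l ++ l') = circuitMatrix l' * circuitMatrix l := by
  induction l with
  | nil => simp [circuitMatrix]
  | cons g l ih => simp [circuitMatrix, ih, Matrix.mul_assoc]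

theorem circuitMatrix_map_equiv (e : W ≃ W') (l : List (QGate W)) :
    circuitMatrix (l.map (QGate.map e.toEmbedding)) = relabel e (circuitMatrix l) := by
  induction l with
  | nil => simp [circuitMatrix, relabel_one]
  | cons g l ih => simp [circuitMatrix, ih, relabel_mul, QGate.matrix_map_equiv]

theorem circuitMatrix_map_inl (l : List (QGate W)) :
    circuitMatrix (l.map (QGate.map (Function.Embedding.inl : W ↪ W ⊕ Z))) =
      tensor (circuitMatrix l) 1 := by
  induction l with
  | nil => simp [circuitMatrix, tensor_one]
  | cons g l ih =>
    simp only [circuitMatrix, List.map_cons, ih, QGate.matrix_map_inl]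
    rw [← tensor_mul, Matrix.mul_one]

/-- The inverse of a gate, as a sequence of gates. -/
def QGate.inv : QGate W → List (QGate W)
  | .tee i => List.replicate 7 (.tee i)
  | g => [g]

/-- The inverse of a sequence of gates. -/
def circuitInv (l : List (QGate W)) : List (QGate W) := l.reverse.flatMap QGate.inv

theorem length_circuitInv (l : List (QGate W)) : (circuitInv l).length ≤ 7 * l.length := by
  induction l with
  | nil => simp [circuitInv]
  | cons g l ih =>
    have : g.inv.length ≤ 7 := by cases g <;> simp [QGate.inv]
    simp only [circuitInv, List.reverse_cons, List.flatMap_append, List.length_append,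
      List.flatMap_singleton, List.length_cons] at ih ⊢
    omega

/-- Permutation matrices of an involution are self-adjoint and self-inverse. -/
theorem involution_matrix {π : Bits W → Bits W} (h : Function.Involutive π) {M : Op W}
    (hM : M = fun f g => if f = π g then 1 else 0) : Mᴴ = M ∧ M * M = 1 := by
  subst hM
  constructor
  · funext f g
    change star (if g = π f then (1 : ℂ) else 0) = if f = π g then 1 else 0
    have : g = π f ↔ f = π g := by
      constructor <;> · rintro rfl; rw [h]
    simp only [this]
    split_ifs <;> simp
  · funext f g
    change (∑ x, (if f = π x then (1 : ℂ) else 0) * (if x = π g then 1 else 0)) = _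
    rw [Finset.sum_eq_single (π g)]
    · simp [h g, Matrix.one_apply]
    · intro x _ hx; simp [hx]
    · simp

theorem had_unit (f g : Bits Unit) : (QGate.had ()).matrix f g =
    (if f () && g () then (-1 : ℂ) else 1) / (Real.sqrt 2 : ℂ) := by
  simp [QGate.matrix]

theorem sum_bits_unit {R : Type*} [AddCommMonoid R] (F : Bits Unit → R) :
    ∑ f, F f = F (fun _ => false) + F (fun _ => true) := by
  rw [← (Equiv.funUnique Unit Bool).symm.sum_comp, Fintype.sum_bool, add_comm]
  rfl

theorem bits_unit_cases (f : Bits Unit) : f = (fun _ => false) ∨ f = (fun _ => true) := by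
  rcases h : f () with _ | _
  · left; ext; simp [h]
  · right; ext; simp [h]

theorem sqrt_two_mul : ((Real.sqrt 2 : ℝ) : ℂ) * ((Real.sqrt 2 : ℝ) : ℂ) = 2 := by
  rw [← Complex.ofReal_mul, Real.mul_self_sqrt (by norm_num)]; norm_num

theorem had_unit_sq : (QGate.had ()).matrix * (QGate.had ()).matrix = (1 : Op Unit) := by
  have h2 : ((Real.sqrt 2 : ℝ) : ℂ) ≠ 0 := by
    intro h; have := sqrt_two_mul; rw [h] at this; norm_num at this
  funext f g
  rw [Matrix.mul_apply, sum_bits_unit]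
  simp only [had_unit]
  have h3 := sqrt_two_mul
  have hne : (fun _ : Unit => false) ≠ fun _ => true := fun h => by simpa using congrFun h ()
  rcases bits_unit_cases f with rfl | rfl <;> rcases bits_unit_cases g with rfl | rfl <;>
    simp [hne, hne.symm] <;> field_simp <;> (try rw [pow_two, h3]) <;> norm_num

/-- Every Hadamard gate is the one-qubit gate next to an identity. -/
theorem had_matrix (i : W) : ∃ (e : Unit ⊕ {j // j ≠ i} ≃ W),
    (QGate.had i).matrix = relabel e (tensor (QGate.had ()).matrix 1) := by
  let e : Unit ⊕ {j // j ≠ i} ≃ W :=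
    { toFun := Sum.elim (fun _ => i) Subtype.val
      invFun := fun j => if h : j = i then .inl () else .inr ⟨j, h⟩
      left_inv := by rintro (_ | ⟨j, hj⟩) <;> simp [*]
      right_inv := by intro j; by_cases h : j = i <;> simp [h] }
  refine ⟨e, ?_⟩
  rw [← QGate.matrix_map_inl, ← QGate.matrix_map_equiv]
  rfl

theorem QGate.had_sq (i : W) : (QGate.had i).matrix * (QGate.had i).matrix = 1 := by
  obtain ⟨e, he⟩ := had_matrix i
  rw [he, ← relabel_mul, ← tensor_mul, had_unit_sq, Matrix.one_mul, tensor_one, relabel_one]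

theorem QGate.had_adjoint (i : W) : (QGate.had i).matrixᴴ = (QGate.had i).matrix := by
  funext f g
  change star (if ∀ j, j ≠ i → g j = f j then
      (if g i && f i then (-1 : ℂ) else 1) / (Real.sqrt 2 : ℂ) else 0) =
    if ∀ j, j ≠ i → f j = g j then (if f i && g i then (-1 : ℂ) else 1) / (Real.sqrt 2 : ℂ) else 0
  have : (∀ j, j ≠ i → g j = f j) ↔ ∀ j, j ≠ i → f j = g j :=
    ⟨fun h j hj => (h j hj).symm, fun h j hj => (h j hj).symm⟩
  simp only [this, Bool.and_comm]
  split_ifs <;> simp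

theorem flip_involutive (i : W) :
    Function.Involutive fun g : Bits W => Function.update g i (!(g i)) := by
  intro g; simp

theorem cnot_involutive {i j : W} (h : i ≠ j) :
    Function.Involutive fun g : Bits W => Function.update g j (xor (g j) (g i)) := by
  intro g; simp [h]

theorem toffoli_involutive {i j k : W} (h₂ : i ≠ k) (h₃ : j ≠ k) :
    Function.Involutive fun g : Bits W => Function.update g k (xor (g k) (g i && g j)) := by
  intro g; simp [h₂, h₃]

theorem circuitMatrix_replicate_tee (i : W) (n : ℕ) :
    circuitMatrix (List.replicate n (QGate.tee i)) = Matrix.diagonal fun f : Bits W =>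
      (if f i then Complex.exp (Complex.I * (Real.pi / 4 : ℝ)) else 1) ^ n := by
  induction n with
  | zero => simp [circuitMatrix]
  | succ n ih =>
    rw [List.replicate_succ, circuitMatrix, ih, QGate.matrix, Matrix.diagonal_mul_diagonal]
    simp only [pow_succ]

theorem exp_eighth_conj : star (Complex.exp (Complex.I * (Real.pi / 4 : ℝ))) =
    Complex.exp (Complex.I * (Real.pi / 4 : ℝ)) ^ 7 := by
  rw [← Complex.exp_nat_mul, Complex.star_def, ← Complex.exp_conj, map_mul, Complex.conj_I,
    Complex.conj_ofReal, Complex.exp_eq_exp_iff_exists_int]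
  refine ⟨-1, ?_⟩
  push_cast
  ring

theorem circuitMatrix_inv_gate (g : QGate W) : circuitMatrix g.inv = g.matrixᴴ := by
  have h : ∀ g : QGate W, circuitMatrix [g] = g.matrix := by simp [circuitMatrix]
  cases g with
  | had i => rw [QGate.had_adjoint]; exact h _
  | tee i =>
    simp only [QGate.inv]
    rw [circuitMatrix_replicate_tee, QGate.matrix, Matrix.diagonal_conjTranspose]
    congr 1
    funext f
    simp only [Pi.star_apply]
    split_ifs
    · exact exp_eighth_conj.symm
    · simp
  | flip i =>
    rw [(involution_matrix (flip_involutive i) (M := (QGate.flip i).matrix) rfl).1]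
    exact h _
  | cnot i j hh =>
    rw [(involution_matrix (cnot_involutive hh) (M := (QGate.cnot i j hh).matrix) rfl).1]
    exact h _
  | toffoli i j k h₁ h₂ h₃ =>
    rw [(involution_matrix (toffoli_involutive h₂ h₃)
      (M := (QGate.toffoli i j k h₁ h₂ h₃).matrix) rfl).1]
    exact h _

theorem QGate.unitary (g : QGate W) : g.matrixᴴ * g.matrix = 1 := by
  cases g with
  | had i => rw [QGate.had_adjoint, QGate.had_sq]
  | tee i =>
    rw [QGate.matrix, Matrix.diagonal_conjTranspose, Matrix.diagonal_mul_diagonal,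
      ← Matrix.diagonal_one]
    congr 1
    funext f
    simp only [Pi.star_apply]
    split_ifs
    · rw [Complex.star_def, ← Complex.exp_conj, ← Complex.exp_add]
      rw [map_mul, Complex.conj_I, Complex.conj_ofReal]
      simp
    · simp
  | flip i =>
    have := involution_matrix (flip_involutive i) (M := (QGate.flip i).matrix) rfl
    rw [this.1, this.2]
  | cnot i j hh =>
    have := involution_matrix (cnot_involutive hh) (M := (QGate.cnot i j hh).matrix) rfl
    rw [this.1, this.2]
  | toffoli i j k h₁ h₂ h₃ =>
    have := involution_matrix (toffoli_involutive h₂ h₃)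
      (M := (QGate.toffoli i j k h₁ h₂ h₃).matrix) rfl
    rw [this.1, this.2]

theorem circuitMatrix_unitary (l : List (QGate W)) :
    (circuitMatrix l)ᴴ * circuitMatrix l = 1 := by
  induction l with
  | nil => simp [circuitMatrix]
  | cons g l ih =>
    rw [circuitMatrix, Matrix.conjTranspose_mul, Matrix.mul_assoc,
      ← Matrix.mul_assoc (circuitMatrix l)ᴴ, ih, Matrix.one_mul, QGate.unitary]

theorem circuitMatrix_circuitInv (l : List (QGate W)) :
    circuitMatrix (circuitInv l) = (circuitMatrix l)ᴴ := by
  induction l with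
  | nil => simp [circuitInv, circuitMatrix]
  | cons g l ih =>
    have : circuitInv (g :: l) = circuitInv l ++ g.inv := by
      simp [circuitInv, List.flatMap_append]
    rw [this, circuitMatrix_append, ih, circuitMatrix_inv_gate, circuitMatrix,
      Matrix.conjTranspose_mul]

theorem conjBy_circuitInv (l : List (QGate W)) (M : Op W) :
    conjBy (circuitMatrix (circuitInv l)) (conjBy (circuitMatrix l) M) = M := by
  rw [← conjBy_mul, circuitMatrix_circuitInv, circuitMatrix_unitary]
  simp [conjBy]

end Gates

/-! ### Channels realized by small quantum operations -/

section Channels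

variable {ι ι' ο Z A B π : Type}
  [Fintype ι] [DecidableEq ι] [Fintype ι'] [DecidableEq ι'] [Fintype ο] [DecidableEq ο]
  [Fintype Z] [DecidableEq Z] [Fintype A] [DecidableEq A] [Fintype B] [DecidableEq B]
  [Fintype π] [DecidableEq π]

/-- The map `Φ` is the channel of a quantum operation of size at most `N`. -/
def Eff (Φ : Op ι → Op ο) (N : ℕ) : Prop := ∃ Q : QOp ι ο, Q.size ≤ N ∧ ∀ ρ, Q.apply ρ = Φ ρ

theorem Eff.mono {Φ : Op ι → Op ο} {N N' : ℕ} (h : Eff Φ N) (hN : N ≤ N') : Eff Φ N' :=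
  let ⟨Q, hQ, hΦ⟩ := h
  ⟨Q, hQ.trans hN, hΦ⟩

theorem Eff.congr {Φ Ψ : Op ι → Op ο} {N : ℕ} (h : Eff Φ N) (hΨ : ∀ ρ, Ψ ρ = Φ ρ) : Eff Ψ N :=
  let ⟨Q, hQ, hΦ⟩ := h
  ⟨Q, hQ, fun ρ => (hΦ ρ).trans (hΨ ρ).symm⟩

theorem QOp.eff (Q : QOp ι ο) : Eff Q.apply Q.size := ⟨Q, le_rfl, fun _ => rfl⟩

theorem IsDensity.tensor {ρ : Op ι} {σ : Op ι'} (hρ : IsDensity ρ) (hσ : IsDensity σ) :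
    IsDensity (tensor ρ σ) :=
  ⟨tensor_posSemidef hρ.1 hσ.1, by rw [trace_tensor, hρ.2, hσ.2, one_mul]⟩

theorem IsDensity.relabel {ρ : Op ι} (hρ : IsDensity ρ) (e : ι ≃ ι') : IsDensity (relabel e ρ) :=
  ⟨relabel_posSemidef e hρ.1, by rw [trace_relabel, hρ.2]⟩

theorem isDensity_basisState (a : Bits ι) : IsDensity (basisState a) := by
  constructor
  · have : basisState a = Matrix.diagonal fun b => if b = a then (1 : ℂ) else 0 := by
      rw [basisState, ← Matrix.diagonal_single]
      congr 1
      funext b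
      simp [Pi.single_apply]
    rw [this, Matrix.posSemidef_diagonal_iff]
    intro b
    split_ifs <;> simp
  · rw [basisState, Matrix.trace_single_eq_same]

/-- The traced-out qubits of a quantum operation form a second register. -/
theorem QOp.apply_eq (Q : QOp ι ο) : ∃ (k : ℕ) (w : ι ⊕ Fin Q.aux ≃ ο ⊕ Fin k),
    ∀ ρ, Q.apply ρ =
      ptr (SuccTest.relabel w (conjBy (circuitMatrix Q.gates) (SuccTest.tensor ρ Q.advice))) := by
  classical
  let w := (Equiv.Set.sumCompl (Set.range Q.out)).symm.trans
    (Equiv.sumCongr (Equiv.ofInjective Q.out Q.out.injective).symm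
      (Fintype.equivFin ↥(Set.range Q.out)ᶜ))
  refine ⟨_, w, fun ρ => reduce_eq_ptr _ w (fun o => ?_) _⟩
  simp [w, Equiv.Set.sumCompl_symm_apply_of_mem]

/-- Advice qubits and discarded qubits may be indexed by arbitrary finite types. -/
theorem Eff.of_normalForm {Φ : Op ι → Op ο} {N : ℕ} {σ : Op A} (hσ : IsDensity σ)
    (l : List (QGate (ι ⊕ A))) (w : ι ⊕ A ≃ ο ⊕ Z) (hN : Fintype.card A + l.length ≤ N)
    (hΦ : ∀ ρ, Φ ρ = ptr (relabel w (conjBy (circuitMatrix l) (tensor ρ σ)))) : Eff Φ N := by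
  let e := Fintype.equivFin A
  let e' : ι ⊕ A ≃ ι ⊕ Fin (Fintype.card A) := Equiv.sumCongr (Equiv.refl ι) e
  refine ⟨⟨Fintype.card A, SuccTest.relabel e σ, hσ.relabel e, l.map (QGate.map e'.toEmbedding),
    ⟨fun o => e' (w.symm (Sum.inl o)), fun o o' h => by simpa using h⟩⟩, ?_, fun ρ => ?_⟩
  · simpa [QOp.size] using hN
  · rw [QOp.apply, reduce_eq_ptr _ (e'.symm.trans w) (fun o => by
      change w (e'.symm (e' (w.symm (Sum.inl o)))) = _; simp), hΦ, circuitMatrix_map_equiv]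
    change ptr (SuccTest.relabel _ (conjBy _ (SuccTest.relabel e' (SuccTest.tensor ρ σ)))) = _
    rw [← relabel_conjBy, relabel_relabel, ← Equiv.trans_assoc, Equiv.self_trans_symm]
    rfl

/-- Add advice qubits, apply gates, discard all qubits but those of the output. -/
theorem Eff.normalForm {Φ : Op ι → Op ο} {N : ℕ} (h : Eff Φ N) :
    ∃ (a k : ℕ) (σ : Op (Fin a)) (l : List (QGate (ι ⊕ Fin a))) (w : ι ⊕ Fin a ≃ ο ⊕ Fin k),
      IsDensity σ ∧ a + l.length ≤ N ∧
      ∀ ρ, Φ ρ = ptr (relabel w (conjBy (circuitMatrix l) (tensor ρ σ))) := by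
  obtain ⟨Q, hQ, hΦ⟩ := h
  obtain ⟨k, w, hw⟩ := Q.apply_eq
  exact ⟨_, k, Q.advice, Q.gates, w, Q.advice_isDensity, hQ, fun ρ => by rw [← hΦ, hw]⟩

theorem ptr_empty [IsEmpty Z] (M : Op ι) : ptr (relabel (Equiv.sumEmpty ι Z).symm M) = M := by
  funext f g
  simp only [ptr, relabel, Fintype.sum_unique]
  congr 1

theorem isDensity_one_empty [IsEmpty Z] : IsDensity (1 : Op Z) :=
  ⟨Matrix.PosSemidef.one, by simp⟩

theorem tensor_one_empty [IsEmpty Z] (M : Op ι) :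
    tensor M (1 : Op Z) = relabel (Equiv.sumEmpty ι Z).symm M := by
  funext f g
  have : (1 : Op Z) (f ∘ Sum.inr) (g ∘ Sum.inr) = 1 := by
    rw [Matrix.one_apply, if_pos (Subsingleton.elim _ _)]
  rw [tensor, this, mul_one]
  rfl

theorem conjBy_one (M : Op ι) : conjBy 1 M = M := by simp [conjBy]

theorem relabel_refl (M : Op ι) : relabel (Equiv.refl ι) M = M := rfl

theorem Eff.id : Eff (fun ρ : Op ι => ρ) 0 :=
  Eff.of_normalForm (A := Empty) (Z := Empty) isDensity_one_empty [] (Equiv.refl _) (by simp)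
    fun ρ => by rw [circuitMatrix, conjBy_one, tensor_one_empty, relabel_refl, ptr_empty]

/-- Joining an advice state after a quantum operation. -/
theorem Eff.then_tensor {Φ : Op ι → Op ο} {N : ℕ} (h : Eff Φ N) {τ : Op B} (hτ : IsDensity τ) :
    Eff (fun ρ => tensor (Φ ρ) τ) (N + Fintype.card B) := by
  obtain ⟨a, k, σ, l, w, hσ, hN, hΦ⟩ := h.normalForm
  let s := Equiv.sumAssoc ι (Fin a) B
  refine Eff.of_normalForm (A := Fin a ⊕ B) (Z := Fin k) (hσ.tensor hτ)
    ((l.map (QGate.map (Function.Embedding.inl : _ ↪ _ ⊕ B))).map (QGate.map s.toEmbedding))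
    (s.symm.trans ((Equiv.sumCongr w (Equiv.refl B)).trans (swapLast ο (Fin k) B))) ?_ fun ρ => ?_
  · simp; omega
  · rw [hΦ, tensor_ptr, tensor_relabel, conjBy_tensor_one, tensor_assoc, circuitMatrix_map_equiv,
      circuitMatrix_map_inl]
    simp only [← relabel_relabel]
    rw [relabel_conjBy s.symm, relabel_relabel s, Equiv.self_trans_symm, relabel_refl]

/-- Further gates after a quantum operation. -/
theorem Eff.then_gates {Φ : Op ι → Op ο} {N : ℕ} (h : Eff Φ N) (l' : List (QGate ο)) :
    Eff (fun ρ => conjBy (circuitMatrix l') (Φ ρ)) (N + l'.length) := by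
  obtain ⟨a, k, σ, l, w, hσ, hN, hΦ⟩ := h.normalForm
  refine Eff.of_normalForm (A := Fin a) (Z := Fin k) hσ
    (l ++ (l'.map (QGate.map (Function.Embedding.inl : _ ↪ _ ⊕ Fin k))).map
      (QGate.map w.symm.toEmbedding)) w ?_ fun ρ => ?_
  · simp; omega
  · rw [hΦ, conjBy_ptr, circuitMatrix_append, circuitMatrix_map_equiv, circuitMatrix_map_inl,
      conjBy_mul, relabel_conjBy w (relabel _ _), relabel_relabel w.symm,
      Equiv.symm_trans_self, relabel_refl]

theorem Eff.then_relabel {Φ : Op ι → Op ο} {N : ℕ} (h : Eff Φ N) (e : ο ≃ π) :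
    Eff (fun ρ => relabel e (Φ ρ)) N := by
  obtain ⟨a, k, σ, l, w, hσ, hN, hΦ⟩ := h.normalForm
  refine Eff.of_normalForm (A := Fin a) (Z := Fin k) hσ l
    (w.trans (Equiv.sumCongr e (Equiv.refl _))) (by simpa using hN) fun ρ => ?_
  rw [hΦ, relabel_ptr, relabel_relabel]

theorem Eff.then_ptr {Φ : Op ι → Op (ο ⊕ B)} {N : ℕ} (h : Eff Φ N) :
    Eff (fun ρ => ptr (Φ ρ)) N := by
  obtain ⟨a, k, σ, l, w, hσ, hN, hΦ⟩ := h.normalForm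
  refine Eff.of_normalForm (A := Fin a) (Z := B ⊕ Fin k) hσ l
    (w.trans (Equiv.sumAssoc _ _ _)) (by simpa using hN) fun ρ => ?_
  rw [hΦ, ptr_ptr, relabel_relabel]

theorem Eff.comp {Φ : Op ι → Op ο} {Ψ : Op ο → Op π} {N N' : ℕ} (hΨ : Eff Ψ N') (hΦ : Eff Φ N) :
    Eff (fun ρ => Ψ (Φ ρ)) (N + N') := by
  obtain ⟨a, k, σ, l, w, hσ, hN, hΨ⟩ := hΨ.normalForm
  refine (((((hΦ.then_tensor hσ).then_gates l).then_relabel w).then_ptr).mono ?_).congr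
    fun ρ => hΨ _
  simp; omega

/-- A quantum operation that leaves a second register alone. -/
theorem Eff.ext {Φ : Op ι → Op ο} {N : ℕ} (h : Eff Φ N) :
    Eff (ext Φ : Op (ι ⊕ Z) → Op (ο ⊕ Z)) N := by
  obtain ⟨a, k, σ, l, w, hσ, hN, hΦ⟩ := h.normalForm
  have hΦ' : Φ = fun ρ => ptr (relabel w (conjBy (circuitMatrix l) (tensor ρ σ))) := funext hΦ
  have h1 := (Eff.id (ι := ι ⊕ Z)).then_tensor hσ
  have h2 := ((h1.then_relabel (swapLast ι Z (Fin a))).then_gates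
    (l.map (QGate.map (Function.Embedding.inl : _ ↪ _ ⊕ Z)))).then_relabel
      ((Equiv.sumCongr w (Equiv.refl Z)).trans (swapLast _ _ _))
  refine (h2.then_ptr.mono ?_).congr fun M => ?_
  · simpa using hN
  · rw [hΦ', ← ext_comp (fun ρ => relabel w (conjBy (circuitMatrix l) (tensor ρ σ))) ptr,
      ← ext_comp (fun ρ => conjBy (circuitMatrix l) (tensor ρ σ)) (relabel w),
      ← ext_comp (fun ρ => tensor ρ σ) (conjBy (circuitMatrix l)),
      ext_tensor, ext_conjBy, ext_relabel, ext_ptr, circuitMatrix_map_inl, relabel_relabel]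

theorem Eff.posSemidef {Φ : Op ι → Op ο} {N : ℕ} (h : Eff Φ N) {ρ : Op ι} (hρ : ρ.PosSemidef) :
    (Φ ρ).PosSemidef := by
  obtain ⟨a, k, σ, l, w, hσ, hN, hΦ⟩ := h.normalForm
  rw [hΦ]
  exact ptr_posSemidef (relabel_posSemidef _ (conjBy_posSemidef _ (tensor_posSemidef hρ hσ.1)))

theorem Eff.trace {Φ : Op ι → Op ο} {N : ℕ} (h : Eff Φ N) (ρ : Op ι) :
    (Φ ρ).trace = ρ.trace := by
  obtain ⟨a, k, σ, l, w, hσ, hN, hΦ⟩ := h.normalForm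
  rw [hΦ, trace_ptr, trace_relabel, trace_conjBy (circuitMatrix_unitary l), trace_tensor, hσ.2,
    mul_one]

theorem Eff.add {Φ : Op ι → Op ο} {N : ℕ} (h : Eff Φ N) (ρ ρ' : Op ι) :
    Φ (ρ + ρ') = Φ ρ + Φ ρ' := by
  obtain ⟨a, k, σ, l, w, hσ, hN, hΦ⟩ := h.normalForm
  have h1 : tensor (ρ + ρ') σ = tensor ρ σ + tensor ρ' σ := by
    funext f g; exact add_mul _ _ _
  have h2 : ∀ M M', conjBy (circuitMatrix l) (M + M') =
      conjBy (circuitMatrix l) M + conjBy (circuitMatrix l) M' := by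
    intro M M'; simp only [conjBy, Matrix.mul_add, Matrix.add_mul]
  rw [hΦ, hΦ, hΦ, h1, h2]
  funext f g
  exact Finset.sum_add_distrib

theorem Eff.smul {Φ : Op ι → Op ο} {N : ℕ} (h : Eff Φ N) (c : ℂ) (ρ : Op ι) :
    Φ (c • ρ) = c • Φ ρ := by
  obtain ⟨a, k, σ, l, w, hσ, hN, hΦ⟩ := h.normalForm
  have h1 : tensor (c • ρ) σ = c • tensor ρ σ := by
    funext f g; exact mul_assoc _ _ _
  have h2 : ∀ M, conjBy (circuitMatrix l) (c • M) = c • conjBy (circuitMatrix l) M := by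
    intro M; simp only [conjBy, Matrix.mul_smul, Matrix.smul_mul]
  rw [hΦ, hΦ, h1, h2]
  funext f g
  exact (Finset.mul_sum _ _ _).symm

theorem Eff.zero {Φ : Op ι → Op ο} {N : ℕ} (h : Eff Φ N) : Φ 0 = 0 := by
  have := h.smul 0 0
  simpa using this

theorem Eff.sum {Φ : Op ι → Op ο} {N : ℕ} (h : Eff Φ N) {κ : Type*} (s : Finset κ)
    (F : κ → Op ι) : Φ (∑ i ∈ s, F i) = ∑ i ∈ s, Φ (F i) := by
  classical
  induction s using Finset.induction_on with
  | empty => simp [h.zero]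
  | insert i s hi ih => rw [Finset.sum_insert hi, Finset.sum_insert hi, h.add, ih]

end Channels

/-! ### Boolean circuits and their composition -/

section Boolean

variable {ι ι' ο ο' π : Type}

theorem update_append_left {s t : ℕ} (u : Fin s → Bool) (v : Fin t → Bool) (i : Fin s) (b : Bool) :
    Function.update (Fin.append u v) (Fin.castAdd t i) b =
      Fin.append (Function.update u i b) v := by
  funext j
  refine Fin.addCases (fun j => ?_) (fun j => ?_) j
  · simp [Function.update_apply]
  · have : Fin.natAdd s j ≠ Fin.castAdd t i := fun h => by
      have := congrArg Fin.val h
      simp at this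
      omega
    simp [this]

theorem update_append_right {s t : ℕ} (u : Fin s → Bool) (v : Fin t → Bool) (i : Fin t) (b : Bool) :
    Function.update (Fin.append u v) (Fin.natAdd s i) b =
      Fin.append u (Function.update v i b) := by
  funext j
  refine Fin.addCases (fun j => ?_) (fun j => ?_) j
  · have : Fin.castAdd t j ≠ Fin.natAdd s i := fun h => by
      have := congrArg Fin.val h
      simp at this
      omega
    simp [this]
  · simp [Function.update_apply]

theorem Circuit.stage_succ {s : ℕ} (C : Circuit ι ο s) (x : Bits ι) (k : Fin s) :
    C.stage x (k + 1) = Function.update (C.stage x k) k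
      ((C.gate k).op (Wire.read x (C.stage x k) (C.gate k).left)
        (Wire.read x (C.stage x k) (C.gate k).right)) := by
  rw [Circuit.stage]
  simp

/-- The first `s` gates of a circuit that starts with the gates of `C`. -/
theorem Circuit.stage_of_prefix {s t : ℕ} (C : Circuit ι ο s) (E : Circuit ι π (s + t))
    (hE : ∀ k, E.gate (Fin.castAdd t k) =
      (C.gate k).redirect (Sum.map id (Sum.map id (Fin.castAdd t)))) (x : Bits ι) :
    ∀ k ≤ s, E.stage x k = Fin.append (C.stage x k) (fun _ => false) := by
  have hread : ∀ (v : Fin s → Bool) (w : Wire ι s),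
      Wire.read x (Fin.append v (fun _ : Fin t => false))
        (Sum.map id (Sum.map id (Fin.castAdd t)) w) = Wire.read x v w := by
    rintro v (b | i | j) <;> simp [Wire.read]
  intro k
  induction k with
  | zero =>
    intro _
    funext j
    refine Fin.addCases (fun j => ?_) (fun j => ?_) j <;> simp [Circuit.stage]
  | succ k ih =>
    intro hk
    have h := ih (by omega)
    have h1 := E.stage_succ x (Fin.castAdd t ⟨k, hk⟩)
    have h2 := C.stage_succ x ⟨k, hk⟩
    simp only [Fin.val_castAdd] at h1 h2
    rw [h1, h2, h, hE, ← update_append_left]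
    simp only [BoolGate.redirect, hread]

/-- The remaining gates of a circuit that continues with the gates of `D`. -/
theorem Circuit.stage_of_suffix {s t : ℕ} (C : Circuit ι ο s) (D : Circuit ι' ο' t)
    (E : Circuit ι π (s + t))
    (hE : ∀ k, E.gate (Fin.castAdd t k) =
      (C.gate k).redirect (Sum.map id (Sum.map id (Fin.castAdd t))))
    (thru : Wire ι' t → Wire ι (s + t))
    (hE' : ∀ k, E.gate (Fin.natAdd s k) = (D.gate k).redirect thru) (x : Bits ι) (x' : Bits ι')
    (hthru : ∀ v w, Wire.read x (Fin.append (C.stage x s) v) (thru w) = Wire.read x' v w) :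
    ∀ j ≤ t, E.stage x (s + j) = Fin.append (C.stage x s) (D.stage x' j) := by
  intro k
  induction k with
  | zero =>
    intro _
    exact C.stage_of_prefix E hE x s le_rfl
  | succ k ih =>
    intro hk
    have h := ih (by omega)
    have h1 := E.stage_succ x (Fin.natAdd s ⟨k, hk⟩)
    have h2 := D.stage_succ x' ⟨k, hk⟩
    simp only [Fin.val_natAdd] at h1 h2
    rw [← Nat.add_assoc, h1, h2, h, hE', ← update_append_right]
    simp only [BoolGate.redirect, hthru]

theorem Circuit.eval_comp {s t : ℕ} (C : Circuit ι ο s) (D : Circuit ο π t) (x : Bits ι) :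
    (C.comp D).eval x = D.eval (C.eval x) := by
  have hread : ∀ (v : Fin t → Bool) (w : Wire ο t), Wire.read x (Fin.append (C.stage x s) v)
      (Sum.elim Sum.inl (Sum.elim (fun o => Sum.map id (Sum.map id (Fin.castAdd t)) (C.out o))
        (fun k => .inr (.inr (Fin.natAdd s k)))) w) = Wire.read (C.eval x) v w := by
    rintro v (b | i | j)
    · simp [Wire.read]
    · simp only [Sum.elim_inr, Sum.elim_inl, Wire.read, Circuit.eval]
      rcases C.out i with b | i | j <;> simp
    · simp [Wire.read]
  have := C.stage_of_suffix D (C.comp D) (fun k => by simp [Circuit.comp]) _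
    (fun k => by simp only [Circuit.comp, Fin.append_right]) x (C.eval x) hread t le_rfl
  funext o
  rw [Circuit.eval, this]
  exact hread _ _

theorem Circuit.eval_pair {s t : ℕ} (C : Circuit ι ο s) (D : Circuit ι ο' t) (x : Bits ι) :
    (C.pair D).eval x = Sum.elim (C.eval x) (D.eval x) := by
  have hread : ∀ (v : Fin t → Bool) (w : Wire ι t), Wire.read x (Fin.append (C.stage x s) v)
      (Sum.map id (Sum.map id (Fin.natAdd s)) w) = Wire.read x v w := by
    rintro v (b | i | j) <;> simp [Wire.read]
  have := C.stage_of_suffix D (C.pair D) (fun k => by simp [Circuit.pair]) _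
    (fun k => by simp only [Circuit.pair, Fin.append_right]) x x hread t le_rfl
  funext o
  rw [Circuit.eval, this]
  rcases o with o | o
  · simp only [Circuit.pair, Sum.elim_inl, Circuit.eval]
    rcases C.out o with b | i | j <;> simp [Wire.read]
  · exact hread _ _

theorem Circuit.eval_relabel {s : ℕ} (f : ι → ι') (C : Circuit ι ο s) (x : Bits ι') :
    (C.relabel f).eval x = C.eval (x ∘ f) := by
  have hread : ∀ (v : Fin s → Bool) (w : Wire ι s),
      Wire.read x v (Sum.map id (Sum.map f id) w) = Wire.read (x ∘ f) v w := by
    rintro v (b | i | j) <;> simp [Wire.read]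
  have h : ∀ k, (C.relabel f).stage x k = C.stage (x ∘ f) k := by
    intro k
    induction k with
    | zero => rfl
    | succ k ih =>
      have hg : ∀ k, (C.relabel f).gate k = (C.gate k).redirect (Sum.map id (Sum.map f id)) :=
        fun _ => rfl
      simp only [Circuit.stage, ih, hg, BoolGate.redirect, hread]
  funext o
  rw [Circuit.eval, h]
  exact hread _ _

theorem Circuit.eval_select (f : ο → ι) (x : Bits ι) : (Circuit.select f).eval x = x ∘ f := rfl

/-- The values of gates that do not read other gates. -/
theorem Circuit.stage_of_flat {s : ℕ} (C : Circuit ι ο s) (x : Bits ι) (val : Fin s → Bool)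
    (h : ∀ k v, (C.gate k).op (Wire.read x v (C.gate k).left) (Wire.read x v (C.gate k).right)
      = val k) : C.stage x s = val := by
  have : ∀ k ≤ s, C.stage x k = fun j : Fin s => if (j : ℕ) < k then val j else false := by
    intro k
    induction k with
    | zero => intro _; funext j; simp [Circuit.stage]
    | succ k ih =>
      intro hk
      have h1 := C.stage_succ x ⟨k, hk⟩
      simp only at h1
      rw [h1, h, ih (by omega)]
      funext j
      by_cases hj : j = ⟨k, hk⟩
      · subst hj; simp
      · have : (j : ℕ) ≠ k := fun hc => hj (Fin.ext hc)
        rw [Function.update_of_ne hj]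
        congr 1
        rw [eq_iff_iff]
        omega
  rw [this s le_rfl]
  funext j
  simp

theorem Circuit.eval_both (x : Bits (Unit ⊕ Unit)) :
    Circuit.both.eval x () = (x (.inl ()) && x (.inr ())) := by
  rw [Circuit.eval, Circuit.stage_of_flat _ _ (fun _ => x (.inl ()) && x (.inr ()))]
  · rfl
  · intro k v; rfl

theorem Circuit.eval_all (k : ℕ) (x : Bits (Fin k)) :
    (Circuit.all k).eval x () = true ↔ ∀ i, x i = true := by
  induction k with
  | zero => simp [Circuit.eval, Circuit.all, Wire.read]
  | succ k ih =>
    rw [Circuit.all, Circuit.eval_comp, Circuit.eval_both, Circuit.eval_pair,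
      Circuit.eval_relabel, Circuit.eval_select]
    simp only [Sum.elim_inl, Sum.elim_inr, Bool.and_eq_true, ih, Function.comp]
    rw [Fin.forall_fin_succ', and_comm, and_comm]

theorem Circuit.eval_equal (k : ℕ) (x : Bits (Fin k ⊕ Fin k)) :
    (Circuit.equal k).eval x () = true ↔ x ∘ Sum.inl = x ∘ Sum.inr := by
  rw [Circuit.equal, Circuit.eval_comp, Circuit.eval_all, funext_iff]
  refine forall_congr' fun i => ?_
  rw [Circuit.eval, Circuit.stage_of_flat _ _ (fun j => x (.inl j) == x (.inr j))]
  · simp [Wire.read]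
  · intro k v; rfl

/-- The function `f` is computed by a Boolean circuit with at most `N` gates. -/
def HasCircuit (f : Bits ι → Bits ο) (N : ℕ) : Prop :=
  ∃ s ≤ N, ∃ C : Circuit ι ο s, ∀ x, C.eval x = f x

theorem HasCircuit.mono {f : Bits ι → Bits ο} {N N' : ℕ} (h : HasCircuit f N) (hN : N ≤ N') :
    HasCircuit f N' :=
  let ⟨s, hs, C, hC⟩ := h
  ⟨s, hs.trans hN, C, hC⟩

theorem HasCircuit.congr {f g : Bits ι → Bits ο} {N : ℕ} (h : HasCircuit f N)
    (hg : ∀ x, g x = f x) : HasCircuit g N :=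
  let ⟨s, hs, C, hC⟩ := h
  ⟨s, hs, C, fun x => (hC x).trans (hg x).symm⟩

theorem Circuit.hasCircuit {s : ℕ} (C : Circuit ι ο s) : HasCircuit C.eval s :=
  ⟨s, le_rfl, C, fun _ => rfl⟩

/-- Every output bit is a constant or an input bit. -/
theorem HasCircuit.wires (f : ο → Bool ⊕ ι) :
    HasCircuit (fun (x : Bits ι) o => Sum.elim id x (f o)) 0 :=
  ⟨0, le_rfl, ⟨fun k => k.elim0, fun o => Sum.map id Sum.inl (f o)⟩, fun x => by
    funext o
    simp only [Circuit.eval]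
    rcases f o with b | i <;> simp [Wire.read]⟩

theorem HasCircuit.comp {f : Bits ι → Bits ο} {g : Bits ο → Bits π} {N M : ℕ}
    (hg : HasCircuit g M) (hf : HasCircuit f N) : HasCircuit (fun x => g (f x)) (N + M) := by
  obtain ⟨s, hs, C, hC⟩ := hf
  obtain ⟨t, ht, D, hD⟩ := hg
  exact ⟨s + t, by omega, C.comp D, fun x => by rw [Circuit.eval_comp, hC, hD]⟩

theorem HasCircuit.pair {f : Bits ι → Bits ο} {g : Bits ι → Bits ο'} {N M : ℕ}
    (hf : HasCircuit f N) (hg : HasCircuit g M) :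
    HasCircuit (fun x => Sum.elim (f x) (g x)) (N + M) := by
  obtain ⟨s, hs, C, hC⟩ := hf
  obtain ⟨t, ht, D, hD⟩ := hg
  exact ⟨s + t, by omega, C.pair D, fun x => by rw [Circuit.eval_pair, hC, hD]⟩

theorem HasCircuit.precomp {f : Bits ι → Bits ο} {N : ℕ} (hf : HasCircuit f N) (e : ι → ι') :
    HasCircuit (fun x : Bits ι' => f (x ∘ e)) N := by
  obtain ⟨s, hs, C, hC⟩ := hf
  exact ⟨s, hs, C.relabel e, fun x => by rw [Circuit.eval_relabel, hC]⟩

theorem HasCircuit.select (e : ο → ι) : HasCircuit (fun x : Bits ι => x ∘ e) 0 :=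
  (HasCircuit.wires fun p => Sum.inr (e p)).congr fun _ => rfl

theorem HasCircuit.const (a : Bits ο) : HasCircuit (fun _ : Bits ι => a) 0 :=
  (HasCircuit.wires fun p => Sum.inl (a p)).congr fun _ => rfl

/-- Every output bit is a function of two input bits. -/
theorem HasCircuit.layer [Fintype ο] (op : ο → Bool → Bool → Bool) (l r : ο → ι) :
    HasCircuit (fun (x : Bits ι) o => op o (x (l o)) (x (r o))) (Fintype.card ο) := by
  let e := Fintype.equivFin ο
  refine ⟨_, le_rfl, ⟨fun k => ⟨op (e.symm k), .inr (.inl (l (e.symm k))),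
    .inr (.inl (r (e.symm k)))⟩, fun o => .inr (.inr (e o))⟩, fun x => ?_⟩
  funext o
  rw [Circuit.eval, Circuit.stage_of_flat _ _
    (fun k => op (e.symm k) (x (l (e.symm k))) (x (r (e.symm k))))]
  · simp [Wire.read]
  · intro k v; rfl

/-- The choice between two strings by a bit. -/
def mux (b : Bool) (x y : Bits ο) : Bits ο := if b then y else x

theorem HasCircuit.mux [Fintype ο] (b : ι) (l r : ο → ι) :
    HasCircuit (fun x : Bits ι => mux (x b) (x ∘ l) (x ∘ r)) (3 * Fintype.card ο) := by
  have h1 := HasCircuit.layer (ι := ι) (ο := ο ⊕ ο)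
    (Sum.elim (fun _ b a => !b && a) (fun _ b a => b && a)) (fun _ => b) (Sum.elim l r)
  have h2 := HasCircuit.layer (ι := ο ⊕ ο) (ο := ο) (fun _ a b => a || b) Sum.inl Sum.inr
  refine ((h2.comp h1).mono ?_).congr fun x => ?_
  · simp; omega
  · funext o
    rcases x b with _ | _ <;> simp [SuccTest.mux]

theorem commitRelation_holds (H : HashFamily) (m κ : ℕ) (h : Bits (Fin (H.descLen m κ)))
    (c : Bits (Fin κ)) (w : Bits (Fin m)) :
    (commitRelation H m κ).Holds (Fin.append h c) w ↔ H.hash h w = c := by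
  rw [Relation.Holds, commitRelation, Circuit.eval_comp, Circuit.eval_equal, Circuit.eval_pair,
    Circuit.eval_relabel, Circuit.eval_select, HashFamily.hash]
  have h1 : (Sum.elim (Fin.append h c) w ∘ Sum.map (Fin.castAdd κ) id) = Sum.elim h w := by
    funext i; rcases i with i | i <;> simp
  have h2 : (Sum.elim (Fin.append h c) w ∘
      fun j => Sum.inl (Fin.natAdd (H.descLen m κ) j)) = c := by
    funext i; simp
  rw [h1, Sum.elim_comp_inl, Sum.elim_comp_inr, h2]

theorem openRelation_holds (H : HashFamily) (κ : ℕ) {n m s : ℕ} (R : Relation n m s)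
    (x : Bits (Fin n)) (h : Bits (Fin (H.descLen m κ))) (c : Bits (Fin κ)) (w : Bits (Fin m)) :
    (openRelation H κ R).Holds (Fin.append x (Fin.append h c)) w ↔
      R.Holds x w ∧ H.hash h w = c := by
  rw [Relation.Holds, openRelation, Circuit.eval_comp, Circuit.eval_both, Circuit.eval_pair,
    Circuit.eval_relabel, Circuit.eval_relabel]
  have h1 : (Sum.elim (Fin.append x (Fin.append h c)) w ∘ Sum.map (Fin.castAdd _) id) =
      Sum.elim x w := by
    funext i; rcases i with i | i <;> simp
  have h2 : (Sum.elim (Fin.append x (Fin.append h c)) w ∘ Sum.map (Fin.natAdd n) id) =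
      Sum.elim (Fin.append h c) w := by
    funext i; rcases i with i | i <;> simp
  rw [h1, h2, Bool.and_eq_true, Sum.elim_inl, Sum.elim_inr]
  exact and_congr Iff.rfl (commitRelation_holds H m κ h c w)

end Boolean

/-! ### Reversible evaluation of Boolean circuits -/

section Reversible

variable {W ι ο : Type} [Fintype W] [DecidableEq W] [Fintype ι] [DecidableEq ι] [Fintype ο]
  [DecidableEq ο]

/-- The gates that permute the computational basis. -/
def QGate.IsPerm : QGate W → Prop
  | .had _ => False
  | .tee _ => False
  | _ => True

/-- The action of a permutation gate on basis states. -/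
def QGate.act : QGate W → Bits W → Bits W
  | .flip i => fun g => Function.update g i (!(g i))
  | .cnot i j _ => fun g => Function.update g j (xor (g j) (g i))
  | .toffoli i j k _ _ _ => fun g => Function.update g k (xor (g k) (g i && g j))
  | _ => id

/-- The composite action of a list of permutation gates, the last one acting first. -/
def actAll (l : List (QGate W)) (f : Bits W) : Bits W := l.foldr QGate.act f

theorem actAll_append (l l' : List (QGate W)) (f : Bits W) :
    actAll (l ++ l') f = actAll l (actAll l' f) := List.foldr_append

theorem QGate.act_involutive (g : QGate W) : Function.Involutive g.act := by
  cases g with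
  | had i => exact fun _ => rfl
  | tee i => exact fun _ => rfl
  | flip i => exact flip_involutive i
  | cnot i j h => exact cnot_involutive h
  | toffoli i j k h₁ h₂ h₃ => exact toffoli_involutive h₂ h₃

theorem actAll_reverse (l : List (QGate W)) (f : Bits W) :
    actAll l.reverse (actAll l f) = f := by
  induction l with
  | nil => rfl
  | cons g l ih =>
    rw [List.reverse_cons, actAll_append]
    change actAll l.reverse (g.act (g.act (actAll l f))) = f
    rw [g.act_involutive, ih]

theorem conjBy_matrix_of_isPerm (g : QGate W) (hg : g.IsPerm) (M : Op W) (f f' : Bits W) :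
    conjBy g.matrix M f f' = M (g.act f) (g.act f') := by
  have hmat : ∀ f f', g.matrix f f' = if f' = g.act f then 1 else 0 := by
    intro f f'
    have hiff : f = g.act f' ↔ f' = g.act f := by
      constructor <;> · rintro rfl; rw [g.act_involutive]
    cases g with
    | had i => exact hg.elim
    | tee i => exact hg.elim
    | flip i => exact if_congr hiff rfl rfl
    | cnot i j h => exact if_congr hiff rfl rfl
    | toffoli i j k h₁ h₂ h₃ => exact if_congr hiff rfl rfl
  rw [conjBy_apply]
  simp only [hmat]
  rw [Finset.sum_eq_single (g.act f), Finset.sum_eq_single (g.act f')]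
  · simp
  · intro b _ hb; simp [hb]
  · simp
  · intro b _ hb; simp [hb]
  · simp

theorem conjBy_circuitMatrix_of_isPerm (l : List (QGate W)) (hl : ∀ g ∈ l, g.IsPerm) (M : Op W)
    (f f' : Bits W) : conjBy (circuitMatrix l) M f f' = M (actAll l f) (actAll l f') := by
  induction l generalizing M with
  | nil => rw [circuitMatrix, conjBy_one]; rfl
  | cons g l ih =>
    rw [circuitMatrix, conjBy_mul, ih (fun g hg => hl g (List.mem_cons_of_mem _ hg)),
      conjBy_matrix_of_isPerm g (hl g List.mem_cons_self)]
    rfl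

theorem basisState_apply (a b c : Bits W) :
    basisState a b c = if b = a ∧ c = a then 1 else 0 := by
  rw [basisState, Matrix.single_apply]
  exact if_congr (and_congr eq_comm eq_comm) rfl rfl

theorem ptr_apply {Z : Type} [Fintype Z] [DecidableEq Z] (M : Op (ο ⊕ Z)) (a b : Bits ο) :
    ptr M a b = ∑ z : Bits Z, M (Sum.elim a z) (Sum.elim b z) := rfl

theorem tensor_apply {ι' : Type} (M : Op ι) (N : Op ι') (f g : Bits (ι ⊕ ι')) :
    tensor M N f g = M (f ∘ Sum.inl) (g ∘ Sum.inl) * N (f ∘ Sum.inr) (g ∘ Sum.inr) := rfl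

/-- The gates `l` add the bit `v` to the qubit `t` and do not change the others. -/
structure XorsInto (t : W) (l : List (QGate W)) (v : Bits W → Bool) : Prop where
  isPerm : ∀ g ∈ l, g.IsPerm
  act : ∀ f, actAll l f = Function.update f t (xor (f t) (v f))
  indep : ∀ f b, v (Function.update f t b) = v f

theorem XorsInto.append {t : W} {l l' : List (QGate W)} {v v' : Bits W → Bool}
    (h : XorsInto t l v) (h' : XorsInto t l' v') :
    XorsInto t (l ++ l') fun f => xor (v' f) (v f) where
  isPerm g hg := (List.mem_append.1 hg).elim (h.isPerm g) (h'.isPerm g)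
  act f := by
    rw [actAll_append, h'.act, h.act, h.indep]
    simp
  indep f b := by rw [h.indep, h'.indep]

theorem XorsInto.nil (t : W) : XorsInto t [] fun _ => false :=
  ⟨by simp, fun f => by simp [actAll], fun _ _ => rfl⟩

theorem XorsInto.ite {t : W} {l : List (QGate W)} {v : Bits W → Bool} (h : XorsInto t l v)
    (b : Bool) : XorsInto t (if b then l else []) fun f => b && v f := by
  cases b
  · simpa using XorsInto.nil t
  · simpa using h

/-- A bit that can be added to the qubit `t`: a constant or another qubit. -/
abbrev Source (t : W) : Type := Bool ⊕ {p : W // p ≠ t}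

/-- The value of a source. -/
def Source.val {t : W} (f : Bits W) : Source t → Bool := Sum.elim id fun p => f p

/-- Gates that add a source to the qubit `t`. -/
def xorSource {t : W} : Source t → List (QGate W)
  | .inl false => []
  | .inl true => [.flip t]
  | .inr p => [.cnot p t p.2]

/-- Gates that add the conjunction of two sources to the qubit `t`. -/
def xorAnd {t : W} : Source t → Source t → List (QGate W)
  | .inl false, _ => []
  | .inl true, b => xorSource b
  | .inr _, .inl false => []
  | .inr p, .inl true => xorSource (.inr p)
  | .inr p, .inr q =>
    if h : (p : W) = q then xorSource (.inr p) else [.toffoli p q t h p.2 q.2]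

/-- Gates that add a function of two sources to the qubit `t`. -/
def xorOp {t : W} (op : Bool → Bool → Bool) (a b : Source t) : List (QGate W) :=
  (if op false false then xorSource (t := t) (.inl true) else []) ++
    ((if xor (op true false) (op false false) then xorSource a else []) ++
    ((if xor (op false true) (op false false) then xorSource b else []) ++
    (if xor (xor (op true true) (op true false)) (xor (op false true) (op false false)) then
      xorAnd a b else [])))

theorem Source.val_update {t : W} (f : Bits W) (b : Bool) (a : Source t) :
    a.val (Function.update f t b) = a.val f := by
  rcases a with a | a
  · rfl
  · simp [Source.val, a.2]

theorem xorsInto_xorSource {t : W} (a : Source t) : XorsInto t (xorSource a) fun f => a.val f := by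
  refine ⟨?_, fun f => ?_, fun f b => a.val_update f b⟩
  · rcases a with (_ | _) | a <;> simp [xorSource, QGate.IsPerm]
  · rcases a with (_ | _) | a <;> simp [xorSource, actAll, QGate.act, Source.val]

theorem xorsInto_xorAnd {t : W} (a b : Source t) :
    XorsInto t (xorAnd a b) fun f => a.val f && b.val f := by
  rcases a with (_ | _) | p
  · simpa [xorAnd, Source.val] using XorsInto.nil t
  · simpa [xorAnd, Source.val] using xorsInto_xorSource b
  · rcases b with (_ | _) | q
    · simpa [xorAnd, Source.val] using XorsInto.nil t
    · simpa [xorAnd, Source.val] using xorsInto_xorSource (.inr p)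
    · simp only [xorAnd]
      split_ifs with h
      · simpa [Source.val, h] using xorsInto_xorSource (.inr p)
      · refine ⟨by simp [QGate.IsPerm], fun f => by simp [actAll, QGate.act, Source.val],
          fun f b => ?_⟩
        rw [Source.val_update, Source.val_update]

theorem xorsInto_xorOp {t : W} (op : Bool → Bool → Bool) (a b : Source t) :
    XorsInto t (xorOp op a b) fun f => op (a.val f) (b.val f) := by
  have h := ((xorsInto_xorSource (t := t) (.inl true)).ite (op false false)).append
    (((xorsInto_xorSource a).ite (xor (op true false) (op false false))).append
    (((xorsInto_xorSource b).ite (xor (op false true) (op false false))).append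
    ((xorsInto_xorAnd a b).ite
      (xor (xor (op true true) (op true false)) (xor (op false true) (op false false))))))
  refine (funext fun f => ?_ : _ = fun f => op (a.val f) (b.val f)) ▸ h
  simp only [Source.val, Sum.elim_inl, id_eq]
  generalize Sum.elim id (fun p : {p : W // p ≠ t} => f p) a = x
  generalize Sum.elim id (fun p : {p : W // p ≠ t} => f p) b = y
  cases x <;> cases y <;> cases op false false <;> cases op false true <;>
    cases op true false <;> cases op true true <;> rfl

theorem length_xorSource {t : W} (a : Source t) : (xorSource a).length ≤ 1 := by
  rcases a with (_ | _) | a <;> simp [xorSource]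

theorem length_xorAnd {t : W} (a b : Source t) : (xorAnd a b).length ≤ 1 := by
  rcases a with (_ | _) | a
  · simp [xorAnd]
  · exact length_xorSource b
  · rcases b with (_ | _) | b
    · simp [xorAnd]
    · exact length_xorSource (.inr a)
    · simp only [xorAnd]
      split_ifs
      · exact length_xorSource (.inr a)
      · simp

theorem length_xorOp {t : W} (op : Bool → Bool → Bool) (a b : Source t) :
    (xorOp op a b).length ≤ 4 := by
  have hite : ∀ (c : Bool) (l : List (QGate W)), l.length ≤ 1 →
      (if c then l else []).length ≤ 1 := by
    intro c l hl; split_ifs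
    · exact hl
    · simp
  simp only [xorOp, List.length_append]
  have h1 := hite (op false false) _ (length_xorSource (W := W) (t := t) (.inl true))
  have h2 := hite (xor (op true false) (op false false)) _ (length_xorSource a)
  have h3 := hite (xor (op false true) (op false false)) _ (length_xorSource b)
  have h4 := hite (xor (xor (op true true) (op true false)) (xor (op false true) (op false false)))
    _ (length_xorAnd a b)
  omega

variable {s : ℕ}

/-- The source read by gate `k` on a wire; gate `k` itself has not been evaluated yet. -/
def gateSource (k : Fin s) : Wire ι s → Source (Sum.inr k : (ι ⊕ ο) ⊕ Fin s)
  | .inl b => .inl b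
  | .inr (.inl i) => .inr ⟨.inl (.inl i), by simp⟩
  | .inr (.inr j) => if h : j = k then .inl false else .inr ⟨.inr j, by simpa using h⟩

theorem gateSource_val (k : Fin s) (w : Wire ι s) (x : Bits ι) (y : Bits ο) (v : Fin s → Bool) :
    (gateSource k w).val (Sum.elim (Sum.elim x y) v) =
      Wire.read x (Function.update v k false) w := by
  rcases w with b | i | j
  · rfl
  · rfl
  · simp only [gateSource, Wire.read]
    split_ifs with h
    · subst h; simp [Source.val]
    · simp [Source.val, h]

/-- Reversible evaluation of gate `k`. -/
def gateList (C : Circuit ι ο s) (k : Fin s) : List (QGate ((ι ⊕ ο) ⊕ Fin s)) :=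
  xorOp (C.gate k).op (gateSource k (C.gate k).left) (gateSource k (C.gate k).right)

/-- Reversible evaluation of the first `k` gates. -/
def evalList (C : Circuit ι ο s) : ℕ → List (QGate ((ι ⊕ ο) ⊕ Fin s))
  | 0 => []
  | k + 1 => if h : k < s then gateList C ⟨k, h⟩ ++ evalList C k else evalList C k

/-- The values of the work qubits after the reversible evaluation of the first `k` gates. -/
def evalWork (C : Circuit ι ο s) (x : Bits ι) (v : Fin s → Bool) : ℕ → Fin s → Bool
  | 0 => v
  | k + 1 =>
    let u := evalWork C x v k
    if h : k < s then
      Function.update u ⟨k, h⟩ (xor (u ⟨k, h⟩)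
        ((C.gate ⟨k, h⟩).op (Wire.read x (Function.update u ⟨k, h⟩ false) (C.gate ⟨k, h⟩).left)
          (Wire.read x (Function.update u ⟨k, h⟩ false) (C.gate ⟨k, h⟩).right)))
    else u

theorem isPerm_evalList (C : Circuit ι ο s) (k : ℕ) : ∀ g ∈ evalList C k, g.IsPerm := by
  induction k with
  | zero => simp [evalList]
  | succ k ih =>
    simp only [evalList]
    split_ifs with h
    · intro g hg
      exact (List.mem_append.1 hg).elim ((xorsInto_xorOp _ _ _).isPerm g) (ih g)
    · exact ih

theorem length_evalList (C : Circuit ι ο s) (k : ℕ) : (evalList C k).length ≤ 4 * k := by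
  induction k with
  | zero => simp [evalList]
  | succ k ih =>
    simp only [evalList]
    split_ifs with h
    · have : (gateList C ⟨k, h⟩).length ≤ 4 := length_xorOp _ _ _
      simp only [List.length_append]
      omega
    · omega

theorem actAll_evalList (C : Circuit ι ο s) (x : Bits ι) (y : Bits ο) (v : Fin s → Bool) (k : ℕ) :
    actAll (evalList C k) (Sum.elim (Sum.elim x y) v) =
      Sum.elim (Sum.elim x y) (evalWork C x v k) := by
  induction k with
  | zero => rfl
  | succ k ih =>
    simp only [evalList, evalWork]
    split_ifs with h
    · rw [actAll_append, ih, gateList, (xorsInto_xorOp _ _ _).act, gateSource_val, gateSource_val,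
        Sum.elim_inr, Sum.update_elim_inr]
    · exact ih

theorem Circuit.stage_eq_false (C : Circuit ι ο s) (x : Bits ι) (k : ℕ) (j : Fin s)
    (hj : k ≤ j) : C.stage x k j = false := by
  induction k with
  | zero => rfl
  | succ k ih =>
    simp only [Circuit.stage]
    split_ifs with h
    · rw [Function.update_of_ne]
      · exact ih (by omega)
      · rintro rfl; simp at hj
    · exact ih (by omega)

theorem evalWork_false (C : Circuit ι ο s) (x : Bits ι) (k : ℕ) :
    evalWork C x (fun _ => false) k = C.stage x k := by
  induction k with
  | zero => rfl
  | succ k ih =>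
    simp only [evalWork, Circuit.stage, ih]
    split_ifs with h
    · have h0 := C.stage_eq_false x k ⟨k, h⟩ le_rfl
      have : Function.update (C.stage x k) ⟨k, h⟩ false = C.stage x k := by
        rw [← h0, Function.update_eq_self]
      rw [this, h0, Bool.false_xor]
    · rfl

/-- The source of an output bit. -/
def outSource (o : ο) : Wire ι s → Source (Sum.inl (Sum.inr o) : (ι ⊕ ο) ⊕ Fin s)
  | .inl b => .inl b
  | .inr (.inl i) => .inr ⟨.inl (.inl i), by simp⟩
  | .inr (.inr j) => .inr ⟨.inr j, by simp⟩

theorem outSource_val (o : ο) (w : Wire ι s) (x : Bits ι) (y : Bits ο) (v : Fin s → Bool) :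
    (outSource o w).val (Sum.elim (Sum.elim x y) v) = Wire.read x v w := by
  rcases w with b | i | j <;> rfl

/-- Adding the outputs `os` of an evaluated circuit to the output register. -/
def outList (C : Circuit ι ο s) (os : List ο) : List (QGate ((ι ⊕ ο) ⊕ Fin s)) :=
  os.flatMap fun o => xorSource (outSource o (C.out o))

theorem isPerm_outList (C : Circuit ι ο s) (os : List ο) : ∀ g ∈ outList C os, g.IsPerm := by
  intro g hg
  obtain ⟨o, _, ho⟩ := List.mem_flatMap.1 hg
  exact (xorsInto_xorSource _).isPerm g ho

theorem length_outList (C : Circuit ι ο s) (os : List ο) : (outList C os).length ≤ os.length := by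
  induction os with
  | nil => simp [outList]
  | cons o os ih =>
    have := length_xorSource (outSource o (C.out o))
    simp only [outList, List.flatMap_cons, List.length_append, List.length_cons] at ih ⊢
    omega

theorem actAll_outList (C : Circuit ι ο s) (x : Bits ι) (y : Bits ο) (v : Fin s → Bool)
    (os : List ο) (hos : os.Nodup) :
    actAll (outList C os) (Sum.elim (Sum.elim x y) v) = Sum.elim (Sum.elim x
      fun o => if o ∈ os then xor (y o) (Wire.read x v (C.out o)) else y o) v := by
  induction os with
  | nil => simp [outList, actAll]
  | cons o os ih =>
    have hcons : outList C (o :: os) = xorSource (outSource o (C.out o)) ++ outList C os := by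
      simp [outList]
    rw [List.nodup_cons] at hos
    rw [hcons, actAll_append, ih hos.2, (xorsInto_xorSource _).act, outSource_val, Sum.elim_inl,
      Sum.elim_inr, if_neg hos.1, Sum.update_elim_inl, Sum.update_elim_inr]
    congr 2
    funext o'
    by_cases h : o' = o
    · subst h; simp
    · simp [h]

/-- Adding `f x` to the second register, where `x` is the content of the first. -/
def xorMap (f : Bits ι → Bits ο) (a : Bits (ι ⊕ ο)) : Bits (ι ⊕ ο) :=
  Sum.elim (a ∘ Sum.inl) fun o => xor (a (Sum.inr o)) (f (a ∘ Sum.inl) o)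

/-- Conjugation by the unitary `|x, y⟩ ↦ |x, y ⊕ f x⟩`. -/
def xorInto (f : Bits ι → Bits ο) (M : Op (ι ⊕ ο)) : Op (ι ⊕ ο) :=
  fun a b => M (xorMap f a) (xorMap f b)

/-- Evaluating a circuit on ancillas, copying its output and evaluating it backwards implements
the unitary `|x, y⟩ ↦ |x, y ⊕ f x⟩` exactly. -/
theorem Eff.xorInto {f : Bits ι → Bits ο} {N : ℕ} (hf : HasCircuit f N) :
    Eff (xorInto f) (9 * N + Fintype.card ο) := by
  obtain ⟨s, hs, C, hC⟩ := hf
  let os := (Finset.univ : Finset ο).toList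
  let l := (evalList C s).reverse ++ (outList C os ++ evalList C s)
  have hperm : ∀ g ∈ l, g.IsPerm := by
    intro g hg
    simp only [l, List.mem_append, List.mem_reverse] at hg
    rcases hg with h | h | h
    · exact isPerm_evalList C s g h
    · exact isPerm_outList C os g h
    · exact isPerm_evalList C s g h
  have hact : ∀ (a : Bits (ι ⊕ ο)) (v : Fin s → Bool), actAll l (Sum.elim a v) =
      Sum.elim (Sum.elim (a ∘ Sum.inl) fun o => xor (a (Sum.inr o))
        (Wire.read (a ∘ Sum.inl) (evalWork C (a ∘ Sum.inl) v s) (C.out o))) v := by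
    intro a v
    have ha : a = Sum.elim (a ∘ Sum.inl) (a ∘ Sum.inr) := (Sum.elim_comp_inl_inr a).symm
    conv_lhs => rw [ha]
    rw [actAll_append, actAll_append, actAll_evalList, actAll_outList _ _ _ _ _
      (Finset.nodup_toList _)]
    simp only [Finset.mem_toList, Finset.mem_univ, if_true]
    rw [← actAll_evalList C _ _ v, actAll_reverse]
    rfl
  have hσ := isDensity_basisState (fun _ : Fin s => false)
  refine Eff.of_normalForm (A := Fin s) (Z := Fin s) hσ l (Equiv.refl _) ?_ fun M => ?_
  · have h1 := length_evalList C s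
    have h2 := length_outList C os
    have h3 : os.length = Fintype.card ο := by simp [os]
    simp only [l, List.length_append, List.length_reverse, Fintype.card_fin]
    omega
  · funext a b
    rw [relabel_refl, ptr_apply]
    simp only [conjBy_circuitMatrix_of_isPerm l hperm, hact, tensor_apply, Sum.elim_comp_inl,
      Sum.elim_comp_inr, basisState_apply, and_self]
    rw [Finset.sum_eq_single (fun _ => false)]
    · simp only [if_true, mul_one, evalWork_false, SuccTest.xorInto, xorMap, ← hC]
      rfl
    · intro v _ hv
      simp [hv]
    · simp

end Reversible

/-! ### Channels with classical parameters -/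

section Parameters

variable {γ γ' ν β ι ι' ο Z A π : Type}
  [Fintype ι] [DecidableEq ι] [Fintype ι'] [DecidableEq ι'] [Fintype ο] [DecidableEq ο]
  [Fintype Z] [DecidableEq Z] [Fintype A] [DecidableEq A] [Fintype π] [DecidableEq π]
  [Fintype γ] [DecidableEq γ] [Fintype γ'] [DecidableEq γ'] [Fintype β] [DecidableEq β]
  [Fintype ν] [DecidableEq ν]

/-- The isometry `|x⟩ ↦ |x, f x⟩`, as a channel. -/
def compute (f : Bits ι → Bits ο) (M : Op ι) : Op (ι ⊕ ο) := fun a b =>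
  if a ∘ Sum.inr = f (a ∘ Sum.inl) ∧ b ∘ Sum.inr = f (b ∘ Sum.inl) then
    M (a ∘ Sum.inl) (b ∘ Sum.inl) else 0

theorem compute_apply (f : Bits ι → Bits ο) (M : Op ι) (a b : Bits (ι ⊕ ο)) :
    compute f M a b = if a ∘ Sum.inr = f (a ∘ Sum.inl) ∧ b ∘ Sum.inr = f (b ∘ Sum.inl) then
      M (a ∘ Sum.inl) (b ∘ Sum.inl) else 0 := rfl

theorem relabel_apply (e : ι ≃ ι') (M : Op ι) (f g : Bits ι') :
    relabel e M f g = M (f ∘ e) (g ∘ e) := rfl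

theorem outcome_apply (b : Bits β) (M : Op (ι ⊕ β)) (f g : Bits ι) :
    outcome b M f g = M (Sum.elim f b) (Sum.elim g b) := rfl

theorem xor_eq_false_iff_funext (u v : Bits ο) :
    (fun o => xor (u o) (v o)) = (fun _ => false) ↔ u = v := by
  simp [funext_iff]

theorem Eff.compute {f : Bits ι → Bits ο} {N : ℕ} (hf : HasCircuit f N) :
    Eff (compute f) (9 * N + 2 * Fintype.card ο) := by
  refine (((Eff.xorInto hf).comp (Eff.id.then_tensor
    (isDensity_basisState fun _ : ο => false))).mono (by omega)).congr fun M => ?_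
  funext a b
  rw [compute_apply, SuccTest.xorInto, tensor_apply, basisState_apply]
  simp only [xorMap, Sum.elim_comp_inl, Sum.elim_comp_inr]
  have h : ∀ a : Bits (ι ⊕ ο), (fun o => xor (a (Sum.inr o)) (f (a ∘ Sum.inl) o)) = (fun _ => false)
      ↔ a ∘ Sum.inr = f (a ∘ Sum.inl) := fun a => xor_eq_false_iff_funext (a ∘ Sum.inr) _
  simp [h]

theorem relabel_sumComm_tensor (M : Op ι) (N : Op ι') :
    relabel (Equiv.sumComm ι ι') (tensor M N) = tensor N M := by
  funext f g
  rw [relabel_apply, tensor_apply, tensor_apply, mul_comm]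
  rfl

/-- Copying a classical parameter. -/
theorem compute_inl_tensor (g : Bits γ) (ρ : Op ι) :
    compute (fun a => a ∘ Sum.inl) (tensor (basisState g) ρ) =
      tensor (tensor (basisState g) ρ) (basisState g) := by
  funext a b
  rw [compute_apply, tensor_apply, tensor_apply, tensor_apply, basisState_apply, basisState_apply]
  by_cases h1 : (a ∘ Sum.inl) ∘ Sum.inl = g <;> by_cases h2 : (b ∘ Sum.inl) ∘ Sum.inl = g <;>
    simp [h1, h2]

/-- The maps `Φ g`, for classical bits `g`, are given by a quantum operation of size at most `N`
that is applied to `|g⟩⟨g|` and the input. -/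
def EffC (Φ : Bits γ → Op ι → Op ο) (N : ℕ) : Prop :=
  ∃ Θ : Op (γ ⊕ ι) → Op ο, Eff Θ N ∧ ∀ g ρ, Θ (tensor (basisState g) ρ) = Φ g ρ

theorem EffC.mono {Φ : Bits γ → Op ι → Op ο} {N N' : ℕ} (h : EffC Φ N) (hN : N ≤ N') :
    EffC Φ N' :=
  let ⟨Θ, hΘ, hΦ⟩ := h
  ⟨Θ, hΘ.mono hN, hΦ⟩

theorem EffC.congr {Φ Ψ : Bits γ → Op ι → Op ο} {N : ℕ} (h : EffC Φ N)
    (hΨ : ∀ g ρ, Ψ g ρ = Φ g ρ) : EffC Ψ N :=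
  let ⟨Θ, hΘ, hΦ⟩ := h
  ⟨Θ, hΘ, fun g ρ => (hΦ g ρ).trans (hΨ g ρ).symm⟩

/-- For each value of the parameter the map is a channel. -/
theorem EffC.eff {Φ : Bits γ → Op ι → Op ο} {N : ℕ} (h : EffC Φ N) (g : Bits γ) :
    Eff (Φ g) (N + Fintype.card γ) := by
  obtain ⟨Θ, hΘ, hΦ⟩ := h
  refine ((hΘ.comp ((Eff.id.then_tensor (isDensity_basisState g)).then_relabel
    (Equiv.sumComm ι γ))).mono (by omega)).congr fun ρ => ?_
  rw [relabel_sumComm_tensor, hΦ]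

theorem EffC.of_eff {Φ : Op ι → Op ο} {N : ℕ} (h : Eff Φ N) :
    EffC (fun _ : Bits γ => Φ) N := by
  refine ⟨_, (h.comp ((Eff.id.then_relabel (Equiv.sumComm γ ι)).then_ptr)).mono (by omega),
    fun g ρ => ?_⟩
  rw [relabel_sumComm_tensor, ptr_tensor, (isDensity_basisState g).2, one_smul]

theorem EffC.of_right {Θ : Op (ι ⊕ γ) → Op ο} {N : ℕ} (h : Eff Θ N) :
    EffC (fun (g : Bits γ) ρ => Θ (tensor ρ (basisState g))) N :=
  ⟨_, (h.comp (Eff.id.then_relabel (Equiv.sumComm γ ι))).mono (by omega), fun g ρ => by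
    rw [relabel_sumComm_tensor]⟩

/-- A channel with classical parameters, written as a quantum operation with the parameters in the
second register. -/
theorem EffC.exists_qop {Φ : Bits γ → Op ι → Op ο} {N : ℕ} (h : EffC Φ N) :
    ∃ Q : QOp (ι ⊕ γ) ο, Q.size ≤ N ∧ ∀ g ρ, Q.apply (tensor ρ (basisState g)) = Φ g ρ := by
  obtain ⟨Θ, hΘ, hΦ⟩ := h
  obtain ⟨Q, hQ, h⟩ := hΘ.comp (Eff.id.then_relabel (Equiv.sumComm ι γ))
  exact ⟨Q, by omega, fun g ρ => (h _).trans (by beta_reduce; rw [relabel_sumComm_tensor, hΦ])⟩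

theorem EffC.exists_qop_left {Φ : Bits γ → Op ι → Op ο} {N : ℕ} (h : EffC Φ N) :
    ∃ Q : QOp (γ ⊕ ι) ο, Q.size ≤ N ∧ ∀ g ρ, Q.apply (tensor (basisState g) ρ) = Φ g ρ := by
  obtain ⟨Θ, ⟨Q, hQ, h⟩, hΦ⟩ := h
  exact ⟨Q, hQ, fun g ρ => by rw [h, hΦ]⟩

/-- A state prepared from classical parameters. -/
theorem EffC.exists_qop_state {Φ : Bits γ → Op ι → Op ο} {N : ℕ} (h : EffC Φ N) {σ : Op ι}
    (hσ : IsDensity σ) :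
    ∃ Q : QOp γ ο, Q.size ≤ N + Fintype.card ι ∧ ∀ g, Q.apply (basisState g) = Φ g σ := by
  obtain ⟨Θ, hΘ, hΦ⟩ := h
  obtain ⟨Q, hQ, h⟩ := hΘ.comp (Eff.id.then_tensor hσ)
  exact ⟨Q, by omega, fun g => (h _).trans (hΦ g σ)⟩

theorem EffC.trace {Φ : Bits γ → Op ι → Op ο} {N : ℕ} (h : EffC Φ N) (g : Bits γ) (ρ : Op ι) :
    (Φ g ρ).trace = ρ.trace := (h.eff g).trace ρ

theorem EffC.comp {Φ : Bits γ → Op ι → Op ο} {Ψ : Bits γ → Op ο → Op π} {N N' : ℕ}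
    (hΨ : EffC Ψ N') (hΦ : EffC Φ N) :
    EffC (fun g ρ => Ψ g (Φ g ρ)) (N + N' + 2 * Fintype.card γ) := by
  obtain ⟨Θ, hΘ, hΦ⟩ := hΦ
  obtain ⟨Θ', hΘ', hΨ⟩ := hΨ
  have h1 := Eff.compute (HasCircuit.select (Sum.inl : γ → γ ⊕ ι))
  have h2 := hΘ'.comp ((hΘ.ext.comp h1).then_relabel (Equiv.sumComm ο γ))
  refine ⟨_, h2.mono (by omega), fun g ρ => ?_⟩
  rw [compute_inl_tensor, ext_tensor_left hΘ.smul, relabel_sumComm_tensor, hΦ, hΨ]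

/-- Discarding the first of three registers. -/
def dropFirst (γ ι β : Type) : (γ ⊕ ι) ⊕ β ≃ (ι ⊕ β) ⊕ γ where
  toFun := Sum.elim (Sum.elim .inr (fun i => .inl (.inl i))) (fun b => .inl (.inr b))
  invFun := Sum.elim (Sum.elim (fun i => .inl (.inr i)) .inr) (fun g => .inl (.inl g))
  left_inv := by rintro ((_ | _) | _) <;> rfl
  right_inv := by rintro ((_ | _) | _) <;> rfl

/-- Coherent evaluation of a function of the parameters and the content of the register. -/
theorem EffC.compute {p : Bits (γ ⊕ ι) → Bits β} {N : ℕ} (hp : HasCircuit p N) :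
    EffC (fun (g : Bits γ) (M : Op ι) => SuccTest.compute (fun a => p (Sum.elim g a)) M)
      (9 * N + 2 * Fintype.card β) := by
  refine ⟨_, ((Eff.compute hp).then_relabel (dropFirst γ ι β)).then_ptr, fun g M => ?_⟩
  beta_reduce
  funext a b
  rw [ptr_apply, Finset.sum_eq_single g]
  · rw [relabel_apply, compute_apply, compute_apply, tensor_apply, basisState_apply]
    have h : ∀ a : Bits (ι ⊕ β), (Sum.elim a g ∘ dropFirst γ ι β) ∘ Sum.inl =
        Sum.elim g (a ∘ Sum.inl) := fun a => by ext (_ | _) <;> rfl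
    have h' : ∀ a : Bits (ι ⊕ β), (Sum.elim a g ∘ dropFirst γ ι β) ∘ Sum.inr = a ∘ Sum.inr :=
      fun a => rfl
    simp only [h, h', Sum.elim_comp_inl, Sum.elim_comp_inr, and_self, if_true, one_mul]
  · intro z _ hz
    rw [relabel_apply, compute_apply, tensor_apply, basisState_apply]
    have h : ((Sum.elim a z ∘ dropFirst γ ι β) ∘ Sum.inl) ∘ Sum.inl = z := rfl
    simp [h, hz]
  · simp

theorem EffC.emit : EffC (fun (g : Bits γ) (ρ : Op ι) => tensor ρ (basisState g)) 0 :=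
  EffC.of_right Eff.id

/-- A parameter that is computed from other parameters. -/
theorem EffC.precomp {Φ : Bits γ → Op ι → Op ο} {N N' : ℕ} (h : EffC Φ N)
    {f : Bits γ' → Bits γ} (hf : HasCircuit f N') :
    EffC (fun g ρ => Φ (f g) ρ) (N + 9 * N' + 2 * Fintype.card γ) := by
  obtain ⟨Θ, hΘ, hΦ⟩ := h
  obtain ⟨Θ', hΘ', hf'⟩ := EffC.compute (ι := ι) ((hf.precomp (Sum.inl : γ' → γ' ⊕ ι)))
  refine ⟨_, (hΘ.comp (hΘ'.then_relabel (Equiv.sumComm ι γ))).mono (by omega), fun g ρ => ?_⟩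
  beta_reduce
  rw [hf', ← hΦ, ← relabel_sumComm_tensor]
  congr 2
  beta_reduce
  funext a b
  rw [compute_apply, tensor_apply, basisState_apply, Sum.elim_comp_inl]
  by_cases h1 : a ∘ Sum.inr = f g <;> by_cases h2 : b ∘ Sum.inr = f g <;> simp [h1, h2]

theorem EffC.ext {Φ : Bits γ → Op ι → Op ο} {N : ℕ} (h : EffC Φ N) :
    EffC (fun g => (SuccTest.ext (Φ g) : Op (ι ⊕ Z) → Op (ο ⊕ Z))) N := by
  obtain ⟨Θ, hΘ, hΦ⟩ := h
  refine ⟨_, (hΘ.ext.comp (Eff.id.then_relabel (Equiv.sumAssoc γ ι Z).symm)).mono (by omega),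
    fun g M => ?_⟩
  funext a b
  simp only [SuccTest.ext]
  rw [← hΦ]
  congr 1
  funext c d
  simp only [block_apply, relabel_apply, tensor_apply]
  congr 2 <;> · ext (_ | _) <;> rfl

/-- Moving a measured register to the parameters. -/
def toParam (γ ο β : Type) : γ ⊕ (ο ⊕ β) ≃ (γ ⊕ β) ⊕ ο where
  toFun := Sum.elim (fun g => .inl (.inl g)) (Sum.elim .inr (fun b => .inl (.inr b)))
  invFun := Sum.elim (Sum.elim .inl (fun b => .inr (.inr b))) (fun o => .inr (.inl o))
  left_inv := by rintro (_ | _ | _) <;> rfl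
  right_inv := by rintro ((_ | _) | _) <;> rfl

/-- Measuring a register, and using the outcome as a parameter. -/
theorem EffC.read {Ψ : Bits (γ ⊕ β) → Op ο → Op π} {N : ℕ} (h : EffC Ψ N) :
    EffC (fun g (M : Op (ο ⊕ β)) => ∑ b, Ψ (Sum.elim g b) (outcome b M))
      (N + 2 * Fintype.card β) := by
  obtain ⟨Θ, hΘ, hΨ⟩ := h
  have h1 := Eff.compute (HasCircuit.select (fun b => Sum.inr (Sum.inr b) : β → γ ⊕ (ο ⊕ β)))
  refine ⟨_, (hΘ.comp (h1.then_ptr.then_relabel (toParam γ ο β))).mono (by omega), fun g M => ?_⟩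
  simp only [← hΨ]
  rw [← hΘ.sum]
  congr 1
  funext a b
  rw [relabel_apply, ptr_apply, Matrix.sum_apply]
  refine Finset.sum_congr rfl fun z _ => ?_
  rw [compute_apply, tensor_apply, tensor_apply, basisState_apply, basisState_apply, outcome_apply]
  simp only [Sum.elim_comp_inl, Sum.elim_comp_inr]
  have key : ∀ a : Bits ((γ ⊕ β) ⊕ ο), a ∘ Sum.inl = Sum.elim g z ↔
      (a ∘ toParam γ ο β) ∘ Sum.inl = g ∧
      z = (a ∘ toParam γ ο β) ∘ fun b => Sum.inr (Sum.inr b) := by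
    intro a
    constructor
    · intro h
      exact ⟨funext fun i => congrFun h (.inl i), funext fun i => (congrFun h (.inr i)).symm⟩
    · rintro ⟨h1, h2⟩
      ext (i | i)
      · exact congrFun h1 i
      · exact (congrFun h2 i).symm
  have key2 : ∀ a : Bits ((γ ⊕ β) ⊕ ο), z = (a ∘ toParam γ ο β) ∘ (fun b => Sum.inr (Sum.inr b)) →
      (a ∘ toParam γ ο β) ∘ Sum.inr = Sum.elim (a ∘ Sum.inr) z := by
    rintro a rfl
    ext (_ | _) <;> rfl
  by_cases ha : z = (a ∘ toParam γ ο β) ∘ fun b => Sum.inr (Sum.inr b)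
  · by_cases hb : z = (b ∘ toParam γ ο β) ∘ fun b => Sum.inr (Sum.inr b)
    · refine (if_pos ⟨ha, hb⟩).trans ?_
      rw [key2 a ha, key2 b hb]
      congr 1
      refine if_congr (and_congr ?_ ?_) rfl rfl
      · rw [key]; exact (and_iff_left ha).symm
      · rw [key]; exact (and_iff_left hb).symm
    · have : ¬ b ∘ Sum.inl = Sum.elim g z := fun h => hb ((key b).1 h).2
      rw [if_neg (fun h => this h.2), zero_mul]
      exact if_neg fun h => hb h.2
  · have : ¬ a ∘ Sum.inl = Sum.elim g z := fun h => ha ((key a).1 h).2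
    rw [if_neg (c := a ∘ Sum.inl = Sum.elim g z ∧ b ∘ Sum.inl = Sum.elim g z) (fun h => this h.1),
      zero_mul]
    exact if_neg fun h => ha h.1

theorem EffC.bind {Φ : Bits γ → Op ι → Op (ο ⊕ β)} {Ψ : Bits (γ ⊕ β) → Op ο → Op π} {N N' : ℕ}
    (hΦ : EffC Φ N) (hΨ : EffC Ψ N') :
    EffC (fun g ρ => ∑ b, Ψ (Sum.elim g b) (outcome b (Φ g ρ)))
      (N + N' + 2 * Fintype.card β + 2 * Fintype.card γ) :=
  (hΨ.read.comp hΦ).mono (by omega)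

/-- The maximally mixed state. -/
noncomputable def uniformState (ν : Type) [Fintype ν] [DecidableEq ν] : Op ν :=
  ((2 : ℂ) ^ Fintype.card ν)⁻¹ • (1 : Op ν)

theorem isDensity_uniformState : IsDensity (uniformState ν) := by
  have h2 : (0 : ℂ) ≤ ((2 : ℂ) ^ Fintype.card ν)⁻¹ := by
    have : ((2 : ℂ) ^ Fintype.card ν)⁻¹ = (((2 : ℝ) ^ Fintype.card ν)⁻¹ : ℝ) := by push_cast; rfl
    rw [this]
    exact Complex.zero_le_real.2 (by positivity)
  refine ⟨Matrix.PosSemidef.one.smul h2, ?_⟩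
  rw [uniformState, Matrix.trace_smul, Matrix.trace_one]
  simp

/-- Uniformly random bits as a parameter. -/
theorem EffC.random {Ψ : Bits (γ ⊕ ν) → Op ι → Op ο} {N : ℕ} (h : EffC Ψ N) :
    EffC (fun g ρ => ((2 : ℂ) ^ Fintype.card ν)⁻¹ • ∑ r, Ψ (Sum.elim g r) ρ)
      (N + 3 * Fintype.card ν + 2 * Fintype.card γ) := by
  have h1 : EffC (fun (_ : Bits γ) (ρ : Op ι) => tensor ρ (uniformState ν)) (0 + Fintype.card ν) :=
    EffC.of_eff (Eff.id.then_tensor isDensity_uniformState)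
  refine ((h1.bind h).mono (by omega)).congr fun g ρ => ?_
  rw [Finset.smul_sum]
  refine Finset.sum_congr rfl fun r _ => ?_
  have : outcome r (tensor ρ (uniformState ν)) = ((2 : ℂ) ^ Fintype.card ν)⁻¹ • ρ := by
    funext a b
    rw [outcome_apply, tensor_apply, Sum.elim_comp_inl, Sum.elim_comp_inl, Sum.elim_comp_inr,
      Sum.elim_comp_inr, uniformState, Matrix.smul_apply, Matrix.smul_apply, Matrix.one_apply_eq,
      smul_eq_mul, smul_eq_mul, mul_one, mul_comm]
  rw [this, (h.eff _).smul]

/-- Appending classical bits that are computed from the parameters. -/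
theorem EffC.append {f : Bits γ → Bits β} {N : ℕ} (hf : HasCircuit f N) :
    EffC (fun g (ρ : Op ι) => tensor ρ (basisState (f g))) (9 * N + 2 * Fintype.card β) :=
  (EffC.emit.precomp hf).mono (by omega)

theorem outcome_posSemidef (b : Bits β) {M : Op (ι ⊕ β)} (hM : M.PosSemidef) :
    (outcome b M).PosSemidef := hM.submatrix fun f => Sum.elim f b

theorem sum_trace_outcome (M : Op (ι ⊕ β)) : ∑ b, (outcome b M).trace = M.trace := by
  simp only [Matrix.trace, Matrix.diag, outcome_apply]
  rw [sum_bits_sum (fun f => M f f), Finset.sum_comm]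

theorem outcome_tensor_basisState (ρ : Op ι) (a b : Bits β) :
    outcome b (tensor ρ (basisState a)) = if b = a then ρ else 0 := by
  funext f g
  rw [outcome_apply, tensor_apply, basisState_apply]
  by_cases h : b = a <;> simp [h]

theorem outcome_add (b : Bits β) (M N : Op (ι ⊕ β)) :
    outcome b (M + N) = outcome b M + outcome b N := rfl

theorem outcome_smul (b : Bits β) (c : ℂ) (M : Op (ι ⊕ β)) :
    outcome b (c • M) = c • outcome b M := rfl

theorem outcome_sum (b : Bits β) {κ : Type*} (s : Finset κ) (F : κ → Op (ι ⊕ β)) :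
    outcome b (∑ i ∈ s, F i) = ∑ i ∈ s, outcome b (F i) := by
  funext f g
  simp only [outcome_apply, Matrix.sum_apply]

end Parameters

/-! ### Probabilities of measurement outcomes, gentle measurement -/

section Prob

variable {ι ο Z : Type} [Fintype ι] [DecidableEq ι] [Fintype ο] [DecidableEq ο] [Fintype Z]
  [DecidableEq Z]

/-- The probability that measuring `τ` gives an outcome with the property `p`. -/
noncomputable def prob (τ : Op ο) (p : Bits ο → Prop) [DecidablePred p] : ℝ :=
  ∑ w, if p w then (τ w w).re else 0

theorem diag_re_nonneg {τ : Op ο} (hτ : τ.PosSemidef) (w : Bits ο) : 0 ≤ (τ w w).re :=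
  (Complex.le_def.1 (hτ.diag_nonneg (i := w))).1

theorem prob_nonneg {τ : Op ο} (hτ : τ.PosSemidef) (p : Bits ο → Prop) [DecidablePred p] :
    0 ≤ prob τ p :=
  Finset.sum_nonneg fun w _ => by split_ifs; exacts [diag_re_nonneg hτ w, le_rfl]

theorem prob_mono {τ : Op ο} (hτ : τ.PosSemidef) {p q : Bits ο → Prop} [DecidablePred p]
    [DecidablePred q] (h : ∀ w, p w → q w) : prob τ p ≤ prob τ q :=
  Finset.sum_le_sum fun w _ => by
    by_cases hp : p w
    · rw [if_pos hp, if_pos (h w hp)]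
    · rw [if_neg hp]; split_ifs; exacts [diag_re_nonneg hτ w, le_rfl]

theorem trace_re (τ : Op ο) : τ.trace.re = ∑ w, (τ w w).re := by
  rw [Matrix.trace, Complex.re_sum]; rfl

theorem prob_add_prob_not (τ : Op ο) (p : Bits ο → Prop) [DecidablePred p] :
    prob τ p + prob τ (fun w => ¬ p w) = τ.trace.re := by
  rw [trace_re, prob, prob, ← Finset.sum_add_distrib]
  refine Finset.sum_congr rfl fun w _ => ?_
  by_cases h : p w <;> simp [h]

theorem prob_le_trace {τ : Op ο} (hτ : τ.PosSemidef) (p : Bits ο → Prop) [DecidablePred p] :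
    prob τ p ≤ τ.trace.re := by
  rw [← prob_add_prob_not τ p]
  linarith [prob_nonneg hτ fun w => ¬ p w]

theorem trace_re_nonneg {τ : Op ο} (hτ : τ.PosSemidef) : 0 ≤ τ.trace.re := by
  rw [trace_re]; exact Finset.sum_nonneg fun w _ => diag_re_nonneg hτ w

theorem prob_add (τ τ' : Op ο) (p : Bits ο → Prop) [DecidablePred p] :
    prob (τ + τ') p = prob τ p + prob τ' p := by
  rw [prob, prob, prob, ← Finset.sum_add_distrib]
  refine Finset.sum_congr rfl fun w _ => ?_
  split_ifs <;> simp

theorem prob_smul (c : ℝ) (τ : Op ο) (p : Bits ο → Prop) [DecidablePred p] :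
    prob ((c : ℂ) • τ) p = c * prob τ p := by
  rw [prob, prob, Finset.mul_sum]
  refine Finset.sum_congr rfl fun w _ => ?_
  split_ifs <;> simp

theorem prob_sum {κ : Type*} (s : Finset κ) (F : κ → Op ο) (p : Bits ο → Prop) [DecidablePred p] :
    prob (∑ i ∈ s, F i) p = ∑ i ∈ s, prob (F i) p := by
  simp only [prob, Matrix.sum_apply]
  rw [Finset.sum_comm]
  refine Finset.sum_congr rfl fun w _ => ?_
  split_ifs
  · rw [Complex.re_sum]
  · simp

theorem trace_re_smul (c : ℝ) (τ : Op ο) : ((c : ℂ) • τ).trace.re = c * τ.trace.re := by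
  rw [Matrix.trace_smul]; simp

/-- The compression of a state to the strings of the first register with the property `p`. -/
def proj (p : Bits ο → Prop) [DecidablePred p] (ω : Op (ο ⊕ Z)) : Op (ο ⊕ Z) :=
  fun f g => if p (f ∘ Sum.inl) ∧ p (g ∘ Sum.inl) then ω f g else 0

theorem proj_apply (p : Bits ο → Prop) [DecidablePred p] (ω : Op (ο ⊕ Z)) (f g : Bits (ο ⊕ Z)) :
    proj p ω f g = if p (f ∘ Sum.inl) ∧ p (g ∘ Sum.inl) then ω f g else 0 := rfl

theorem conjBy_diagonal_apply (d : Bits ο → ℂ) (M : Op ο) (f g : Bits ο) :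
    conjBy (Matrix.diagonal d) M f g = d f * M f g * star (d g) := by
  rw [conjBy, Matrix.diagonal_conjTranspose, Matrix.mul_diagonal, Matrix.diagonal_mul]
  rfl

theorem proj_posSemidef (p : Bits ο → Prop) [DecidablePred p] {ω : Op (ο ⊕ Z)}
    (hω : ω.PosSemidef) : (proj p ω).PosSemidef := by
  have : proj p ω = conjBy (Matrix.diagonal fun f => if p (f ∘ Sum.inl) then 1 else 0) ω := by
    funext f g
    rw [conjBy_diagonal_apply, proj_apply]
    by_cases h1 : p (f ∘ Sum.inl) <;> by_cases h2 : p (g ∘ Sum.inl) <;> simp [h1, h2]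
  rw [this]
  exact conjBy_posSemidef _ hω

theorem trace_proj (p : Bits ο → Prop) [DecidablePred p] (ω : Op (ο ⊕ Z)) :
    (proj p ω).trace.re = prob (ptr ω) p := by
  rw [trace_re, prob, sum_bits_sum]
  refine Finset.sum_congr rfl fun w _ => ?_
  simp only [proj_apply, Sum.elim_comp_inl, and_self]
  split_ifs
  · rw [ptr_apply, Complex.re_sum]
  · simp

/-- `2ω + 2QωQ - PωP = (1 + Q) ω (1 + Q)` for complementary projections `P` and `Q`. -/
theorem proj_complement_posSemidef (p : Bits ο → Prop) [DecidablePred p] {ω : Op (ο ⊕ Z)}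
    (hω : ω.PosSemidef) :
    ((2 : ℂ) • ω + (2 : ℂ) • proj (fun w => ¬ p w) ω + (-1 : ℂ) • proj p ω).PosSemidef := by
  have : (2 : ℂ) • ω + (2 : ℂ) • proj (fun w => ¬ p w) ω + (-1 : ℂ) • proj p ω =
      conjBy (Matrix.diagonal fun f => if p (f ∘ Sum.inl) then 1 else 2) ω := by
    funext f g
    rw [conjBy_diagonal_apply, Matrix.add_apply, Matrix.add_apply, Matrix.smul_apply,
      Matrix.smul_apply, Matrix.smul_apply, proj_apply, proj_apply]
    by_cases h1 : p (f ∘ Sum.inl) <;> by_cases h2 : p (g ∘ Sum.inl) <;> simp [h1, h2] <;> ring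
  rw [this]
  exact conjBy_posSemidef _ hω

/-- If a state passes the measurement `p` and the test `good ∘ X` with small error, then after
passing `p` it passes `good ∘ X` with an error of the same order. -/
theorem gentle_test {X : Op (ο ⊕ Z) → Op ι} {N : ℕ} (hX : Eff X N) (p : Bits ο → Prop)
    [DecidablePred p] (good : Bits ι → Prop) [DecidablePred good] {ω : Op (ο ⊕ Z)}
    (hω : ω.PosSemidef) :
    ω.trace.re - 3 * (ω.trace.re - prob (ptr ω) p) - 2 * (ω.trace.re - prob (X ω) good) ≤
      prob (X (proj p ω)) good := by
  set Q := proj (fun w => ¬ p w) ω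
  have hQ : Q.PosSemidef := proj_posSemidef _ hω
  have h1 := prob_nonneg (hX.posSemidef (proj_complement_posSemidef p hω)) fun w => ¬ good w
  rw [hX.add, hX.add, hX.smul, hX.smul, hX.smul, prob_add, prob_add] at h1
  have e2 : (2 : ℂ) = ((2 : ℝ) : ℂ) := by push_cast; rfl
  have e1 : (-1 : ℂ) = ((-1 : ℝ) : ℂ) := by push_cast; rfl
  rw [e2, e1, prob_smul, prob_smul, prob_smul] at h1
  have h2 := prob_add_prob_not (X ω) good
  have h3 := prob_add_prob_not (X (proj p ω)) good
  have h4 := prob_le_trace (hX.posSemidef hQ) fun w => ¬ good w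
  have h5 := trace_proj p ω
  have h6 : Q.trace.re = _ := trace_proj (fun w => ¬ p w) ω
  have h7 := prob_add_prob_not (ptr ω) p
  rw [hX.trace] at h2 h3 h4
  rw [trace_ptr] at h7
  change 0 ≤ 2 * prob (X ω) _ + 2 * prob (X Q) _ + -1 * _ at h1
  linarith

theorem outcome_compute_eq {β : Type} [Fintype β] [DecidableEq β] (f : Bits ι → Bits β)
    (M : Op ι) (b : Bits β) (x y : Bits ι) :
    outcome b (compute f M) x y = if f x = b ∧ f y = b then M x y else 0 := by
  rw [outcome_apply, compute_apply]
  simp only [Sum.elim_comp_inl, Sum.elim_comp_inr]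
  exact if_congr (and_congr eq_comm eq_comm) rfl rfl

end Prob

/-! ### One-qubit Hadamard measurements -/

section Hadamard

/-- The state `|+⟩⟨+|` of one qubit. -/
noncomputable def plusState : Op Unit := fun _ _ => 1 / 2

theorem isDensity_plusState : IsDensity plusState := by
  have hne : ((2 : ℝ) : ℂ) = 2 := by push_cast; rfl
  constructor
  · have : plusState = ((1 / 2 : ℝ) : ℂ) • Matrix.vecMulVec (fun _ : Bits Unit => (1 : ℂ))
        (star fun _ : Bits Unit => (1 : ℂ)) := by
      funext f g
      simp [plusState, Matrix.vecMulVec, Matrix.smul_apply]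
    rw [this]
    exact (Matrix.posSemidef_vecMulVec_self_star _).smul (Complex.zero_le_real.2 (by norm_num))
  · rw [Matrix.trace, sum_bits_unit]
    simp only [Matrix.diag, plusState]
    norm_num

/-- A Hadamard gate on one qubit. -/
noncomputable def hadamard (ρ : Op Unit) : Op Unit := conjBy (circuitMatrix [QGate.had ()]) ρ

theorem Eff.hadamard : Eff hadamard 1 := (Eff.id.then_gates [QGate.had ()]).congr fun _ => rfl

theorem hadamard_zero (ρ : Op Unit) : hadamard ρ (fun _ => false) (fun _ => false) =
    (1 / 2) * ∑ b, ∑ b', ρ b b' := by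
  have h3 := sqrt_two_mul
  have h2 : ((Real.sqrt 2 : ℝ) : ℂ) ≠ 0 := by
    intro h; rw [h] at h3; norm_num at h3
  have hs : (1 / (Real.sqrt 2 : ℂ)) * (1 / (Real.sqrt 2 : ℂ)) = 1 / 2 := by
    rw [div_mul_div_comm, h3, one_mul]
  have hstar : star (1 / (Real.sqrt 2 : ℂ)) = 1 / (Real.sqrt 2 : ℂ) := by
    rw [Complex.star_def, map_div₀, map_one, Complex.conj_ofReal]
  rw [SuccTest.hadamard, conjBy_apply]
  have hm : ∀ b : Bits Unit, circuitMatrix [QGate.had ()] (fun _ => false) b =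
      1 / (Real.sqrt 2 : ℂ) := by
    intro b
    rw [circuitMatrix, circuitMatrix, Matrix.one_mul, had_unit]
    simp
  simp only [hm, hstar]
  rw [Finset.mul_sum]
  refine Finset.sum_congr rfl fun b _ => ?_
  rw [Finset.mul_sum]
  refine Finset.sum_congr rfl fun b' _ => ?_
  rw [← hs]; ring

end Hadamard

/-! ### Testing a pair of strings for a collision -/

section Collision

variable {X Z : Type} [Fintype X] [DecidableEq X] [Fintype Z] [DecidableEq Z]

/-- Erasing the coherences between the strings of the first register that are not related
by `s`. -/
def mask (s : Bits X → Bits X → Prop) [DecidableRel s] (M : Op (X ⊕ Z)) : Op (X ⊕ Z) :=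
  fun f g => if s (f ∘ Sum.inl) (g ∘ Sum.inl) then M f g else 0

theorem mask_apply (s : Bits X → Bits X → Prop) [DecidableRel s] (M : Op (X ⊕ Z))
    (f g : Bits (X ⊕ Z)) :
    mask s M f g = if s (f ∘ Sum.inl) (g ∘ Sum.inl) then M f g else 0 := rfl

/-- The choice between the two strings of a pair by a control qubit. -/
def pick (j : Bits ((X ⊕ X) ⊕ Unit)) : Bits X :=
  mux (j (Sum.inr ())) (j ∘ fun i => Sum.inl (Sum.inl i)) (j ∘ fun i => Sum.inl (Sum.inr i))

theorem hasCircuit_pick : HasCircuit (pick (X := X)) (3 * Fintype.card X) :=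
  HasCircuit.mux _ _ _

/-- A superposition of the two strings of a pair, next to the pair and the control qubit. -/
noncomputable def superpose (K : Op (X ⊕ X)) : Op (X ⊕ ((X ⊕ X) ⊕ Unit)) :=
  relabel (Equiv.sumComm _ _) (compute pick (tensor K plusState))

/-- Uncompute the superposition of the two strings, and measure the control qubit in the
Hadamard basis. -/
noncomputable def coherenceTest (M : Op (X ⊕ ((X ⊕ X) ⊕ Unit))) : Op Unit :=
  ptr (ext hadamard (relabel (Equiv.sumComm _ _)
    (ptr (xorInto pick (relabel (Equiv.sumComm _ _) M)))))

theorem Eff.superpose : Eff (superpose (X := X)) (1 + 29 * Fintype.card X) := by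
  have h := ((Eff.compute hasCircuit_pick).comp
    (Eff.id.then_tensor (ι := X ⊕ X) isDensity_plusState)).then_relabel (Equiv.sumComm _ X)
  exact (h.mono (by simp; omega)).congr fun _ => rfl

theorem Eff.coherenceTest : Eff (coherenceTest (X := X)) (1 + 28 * Fintype.card X) := by
  have h1 := ((Eff.xorInto hasCircuit_pick).comp (Eff.id.then_relabel (Equiv.sumComm X _)))
  have h2 := (Eff.hadamard.ext (Z := X ⊕ X)).comp
    (h1.then_ptr.then_relabel (Equiv.sumComm (X ⊕ X) Unit))
  exact (h2.then_ptr.mono (by omega)).congr fun _ => rfl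

theorem coherenceTest_mask (s : Bits X → Bits X → Prop) [DecidableRel s] (K : Op (X ⊕ X)) :
    coherenceTest (mask s (superpose K)) (fun _ => false) (fun _ => false) =
      ∑ u : Bits (X ⊕ X), K u u * ((1 / 4) * ∑ b : Bits Unit, ∑ b' : Bits Unit,
        if s (pick (Sum.elim u b)) (pick (Sum.elim u b')) then 1 else 0) := by
  have key : ∀ j j' : Bits ((X ⊕ X) ⊕ Unit),
      ptr (xorInto pick (relabel (Equiv.sumComm _ _) (mask s (superpose K)))) j j' =
        if s (pick j) (pick j') then tensor K plusState j j' else 0 := by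
    intro j j'
    rw [ptr_apply, Finset.sum_eq_single (fun _ => false)]
    · rw [xorInto, relabel_apply, mask_apply, superpose, relabel_apply, compute_apply]
      have h : ∀ j : Bits ((X ⊕ X) ⊕ Unit), xorMap pick (Sum.elim j fun _ => false) =
          Sum.elim j (pick j) := by
        intro j; simp [xorMap]
      have h1 : ∀ f : Bits (((X ⊕ X) ⊕ Unit) ⊕ X), (f ∘ Equiv.sumComm _ _) ∘ Equiv.sumComm _ _ =
        f := fun f => by ext (_ | _) <;> rfl
      have h2 : ∀ f : Bits (((X ⊕ X) ⊕ Unit) ⊕ X), (f ∘ Equiv.sumComm _ _) ∘ Sum.inl =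
        f ∘ Sum.inr := fun f => rfl
      rw [h, h, h1, h1, h2, h2]
      simp
    · intro z _ hz
      rw [xorInto, relabel_apply, mask_apply, superpose, relabel_apply, compute_apply]
      have h1 : ∀ f : Bits (((X ⊕ X) ⊕ Unit) ⊕ X), (f ∘ Equiv.sumComm _ _) ∘ Equiv.sumComm _ _ =
        f := fun f => by ext (_ | _) <;> rfl
      rw [h1, h1, if_neg (c := _ ∧ _)]
      · simp
      · rintro ⟨h, -⟩
        apply hz
        simp only [xorMap, Sum.elim_comp_inr, Sum.elim_comp_inl, Sum.elim_inr] at h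
        funext o
        have := congrFun h o
        revert this
        cases z o <;> cases pick j o <;> simp
    · simp
  rw [coherenceTest, ptr_apply]
  refine Finset.sum_congr rfl fun u _ => ?_
  rw [ext, Sum.elim_comp_inl, Sum.elim_comp_inr, hadamard_zero, Finset.mul_sum, Finset.mul_sum,
    Finset.mul_sum]
  refine Finset.sum_congr rfl fun b _ => ?_
  rw [Finset.mul_sum, Finset.mul_sum, Finset.mul_sum]
  refine Finset.sum_congr rfl fun b' _ => ?_
  rw [block_apply, relabel_apply, key]
  have h : ∀ b : Bits Unit, (Sum.elim b u ∘ Equiv.sumComm (X ⊕ X) Unit) = Sum.elim u b :=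
    fun b => by ext (_ | _) <;> rfl
  rw [h, h, tensor_apply, Sum.elim_comp_inl, Sum.elim_comp_inl, plusState]
  split_ifs
  · ring
  · simp

/-- The test detects whether the coherence between the two strings has been erased. -/
theorem coherenceTest_mask_re (s : Bits X → Bits X → Prop) [DecidableRel s] (hs : ∀ x, s x x)
    (hs' : ∀ x y, s x y → s y x) (K : Op (X ⊕ X)) :
    (coherenceTest (mask s (superpose K)) (fun _ => false) (fun _ => false)).re =
      ∑ u : Bits (X ⊕ X), (K u u).re * (1 / 2 +
        if s (u ∘ Sum.inl) (u ∘ Sum.inr) then 1 / 2 else 0) := by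
  rw [coherenceTest_mask, Complex.re_sum]
  refine Finset.sum_congr rfl fun u _ => ?_
  have h0 : pick (Sum.elim u fun _ => false) = u ∘ Sum.inl := rfl
  have h1 : pick (Sum.elim u fun _ => true) = u ∘ Sum.inr := rfl
  simp only [sum_bits_unit, h0, h1, hs, if_true]
  have h2 : s (u ∘ Sum.inr) (u ∘ Sum.inl) ↔ s (u ∘ Sum.inl) (u ∘ Sum.inr) := ⟨hs' _ _, hs' _ _⟩
  simp only [h2]
  split_ifs
  · rw [show (1 / 4 : ℂ) * (1 + 1 + (1 + 1)) = ((1 : ℝ) : ℂ) by push_cast; norm_num,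
      Complex.re_mul_ofReal]
    norm_num
  · rw [show (1 / 4 : ℂ) * (1 + 0 + (0 + 1)) = ((1 / 2 : ℝ) : ℂ) by push_cast; norm_num,
      Complex.re_mul_ofReal]
    norm_num

end Collision

/-! ### Extraction from two consistent extractors of a committed string -/

section Collapsing

theorem average_mono {ι : Type} [Fintype ι] [DecidableEq ι] {p q : Bits ι → ℝ}
    (h : ∀ r, p r ≤ q r) : average p ≤ average q :=
  div_le_div_of_nonneg_right (Finset.sum_le_sum fun r _ => h r) (by positivity)

theorem average_add {ι : Type} [Fintype ι] [DecidableEq ι] (p q : Bits ι → ℝ) :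
    average (fun r => p r + q r) = average p + average q := by
  rw [average, Finset.sum_add_distrib, add_div]; rfl

theorem average_const_mul {ι : Type} [Fintype ι] [DecidableEq ι] (c : ℝ) (p : Bits ι → ℝ) :
    average (fun r => c * p r) = c * average p := by
  rw [average, ← Finset.mul_sum, mul_div_assoc]; rfl

theorem average_const {ι : Type} [Fintype ι] [DecidableEq ι] (c : ℝ) :
    average (fun _ : Bits ι => c) = c := by
  rw [average, Finset.sum_const, Finset.card_univ]
  simp

variable {γ ι R ο : Type} [Fintype ι] [DecidableEq ι] [Fintype R] [DecidableEq R]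
  [Fintype ο] [DecidableEq ο] [Fintype γ] [DecidableEq γ]

/-- A quantum operation can be run coherently, keeping all of its qubits, and undone. -/
theorem EffC.dilate {E : Bits γ → Op R → Op ο} {N : ℕ} (hE : EffC E N) :
    ∃ (k : ℕ) (V : Bits γ → Op R → Op (ο ⊕ Fin k)) (U : Op (ο ⊕ Fin k) → Op R),
      EffC V N ∧ Eff U (7 * N) ∧ (∀ g ρ, ptr (V g ρ) = E g ρ) ∧ ∀ g ρ, U (V g ρ) = ρ := by
  obtain ⟨Θ, hΘ, hE⟩ := hE
  obtain ⟨a, k, σ, l, w, hσ, hN, hΘ'⟩ := hΘ.normalForm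
  have hV := ((Eff.id (ι := γ ⊕ R)).then_tensor hσ).then_gates l |>.then_relabel w
  have hU := ((((Eff.id (ι := ο ⊕ Fin k)).then_relabel w.symm).then_gates
    (circuitInv l)).then_ptr.then_relabel (Equiv.sumComm γ R)).then_ptr
  have hl := length_circuitInv l
  refine ⟨k, fun g ρ => relabel w (conjBy (circuitMatrix l) (tensor (tensor (basisState g) ρ) σ)),
    _, ⟨_, hV.mono ?_, fun g ρ => rfl⟩, hU.mono (by omega), fun g ρ => ?_, fun g ρ => ?_⟩
  · simp; omega
  · rw [← hΘ', hE]
  · beta_reduce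
    rw [relabel_relabel, Equiv.self_trans_symm, relabel_refl, conjBy_circuitInv, ptr_tensor, hσ.2,
      one_smul, relabel_sumComm_tensor, ptr_tensor, (isDensity_basisState g).2, one_smul]

/-- The register of the committed string, the work qubits, and the commitment. -/
def packEquiv (X : Type) (k κ : ℕ) : (X ⊕ Fin k) ⊕ Fin κ ≃ X ⊕ Fin (k + κ) :=
  (Equiv.sumAssoc X (Fin k) (Fin κ)).trans (Equiv.sumCongr (Equiv.refl X) finSumFinEquiv)

theorem outcome_unpack_mask {X : Type} [Fintype X] [DecidableEq X] {k κ : ℕ}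
    (s : Bits X → Bits X → Prop) [DecidableRel s] (ω : Bits (Fin κ) → Op (X ⊕ Fin k))
    (c : Bits (Fin κ)) :
    outcome c (relabel (packEquiv X k κ).symm (mask s (∑ c', relabel (packEquiv X k κ)
      (tensor (ω c') (basisState c'))))) = mask s (ω c) := by
  have h : outcome c (relabel (packEquiv X k κ).symm (∑ c', relabel (packEquiv X k κ)
      (tensor (ω c') (basisState c')))) = ω c := by
    have hsum : relabel (packEquiv X k κ).symm (∑ c', relabel (packEquiv X k κ)
        (tensor (ω c') (basisState c'))) = ∑ c', tensor (ω c') (basisState c') := by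
      rw [(Eff.id.then_relabel (packEquiv X k κ).symm).sum]
      refine Finset.sum_congr rfl fun c' _ => ?_
      rw [relabel_relabel, Equiv.self_trans_symm, relabel_refl]
    rw [hsum, outcome_sum]
    simp [outcome_tensor_basisState]
  conv_rhs => rw [← h]
  rfl

/-- If the string is measured, a string with the property `p` is one of these strings. -/
theorem mask_sum_eq_proj {X Z : Type} [Fintype X] [DecidableEq X] [Fintype Z] [DecidableEq Z]
    (p : Bits X → Prop) [DecidablePred p] (ω : Op (X ⊕ Z)) :
    proj p (mask (fun x y => x = y) ω) = ∑ w, if p w then proj (fun x => x = w) ω else 0 := by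
  funext f g
  rw [proj_apply, mask_apply, Matrix.sum_apply]
  have h : ∀ w, (if p w then proj (fun x => x = w) ω else 0) f g =
      if f ∘ Sum.inl = w then (if p w ∧ g ∘ Sum.inl = w then ω f g else 0) else 0 := by
    intro w
    by_cases hw : p w
    · rw [if_pos hw, proj_apply]
      by_cases h1 : f ∘ Sum.inl = w <;> by_cases h2 : g ∘ Sum.inl = w <;> simp [h1, h2, hw]
    · simp [hw]
  rw [Finset.sum_congr rfl fun w _ => h w, Finset.sum_ite_eq]
  simp only [Finset.mem_univ, if_true]
  by_cases h1 : p (f ∘ Sum.inl)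
  · by_cases h2 : f ∘ Sum.inl = g ∘ Sum.inl
    · simp [← h2, h1]
    · simp [h2, Ne.symm h2]
  · simp [h1]

variable (H : HashFamily) {m κ : ℕ}

theorem elim_comp_finSumFinEquiv_symm {a b : ℕ} (h : Bits (Fin a)) (c : Bits (Fin b)) :
    Sum.elim h c ∘ finSumFinEquiv.symm = Fin.append h c := by
  funext i
  refine Fin.addCases (fun i => ?_) (fun i => ?_) i <;> simp

/-- The test of a commitment. -/
def commitTest (m κ : ℕ) (a : Bits ((Fin (H.descLen m κ) ⊕ Fin κ) ⊕ Fin m)) : Bits Unit :=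
  (commitRelation H m κ).eval (a ∘ Sum.map finSumFinEquiv.symm id)

theorem hasCircuit_commitTest (m κ : ℕ) :
    HasCircuit (commitTest H m κ) (H.evalSize m κ + 0 + (κ + κ)) :=
  (commitRelation H m κ).hasCircuit.precomp _

theorem commitTest_eq (h : Bits (Fin (H.descLen m κ))) (c : Bits (Fin κ)) (w : Bits (Fin m)) :
    commitTest H m κ (Sum.elim (Sum.elim h c) w) () = true ↔ H.hash h w = c := by
  rw [← commitRelation_holds, Relation.Holds, commitTest, ← elim_comp_finSumFinEquiv_symm]
  have : (Sum.elim (Sum.elim h c) w ∘ Sum.map finSumFinEquiv.symm id) =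
      Sum.elim (Sum.elim h c ∘ finSumFinEquiv.symm) w := by
    ext (_ | _) <;> rfl
  rw [this]

/-- The last step of the distinguisher: output `0` if the flag is set and the string `w` is
good. -/
def verdict {κ d m : ℕ} (good : Bits ((Fin d ⊕ Fin κ) ⊕ Fin m) → Bits Unit)
    (a : Bits (((Fin d ⊕ Fin κ) ⊕ Unit) ⊕ Fin m)) : Bits Unit :=
  fun _ => !(a (Sum.inl (Sum.inr ())) && good (a ∘ Sum.map Sum.inl id) ())

theorem hasCircuit_verdict {κ d m N : ℕ} {good : Bits ((Fin d ⊕ Fin κ) ⊕ Fin m) → Bits Unit}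
    (hg : HasCircuit good N) : HasCircuit (verdict good) (N + 1) := by
  have h1 := HasCircuit.select (ο := Unit)
    (fun _ => Sum.inl (Sum.inr ()) : Unit → ((Fin d ⊕ Fin κ) ⊕ Unit) ⊕ Fin m)
  have h2 := h1.pair (hg.precomp (Sum.map Sum.inl id : _ → ((Fin d ⊕ Fin κ) ⊕ Unit) ⊕ Fin m))
  have h3 := HasCircuit.layer (ι := Unit ⊕ Unit) (ο := Unit) (fun _ a b => !(a && b))
    (fun _ => Sum.inl ()) (fun _ => Sum.inr ())
  exact ((h3.comp h2).mono (by simp)).congr fun _ => rfl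

theorem ptr_sumComm_compute_zero {f : Bits ο → Bits Unit} (τ : Op ο) :
    (ptr (relabel (Equiv.sumComm ο Unit) (compute f τ)) (fun _ => false) (fun _ => false)).re =
      prob τ fun w => f w () = false := by
  rw [ptr_apply, Complex.re_sum, prob]
  refine Finset.sum_congr rfl fun w _ => ?_
  have h : ∀ b : Bits Unit, (Sum.elim b w ∘ Equiv.sumComm ο Unit) = Sum.elim w b :=
    fun b => by ext (_ | _) <;> rfl
  rw [relabel_apply, h, compute_apply]
  have h2 : (fun _ : Unit => false) = f w ↔ f w () = false :=
    ⟨fun h => by rw [← h], fun h => by funext u; exact h.symm⟩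
  simp only [Sum.elim_comp_inl, Sum.elim_comp_inr, and_self, h2]
  split_ifs <;> rfl

theorem prob_congr {τ : Op ο} {p q : Bits ο → Prop} [DecidablePred p] [DecidablePred q]
    (h : ∀ w, p w ↔ q w) : prob τ p = prob τ q :=
  Finset.sum_congr rfl fun w _ => if_congr (h w) rfl rfl

/-- The distinguisher of the collapsing game: test the commitment coherently, undo the first
extractor with `U`, and run the second extractor `T`. -/
theorem exists_distinguisher {k N₂ N₃ N : ℕ}
    {T : Bits (Fin (H.descLen m κ) ⊕ Fin κ) → Op R → Op (Fin m)} (hT : EffC T N₂)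
    {U : Op (Fin m ⊕ Fin k) → Op R} (hU : Eff U N)
    {good : Bits ((Fin (H.descLen m κ) ⊕ Fin κ) ⊕ Fin m) → Bits Unit} (hg : HasCircuit good N₃) :
    ∃ D : QOp (Fin (H.descLen m κ) ⊕ (Fin m ⊕ Fin (k + κ))) Unit,
      D.size ≤ 30 * (1 + H.descLen m κ + κ + H.evalSize m κ + N + N₂ + N₃) ∧
      ∀ h (ω : Bits (Fin κ) → Op (Fin m ⊕ Fin k)) (s : Bits (Fin m) → Bits (Fin m) → Prop)
        [DecidableRel s],
        (D.apply (tensor (basisState h) (mask s (∑ c, relabel (packEquiv (Fin m) k κ)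
          (tensor (ω c) (basisState c))))) (fun _ => false) (fun _ => false)).re =
        ∑ c, prob (T (Sum.elim h c) (U (proj (fun w => H.hash h w = c) (mask s (ω c)))))
          fun w => good (Sum.elim (Sum.elim h c) w) () = true := by
  have e1 := EffC.compute (ι := Fin m ⊕ Fin k) ((hasCircuit_commitTest H m κ).precomp
    (Sum.map id Sum.inl : _ → (Fin (H.descLen m κ) ⊕ Fin κ) ⊕ (Fin m ⊕ Fin k)))
  have e2 := ((hT.precomp (HasCircuit.select
    (Sum.inl : _ → (Fin (H.descLen m κ) ⊕ Fin κ) ⊕ Unit))).comp (EffC.of_eff hU))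
  have e3 := (EffC.of_eff (γ := (Fin (H.descLen m κ) ⊕ Fin κ) ⊕ Unit) ((Eff.id.then_relabel
    (Equiv.sumComm (Fin m) Unit)).then_ptr)).comp ((EffC.compute (hasCircuit_verdict hg)).comp e2)
  have e4 := (e1.bind e3).read.comp
    (EffC.of_eff (Eff.id.then_relabel (packEquiv (Fin m) k κ).symm))
  obtain ⟨D, hD, hD'⟩ := e4.exists_qop_left
  refine ⟨D, hD.trans ?_, fun h ω s _ => ?_⟩
  · simp only [Fintype.card_sum, Fintype.card_fin, Fintype.card_unit]
    omega
  · rw [hD']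
    rw [Matrix.sum_apply, Complex.re_sum]
    refine Finset.sum_congr rfl fun c _ => ?_
    rw [outcome_unpack_mask, sum_bits_unit, Matrix.add_apply, Complex.add_re,
      ptr_sumComm_compute_zero, ptr_sumComm_compute_zero]
    have hv : ∀ (y : Bits Unit) w, verdict good (Sum.elim (Sum.elim (Sum.elim h c) y) w) () =
        !(y () && good (Sum.elim (Sum.elim h c) w) ()) := by
      intro y w
      have : (Sum.elim (Sum.elim (Sum.elim h c) y) w ∘ Sum.map Sum.inl id) =
        Sum.elim (Sum.elim h c) w := by ext (_ | _) <;> rfl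
      simp [verdict, this]
    simp only [hv, Bool.false_and, Bool.true_and, Bool.not_false, Bool.not_eq_false']
    have hz : ∀ τ : Op (Fin m), prob τ (fun _ => true = false) = 0 := by
      intro τ; simp [prob]
    rw [hz, zero_add, Sum.elim_comp_inl]
    have hproj : outcome (fun _ => true) (compute (fun a => commitTest H m κ
        (Sum.elim (Sum.elim h c) a ∘ Sum.map id Sum.inl)) (mask s (ω c))) =
        proj (fun w => H.hash h w = c) (mask s (ω c)) := by
      funext f g
      rw [outcome_compute_eq, proj_apply]
      have hf : ∀ f : Bits (Fin m ⊕ Fin k), commitTest H m κ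
          (Sum.elim (Sum.elim h c) f ∘ Sum.map id Sum.inl) = (fun _ => true) ↔
          H.hash h (f ∘ Sum.inl) = c := by
        intro f
        rw [← commitTest_eq]
        have : (Sum.elim (Sum.elim h c) f ∘ Sum.map id Sum.inl) =
          Sum.elim (Sum.elim h c) (f ∘ Sum.inl) := by ext (_ | _) <;> rfl
        rw [this]
        exact ⟨fun h => congrFun h (), fun h => by funext u; exact h⟩
      exact if_congr (and_congr (hf f) (hf g)) rfl rfl
    rw [hproj]

/-- The first stage of the collapsing game: run the first extractor coherently. -/
theorem exists_preparation {k N₀ N : ℕ} {Φ₀ : Bits (Fin (H.descLen m κ)) → Op ι → Op (R ⊕ Fin κ)}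
    (hΦ₀ : EffC Φ₀ N₀) {σ : Op ι} (hσ : IsDensity σ)
    {V : Bits (Fin (H.descLen m κ) ⊕ Fin κ) → Op R → Op (Fin m ⊕ Fin k)} (hV : EffC V N) :
    ∃ A : QOp (Fin (H.descLen m κ)) (Fin m ⊕ Fin (k + κ)),
      A.size ≤ 30 * (1 + H.descLen m κ + κ + Fintype.card ι + N₀ + N) ∧
      ∀ h, A.apply (basisState h) = ∑ c, relabel (packEquiv (Fin m) k κ)
          (tensor (V (Sum.elim h c) (outcome c (Φ₀ h σ))) (basisState c)) := by
  have e1 := (EffC.append (ι := Fin m ⊕ Fin k)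
    (HasCircuit.select (Sum.inr : _ → Fin (H.descLen m κ) ⊕ Fin κ))).comp hV
  have e2 := hΦ₀.bind ((EffC.of_eff (Eff.id.then_relabel (packEquiv (Fin m) k κ))).comp e1)
  obtain ⟨A, hA, hA'⟩ := e2.exists_qop_state hσ
  refine ⟨A, hA.trans ?_, fun h => ?_⟩
  · simp only [Fintype.card_sum, Fintype.card_fin]
    omega
  · rw [hA']
    rfl

/-- The registers of the collision test, besides the committed string. -/
noncomputable def collisionEquiv (m : ℕ) :
    Fin m ⊕ ((Fin m ⊕ Fin m) ⊕ Unit) ≃ Fin m ⊕ Fin (m + m + 1) :=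
  Equiv.sumCongr (Equiv.refl _) (Fintype.equivFinOfCardEq (by simp))

theorem relabel_collisionEquiv_mask (s : Bits (Fin m) → Bits (Fin m) → Prop) [DecidableRel s]
    (M : Op (Fin m ⊕ ((Fin m ⊕ Fin m) ⊕ Unit))) :
    relabel (collisionEquiv m).symm (mask s (relabel (collisionEquiv m) M)) = mask s M := by
  have : relabel (collisionEquiv m).symm (relabel (collisionEquiv m) M) = M := by
    rw [relabel_relabel, Equiv.self_trans_symm, relabel_refl]
  conv_rhs => rw [← this]
  rfl

/-- If the coherent committed string is measured, the first extractor undone and the second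
extractor run, then the outcomes form a collision only as often as the two collapsing games
differ. -/
theorem exists_collisionTest {k N₀ N N' N₂ : ℕ}
    {Φ₀ : Bits (Fin (H.descLen m κ)) → Op ι → Op (R ⊕ Fin κ)}
    (hΦ₀ : EffC Φ₀ N₀) {σ : Op ι} (hσ : IsDensity σ)
    {V : Bits (Fin (H.descLen m κ) ⊕ Fin κ) → Op R → Op (Fin m ⊕ Fin k)} (hV : EffC V N)
    {T : Bits (Fin (H.descLen m κ) ⊕ Fin κ) → Op R → Op (Fin m)} (hT : EffC T N₂)
    {U : Op (Fin m ⊕ Fin k) → Op R} (hU : Eff U N') :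
    ∃ (A : QOp (Fin (H.descLen m κ)) (Fin m ⊕ Fin (m + m + 1)))
      (D : QOp (Fin (H.descLen m κ) ⊕ (Fin m ⊕ Fin (m + m + 1))) Unit),
      A.size ≤ 100 * (1 + H.descLen m κ + κ + m + Fintype.card ι + N₀ + N + N' + N₂) ∧
      D.size ≤ 100 * (1 + m) ∧
      ∀ h (s : Bits (Fin m) → Bits (Fin m) → Prop) [DecidableRel s], (∀ x, s x x) →
        (∀ x y, s x y → s y x) →
        (D.apply (tensor (basisState h) (mask s (A.apply (basisState h))))
          (fun _ => false) (fun _ => false)).re =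
        ∑ c, ∑ w, ∑ w', (T (Sum.elim h c) (U (proj (fun x => x = w)
            (V (Sum.elim h c) (outcome c (Φ₀ h σ))))) w' w').re *
          (1 / 2 + if s w' w then 1 / 2 else 0) := by
  have e1 := (hT.comp (EffC.of_eff hU)).ext (Z := Fin m)
  have e2 := (EffC.of_eff (γ := Fin (H.descLen m κ) ⊕ Fin κ)
    (Eff.compute (HasCircuit.select (Sum.inl : Fin m → Fin m ⊕ Fin k)))).comp hV
  have e3 := hΦ₀.bind (e1.comp e2)
  have e4 := (EffC.of_eff (γ := Fin (H.descLen m κ)) (Eff.superpose.then_relabel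
    (collisionEquiv m))).comp e3
  obtain ⟨A, hA, hA'⟩ := e4.exists_qop_state hσ
  have d1 := EffC.of_eff (γ := Fin (H.descLen m κ)) (Eff.coherenceTest.comp
    (Eff.id.then_relabel (collisionEquiv m).symm))
  obtain ⟨D, hD, hD'⟩ := d1.exists_qop_left
  refine ⟨A, D, hA.trans ?_, hD.trans ?_, fun h s _ hs hs' => ?_⟩
  · simp only [Fintype.card_sum, Fintype.card_fin]
    omega
  · simp only [Fintype.card_fin]
    omega
  · rw [hD', hA', relabel_collisionEquiv_mask, coherenceTest_mask_re s hs hs']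
    simp only [Matrix.sum_apply, Complex.re_sum, Finset.sum_mul]
    rw [Finset.sum_comm]
    refine Finset.sum_congr rfl fun c _ => ?_
    rw [sum_bits_sum, Finset.sum_comm]
    refine Finset.sum_congr rfl fun w _ => Finset.sum_congr rfl fun w' _ => ?_
    simp only [ext, Sum.elim_comp_inl, Sum.elim_comp_inr]
    congr 4
    funext f g
    exact outcome_compute_eq (fun a : Bits (Fin m ⊕ Fin k) => a ∘ Sum.inl) _ w f g

end Collapsing

section Collapsing

variable {ι R : Type} [Fintype ι] [DecidableEq ι] [Fintype R] [DecidableEq R]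
variable (H : HashFamily) {m κ : ℕ}

theorem posSemidef_outcome_eff {γ ο β : Type} [Fintype γ] [DecidableEq γ] [Fintype ο]
    [DecidableEq ο] [Fintype β] [DecidableEq β] {Φ : Bits γ → Op ι → Op (ο ⊕ β)} {N : ℕ}
    (hΦ : EffC Φ N) (g : Bits γ) {σ : Op ι} (hσ : σ.PosSemidef) (b : Bits β) :
    (outcome b (Φ g σ)).PosSemidef :=
  outcome_posSemidef b ((hΦ.eff g).posSemidef hσ)

theorem prob_eq_sum_filter {ο : Type} [Fintype ο] [DecidableEq ο] (τ : Op ο)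
    (p : Bits ο → Prop) [DecidablePred p] :
    prob τ p = ∑ w, if p w then prob τ (fun x => x = w) else 0 := by
  refine Finset.sum_congr rfl fun w _ => ?_
  have : prob τ (fun x => x = w) = (τ w w).re := by
    rw [prob, Finset.sum_ite_eq' Finset.univ w fun x => (τ x x).re]
    simp
  rw [this]

/-- If the committed string is measured, the first extractor undone and the second extractor run,
then a good outcome of the second extractor is either the measured string or a collision. -/
theorem prob_measured_le {k N' : ℕ} {X : Op (Fin m ⊕ Fin k) → Op (Fin m)} (hX : Eff X N')
    {ω : Op (Fin m ⊕ Fin k)} (hω : ω.PosSemidef) (h : Bits (Fin (H.descLen m κ)))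
    (c : Bits (Fin κ)) (good : Bits (Fin m) → Prop) [DecidablePred good]
    (hgood : ∀ w, good w → H.hash h w = c) :
    prob (X (proj (fun w => H.hash h w = c) (mask (fun x y => x = y) ω))) good ≤
      prob (ptr ω) good + 2 * ((∑ w, ∑ w', (X (proj (fun x => x = w) ω) w' w').re *
          (1 / 2 + if H.hash h w' = H.hash h w then 1 / 2 else 0)) -
        ∑ w, ∑ w', (X (proj (fun x => x = w) ω) w' w').re *
          (1 / 2 + if w' = w then 1 / 2 else 0)) := by
  have hnn : ∀ w w', 0 ≤ (X (proj (fun x => x = w) ω) w' w').re := fun w w' =>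
    diag_re_nonneg (hX.posSemidef (proj_posSemidef _ hω)) w'
  have htr : ∀ w, prob (ptr ω) (fun x => x = w) = ∑ w', (X (proj (fun x => x = w) ω) w' w').re := by
    intro w
    rw [← trace_proj, ← trace_re, hX.trace]
  rw [mask_sum_eq_proj, hX.sum, prob_sum, prob_eq_sum_filter (ptr ω), ← Finset.sum_sub_distrib,
    Finset.mul_sum, ← Finset.sum_add_distrib]
  refine Finset.sum_le_sum fun w _ => ?_
  rw [← Finset.sum_sub_distrib, Finset.mul_sum]
  have hpt : ∀ w', (if good w' ∧ H.hash h w = c then (X (proj (fun x => x = w) ω) w' w').re else 0)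
      ≤ (if w' = w ∧ good w then (X (proj (fun x => x = w) ω) w' w').re else 0) +
        2 * ((X (proj (fun x => x = w) ω) w' w').re *
          (1 / 2 + if H.hash h w' = H.hash h w then 1 / 2 else 0) -
        (X (proj (fun x => x = w) ω) w' w').re * (1 / 2 + if w' = w then 1 / 2 else 0)) := by
    intro w'
    have h0 := hnn w w'
    by_cases hw : w' = w
    · subst hw
      by_cases hg : good w'
      · by_cases hc : H.hash h w' = c <;> simp [hg, hc, h0]
      · simp [hg]
    · simp only [hw, false_and, if_false, zero_add]
      by_cases hg : good w' ∧ H.hash h w = c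
      · rw [if_pos hg, if_pos ((hgood w' hg.1).trans hg.2.symm)]
        linarith
      · rw [if_neg hg]
        split_ifs <;> linarith
  have h2 : prob (X (if H.hash h w = c then proj (fun x => x = w) ω else 0)) good =
      ∑ w', if good w' ∧ H.hash h w = c then (X (proj (fun x => x = w) ω) w' w').re else 0 := by
    refine Finset.sum_congr rfl fun w' _ => ?_
    by_cases hc : H.hash h w = c
    · simp [hc]
    · simp [hc, hX.zero]
  have h3 : (∑ w', if w' = w ∧ good w then (X (proj (fun x => x = w) ω) w' w').re else 0) ≤
      if good w then prob (ptr ω) (fun x => x = w) else 0 := by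
    rw [htr]
    by_cases hg : good w
    · rw [if_pos hg]
      refine Finset.sum_le_sum fun w' _ => ?_
      split_ifs
      exacts [le_rfl, hnn _ _]
    · simp [hg]
  rw [h2]
  refine (Finset.sum_le_sum fun w' _ => hpt w').trans ?_
  rw [Finset.sum_add_distrib]
  linarith

/-- Two extractors for a committed string are consistent: if from the states `Φ₀ h σ`, with
commitment `c`, the extractor `E` finds openings of `c` and the extractor `T` finds good openings,
then `E` finds good openings, up to the advantages in two collapsing games. -/
theorem exists_collapsing_games {N₀ N₁ N₂ N₃ : ℕ}
    {Φ₀ : Bits (Fin (H.descLen m κ)) → Op ι → Op (R ⊕ Fin κ)} (hΦ₀ : EffC Φ₀ N₀)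
    {σ : Op ι} (hσ : IsDensity σ)
    {E : Bits (Fin (H.descLen m κ) ⊕ Fin κ) → Op R → Op (Fin m)} (hE : EffC E N₁)
    {T : Bits (Fin (H.descLen m κ) ⊕ Fin κ) → Op R → Op (Fin m)} (hT : EffC T N₂)
    {good : Bits ((Fin (H.descLen m κ) ⊕ Fin κ) ⊕ Fin m) → Bits Unit} (hg : HasCircuit good N₃)
    (hgood : ∀ h c w, good (Sum.elim (Sum.elim h c) w) () = true → H.hash h w = c) :
    ∃ (q q' : ℕ) (A : QOp (Fin (H.descLen m κ)) (Fin m ⊕ Fin q))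
      (D : QOp (Fin (H.descLen m κ) ⊕ (Fin m ⊕ Fin q)) Unit)
      (A' : QOp (Fin (H.descLen m κ)) (Fin m ⊕ Fin q'))
      (D' : QOp (Fin (H.descLen m κ) ⊕ (Fin m ⊕ Fin q')) Unit),
      (A.size ≤ 1000 * (1 + H.descLen m κ + κ + m + Fintype.card ι + H.evalSize m κ +
        N₀ + N₁ + N₂ + N₃) ∧
      D.size ≤ 1000 * (1 + H.descLen m κ + κ + m + Fintype.card ι + H.evalSize m κ +
        N₀ + N₁ + N₂ + N₃) ∧
      A'.size ≤ 1000 * (1 + H.descLen m κ + κ + m + Fintype.card ι + H.evalSize m κ +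
        N₀ + N₁ + N₂ + N₃) ∧
      D'.size ≤ 1000 * (1 + H.descLen m κ + κ + m + Fintype.card ι + H.evalSize m κ +
        N₀ + N₁ + N₂ + N₃)) ∧
      (average fun r => ∑ c,
          ((outcome c (Φ₀ ((H.sample m κ).eval r) σ)).trace.re -
            3 * ((outcome c (Φ₀ ((H.sample m κ).eval r) σ)).trace.re -
              prob (E (Sum.elim ((H.sample m κ).eval r) c)
                (outcome c (Φ₀ ((H.sample m κ).eval r) σ)))
                fun w => H.hash ((H.sample m κ).eval r) w = c) -
            2 * ((outcome c (Φ₀ ((H.sample m κ).eval r) σ)).trace.re -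
              prob (T (Sum.elim ((H.sample m κ).eval r) c)
                (outcome c (Φ₀ ((H.sample m κ).eval r) σ)))
                fun w => good (Sum.elim (Sum.elim ((H.sample m κ).eval r) c) w) () = true))) ≤
        (average fun r => ∑ c, prob (E (Sum.elim ((H.sample m κ).eval r) c)
          (outcome c (Φ₀ ((H.sample m κ).eval r) σ)))
          fun w => good (Sum.elim (Sum.elim ((H.sample m κ).eval r) c) w) () = true) +
        |H.gameProb A D (fun h => H.measureHash h) - H.gameProb A D fun _ => HashFamily.collapse| +
        2 * |H.gameProb A' D' (fun h => H.measureHash h) -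
          H.gameProb A' D' fun _ => HashFamily.collapse| := by
  obtain ⟨k, V, U, hV, hU, hVE, hUV⟩ := hE.dilate
  obtain ⟨D, hDs, hD⟩ := exists_distinguisher H hT hU hg
  obtain ⟨A, hAs, hA⟩ := exists_preparation H hΦ₀ hσ hV
  obtain ⟨A', D', hAs', hDs', hD'⟩ := exists_collisionTest H hΦ₀ hσ hV hT hU
  refine ⟨_, _, A, D, A', D', ⟨by omega, by omega, by omega, by omega⟩, ?_⟩
  set smp := (H.sample m κ).eval
  have hω : ∀ h c, (V (Sum.elim h c) (outcome c (Φ₀ h σ))).PosSemidef := fun h c =>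
    (hV.eff _).posSemidef (posSemidef_outcome_eff hΦ₀ h hσ.1 c)
  have hX : ∀ h c, Eff (fun ρ => T (Sum.elim h c) (U ρ)) _ := fun h c => (hT.eff _).comp hU
  have hpt : ∀ h, (∑ c, ((outcome c (Φ₀ h σ)).trace.re -
      3 * ((outcome c (Φ₀ h σ)).trace.re -
        prob (E (Sum.elim h c) (outcome c (Φ₀ h σ))) fun w => H.hash h w = c) -
      2 * ((outcome c (Φ₀ h σ)).trace.re - prob (T (Sum.elim h c) (outcome c (Φ₀ h σ)))
          fun w => good (Sum.elim (Sum.elim h c) w) () = true))) ≤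
      (D.apply (tensor (basisState h) (H.measureHash h (A.apply (basisState h))))
        (fun _ => false) (fun _ => false)).re := by
    intro h
    rw [hA]
    refine le_of_le_of_eq ?_ (hD h _ (fun x y => H.hash h x = H.hash h y)).symm
    refine Finset.sum_le_sum fun c _ => ?_
    have hproj : proj (fun w => H.hash h w = c) (mask (fun x y => H.hash h x = H.hash h y)
        (V (Sum.elim h c) (outcome c (Φ₀ h σ)))) =
        proj (fun w => H.hash h w = c) (V (Sum.elim h c) (outcome c (Φ₀ h σ))) := by
      funext f g
      rw [proj_apply, proj_apply, mask_apply]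
      refine if_ctx_congr Iff.rfl (fun hfg => if_pos (hfg.1.trans hfg.2.symm)) fun _ => rfl
    have := gentle_test (hX h c) (fun w => H.hash h w = c)
      (fun w => good (Sum.elim (Sum.elim h c) w) () = true) (hω h c)
    rw [hVE, hUV, hV.trace] at this
    rwa [hproj]
  have hpt' : ∀ h, (D.apply (tensor (basisState h) (HashFamily.collapse (A.apply (basisState h))))
        (fun _ => false) (fun _ => false)).re ≤
      (∑ c, prob (E (Sum.elim h c) (outcome c (Φ₀ h σ)))
          fun w => good (Sum.elim (Sum.elim h c) w) () = true) +
      2 * ((D'.apply (tensor (basisState h) (H.measureHash h (A'.apply (basisState h))))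
        (fun _ => false) (fun _ => false)).re + -1 *
        (D'.apply (tensor (basisState h) (HashFamily.collapse (A'.apply (basisState h))))
        (fun _ => false) (fun _ => false)).re) := by
    intro h
    rw [hA]
    refine (hD h _ (fun x y => x = y)).trans_le ?_
    have e1 : (D'.apply (tensor (basisState h) (H.measureHash h (A'.apply (basisState h))))
        (fun _ => false) (fun _ => false)).re = _ :=
      hD' h (fun x y => H.hash h x = H.hash h y) (fun _ => rfl) fun _ _ h => h.symm
    have e2 : (D'.apply (tensor (basisState h) (HashFamily.collapse (A'.apply (basisState h))))
        (fun _ => false) (fun _ => false)).re = _ :=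
      hD' h (fun x y => x = y) (fun _ => rfl) fun _ _ h => h.symm
    rw [e1, e2, neg_one_mul, ← sub_eq_add_neg, ← Finset.sum_sub_distrib, Finset.mul_sum,
      ← Finset.sum_add_distrib]
    refine Finset.sum_le_sum fun c _ => ?_
    have := prob_measured_le H (hX h c) (hω h c) h c
      (fun w => good (Sum.elim (Sum.elim h c) w) () = true) (hgood h c)
    rwa [hVE] at this
  -- the game in which only the hash value is measured; the measurement commutes with the test of
  -- the opening, so that the first extractor is undone faithfully
  have h1 := average_mono fun r => hpt (smp r)
  -- the game in which the string is measured; if it differs from the output of the second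
  -- extractor, then the two form a collision
  have h2 := average_mono fun r => hpt' (smp r)
  rw [average_add, average_const_mul, average_add, average_const_mul] at h2
  have h1' : _ ≤ H.gameProb A D (fun h => H.measureHash h) := h1
  have h2' : H.gameProb A D (fun _ => HashFamily.collapse) ≤ _ + 2 *
    (H.gameProb A' D' (fun h => H.measureHash h) + -1 *
      H.gameProb A' D' (fun _ => HashFamily.collapse)) := h2
  have h3 := le_abs_self (H.gameProb A D (fun h => H.measureHash h) -
    H.gameProb A D fun _ => HashFamily.collapse)
  have h4 := le_abs_self (H.gameProb A' D' (fun h => H.measureHash h) -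
    H.gameProb A' D' fun _ => HashFamily.collapse)
  linarith

end Collapsing

/-! ### Polynomially bounded and negligible functions -/

section Growth

theorem PolyBounded.mono {f g : ℕ → ℕ} (hf : PolyBounded f) (h : ∀ κ, g κ ≤ f κ) :
    PolyBounded g :=
  let ⟨c, hc⟩ := hf
  ⟨c, fun κ => (h κ).trans (hc κ)⟩

theorem PolyBounded.const (a : ℕ) : PolyBounded fun _ => a :=
  ⟨a, fun κ => a.lt_two_pow_self.le.trans (Nat.pow_le_pow_left (by omega) a)⟩

theorem PolyBounded.id : PolyBounded fun κ => κ :=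
  ⟨1, fun κ => (Nat.le_add_right κ 2).trans_eq (pow_one _).symm⟩

theorem PolyBounded.mul {f g : ℕ → ℕ} (hf : PolyBounded f) (hg : PolyBounded g) :
    PolyBounded fun κ => f κ * g κ :=
  let ⟨c, hc⟩ := hf
  let ⟨d, hd⟩ := hg
  ⟨c + d, fun κ => (Nat.mul_le_mul (hc κ) (hd κ)).trans_eq (pow_add _ _ _).symm⟩

theorem PolyBounded.add {f g : ℕ → ℕ} (hf : PolyBounded f) (hg : PolyBounded g) :
    PolyBounded fun κ => f κ + g κ := by
  obtain ⟨c, hc⟩ := hf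
  obtain ⟨d, hd⟩ := hg
  refine ⟨c + d + 1, fun κ => ?_⟩
  have h1 : (κ + 2) ^ c ≤ (κ + 2) ^ (c + d) := Nat.pow_le_pow_right (by omega) (by omega)
  have h2 : (κ + 2) ^ d ≤ (κ + 2) ^ (c + d) := Nat.pow_le_pow_right (by omega) (by omega)
  have := hc κ
  have := hd κ
  rw [pow_succ]
  nlinarith

theorem PolyBounded.pow {f : ℕ → ℕ} (hf : PolyBounded f) (k : ℕ) :
    PolyBounded fun κ => f κ ^ k :=
  let ⟨c, hc⟩ := hf
  ⟨c * k, fun κ => (Nat.pow_le_pow_left (hc κ) k).trans_eq (pow_mul _ _ _).symm⟩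

theorem Negligible.add {μ ν : ℕ → ℝ} (hμ : Negligible μ) (hν : Negligible ν) :
    Negligible fun κ => μ κ + ν κ :=
  Asymptotics.SuperpolynomialDecay.add hμ hν

theorem Negligible.const_mul {μ : ℕ → ℝ} (hμ : Negligible μ) (c : ℝ) :
    Negligible fun κ => c * μ κ :=
  Asymptotics.SuperpolynomialDecay.const_mul hμ c

theorem Negligible.abs {μ : ℕ → ℝ} (hμ : Negligible μ) : Negligible fun κ => |μ κ| :=
  hμ.trans_abs_le fun κ => (abs_abs (μ κ)).le

/-- Bounds by negligible functions for all sequences of instances give a bound that is uniform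
in the instances. -/
theorem exists_negligible_bound {ζ : ℕ → Type*} [∀ κ, Nonempty (ζ κ)] (V : ∀ κ, ζ κ → ℝ) (B : ℝ)
    (hB : ∀ κ z, V κ z ≤ B)
    (h : ∀ z : ∀ κ, ζ κ, ∃ μ, Negligible μ ∧ ∀ κ, V κ (z κ) ≤ μ κ) :
    ∃ μ, Negligible μ ∧ (∀ κ, 0 ≤ μ κ) ∧ ∀ κ z, V κ z ≤ μ κ := by
  -- an instance whose value is at least half of the supremum, if the supremum is positive
  have hz : ∀ κ, ∃ z, ∀ z', V κ z' ≤ 2 * max (V κ z) 0 := by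
    intro κ
    by_cases hpos : 0 < ⨆ z, V κ z
    · obtain ⟨z, hz⟩ := exists_lt_of_lt_ciSup (half_lt_self hpos)
      refine ⟨z, fun z' => ?_⟩
      have h1 : V κ z' ≤ ⨆ z, V κ z := le_ciSup ⟨B, by rintro _ ⟨z, rfl⟩; exact hB κ z⟩ z'
      linarith [le_max_left (V κ z) 0]
    · refine ⟨Classical.arbitrary _, fun z' => ?_⟩
      have h1 : V κ z' ≤ ⨆ z, V κ z := le_ciSup ⟨B, by rintro _ ⟨z, rfl⟩; exact hB κ z⟩ z'
      linarith [le_max_right (V κ (Classical.arbitrary _)) 0]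
  choose z hz using hz
  obtain ⟨μ, hμ, hV⟩ := h z
  refine ⟨fun κ => 2 * |μ κ|, hμ.abs.const_mul 2, fun κ => by positivity, fun κ z' => ?_⟩
  have := max_le ((hV κ).trans (le_abs_self _)) (abs_nonneg (μ κ))
  linarith [hz κ z']

theorem HashFamily.polyBounded_descLen (H : HashFamily) (m : ℕ → ℕ) :
    PolyBounded fun κ => H.descLen (m κ) κ :=
  let ⟨c, hc⟩ := H.descLen_poly
  ⟨c, fun κ => hc (m κ) κ⟩

theorem HashFamily.polyBounded (H : HashFamily) {m : ℕ → ℕ} (hm : PolyBounded m) :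
    PolyBounded (fun κ => H.coins (m κ) κ) ∧ PolyBounded (fun κ => H.sampleSize (m κ) κ) ∧
      PolyBounded (fun κ => H.evalSize (m κ) κ) := by
  obtain ⟨c, hc⟩ := H.efficient
  have h := ((hm.add PolyBounded.id).add (PolyBounded.const 2)).pow c
  exact ⟨h.mono fun κ => (hc _ κ).1, h.mono fun κ => (hc _ κ).2.1, h.mono fun κ => (hc _ κ).2.2⟩

/-- The description of a relation of polynomial size has polynomial length. -/
theorem polyBounded_card_descIndex {n m s : ℕ → ℕ} (hn : PolyBounded n) (hm : PolyBounded m)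
    (hs : PolyBounded s) : PolyBounded fun κ => Fintype.card (DescIndex (n κ) (m κ) (s κ)) := by
  have hw := (PolyBounded.const 2).add ((hn.add hm).add hs)
  refine ((hs.mul ((PolyBounded.const 4).add ((PolyBounded.const 2).mul hw))).add hw).mono ?_
  intro κ
  have : Fintype.card (DescIndex (n κ) (m κ) (s κ)) =
    Fintype.card ((Fin (s κ) × ((Bool × Bool) ⊕ (Bool × Wire (Fin (n κ) ⊕ Fin (m κ)) (s κ)))) ⊕
      Wire (Fin (n κ) ⊕ Fin (m κ)) (s κ)) := rfl
  rw [this]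
  simp

end Growth

/-! ### Consistency of two extractors, asymptotically -/

section Collapsing

variable {ι R : ℕ → Type} [∀ κ, Fintype (ι κ)] [∀ κ, DecidableEq (ι κ)] [∀ κ, Fintype (R κ)]
  [∀ κ, DecidableEq (R κ)]

/-- Two efficient extractors for a committed string are consistent: if `E` finds openings of the
commitment and `T` finds good openings, then `E` finds good openings. -/
theorem HashFamily.IsCollapsing.consistent {H : HashFamily} (hH : H.IsCollapsing) {m : ℕ → ℕ}
    (hm : PolyBounded m) {N : ℕ → ℕ} (hN : PolyBounded N)
    {Φ₀ : ∀ κ, Bits (Fin (H.descLen (m κ) κ)) → Op (ι κ) → Op (R κ ⊕ Fin κ)}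
    (hΦ₀ : ∀ κ, EffC (Φ₀ κ) (N κ)) {σ : ∀ κ, Op (ι κ)} (hσ : ∀ κ, IsDensity (σ κ))
    (hι : ∀ κ, Fintype.card (ι κ) ≤ N κ)
    {E : ∀ κ, Bits (Fin (H.descLen (m κ) κ) ⊕ Fin κ) → Op (R κ) → Op (Fin (m κ))}
    (hE : ∀ κ, EffC (E κ) (N κ))
    {T : ∀ κ, Bits (Fin (H.descLen (m κ) κ) ⊕ Fin κ) → Op (R κ) → Op (Fin (m κ))}
    (hT : ∀ κ, EffC (T κ) (N κ))
    {good : ∀ κ, Bits ((Fin (H.descLen (m κ) κ) ⊕ Fin κ) ⊕ Fin (m κ)) → Bits Unit}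
    (hg : ∀ κ, HasCircuit (good κ) (N κ))
    (hgood : ∀ κ h c w, good κ (Sum.elim (Sum.elim h c) w) () = true → H.hash h w = c) :
    ∃ μ, Negligible μ ∧ ∀ κ,
      (average fun r => ∑ c,
          ((outcome c (Φ₀ κ ((H.sample (m κ) κ).eval r) (σ κ))).trace.re -
            3 * ((outcome c (Φ₀ κ ((H.sample (m κ) κ).eval r) (σ κ))).trace.re -
              prob (E κ (Sum.elim ((H.sample (m κ) κ).eval r) c)
                (outcome c (Φ₀ κ ((H.sample (m κ) κ).eval r) (σ κ))))
                fun w => H.hash ((H.sample (m κ) κ).eval r) w = c) -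
            2 * ((outcome c (Φ₀ κ ((H.sample (m κ) κ).eval r) (σ κ))).trace.re -
              prob (T κ (Sum.elim ((H.sample (m κ) κ).eval r) c)
                (outcome c (Φ₀ κ ((H.sample (m κ) κ).eval r) (σ κ))))
                fun w => good κ (Sum.elim (Sum.elim ((H.sample (m κ) κ).eval r) c) w) () = true)))
        ≤ (average fun r => ∑ c, prob (E κ (Sum.elim ((H.sample (m κ) κ).eval r) c)
          (outcome c (Φ₀ κ ((H.sample (m κ) κ).eval r) (σ κ))))
          fun w => good κ (Sum.elim (Sum.elim ((H.sample (m κ) κ).eval r) c) w) () = true) +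
          μ κ := by
  choose q q' A D A' D' hsize h using fun κ =>
    exists_collapsing_games H (hΦ₀ κ) (hσ κ) (hE κ) (hT κ) (hg κ) (hgood κ)
  have hB : PolyBounded fun κ => 1000 * (1 + H.descLen (m κ) κ + κ + m κ + N κ +
      H.evalSize (m κ) κ + N κ + N κ + N κ + N κ) :=
    (PolyBounded.const 1000).mul (((((((((PolyBounded.const 1).add
      (H.polyBounded_descLen m)).add PolyBounded.id).add hm).add hN).add
      (H.polyBounded hm).2.2).add hN).add hN).add hN |>.add hN)
  obtain ⟨μ, hμ, hA⟩ := hH m hm q A D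
    (hB.mono fun κ => (hsize κ).1.trans (by have := hι κ; omega))
    (hB.mono fun κ => (hsize κ).2.1.trans (by have := hι κ; omega))
  obtain ⟨μ', hμ', hA'⟩ := hH m hm q' A' D'
    (hB.mono fun κ => (hsize κ).2.2.1.trans (by have := hι κ; omega))
    (hB.mono fun κ => (hsize κ).2.2.2.trans (by have := hι κ; omega))
  refine ⟨fun κ => μ κ + 2 * μ' κ, hμ.add (hμ'.const_mul 2), fun κ => (h κ).trans ?_⟩
  have := hA κ
  have := hA' κ
  linarith

end Collapsing

/-! ### Interactions with a quantum server -/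

section Interaction

variable {σ : Shape} {pub : Type} {M : Type*} [AddCommMonoid M]

/-- The sum, over the next `k` messages of the server, of a function of the messages and the
unnormalized state of the memory afterwards.  The client's messages are given by `send`. -/
noncomputable def interact (send : List (List Bool) → List Bool) (A : Adversary σ pub)
    (F : ∀ j, List (List Bool) → Op (Fin (A.mem j)) → M) :
    (k i : ℕ) → List (List Bool) → Op (Fin (A.mem i)) → M
  | 0, i, hist, ρ => F i hist ρ
  | k + 1, i, hist, ρ =>
    ∑ b : Bits (Fin (σ.recvLen i)),
      interact send A F k (i + 1) (hist ++ [List.ofFn b])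
        (outcome b ((A.step i).apply
          (tensor ρ (basisState (toBits (σ.sendLen i) (send hist))))))

theorem acceptFrom_eq_interact (C : Client σ) (A : Adversary σ pub)
    (r : Bits (Fin σ.clientCoins)) (k i : ℕ) (hist : List (List Bool)) (ρ : Op (Fin (A.mem i))) :
    acceptFrom C A r k i hist ρ = interact (C.send r) A
      (fun _ hist ρ => if C.accept r hist then ρ.trace.re else 0) k i hist ρ := by
  induction k generalizing i hist with
  | zero => rfl
  | succ k ih => exact Finset.sum_congr rfl fun b _ => ih _ _ _

theorem interact_add (send : List (List Bool) → List Bool) (A : Adversary σ pub)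
    (F : ∀ j, List (List Bool) → Op (Fin (A.mem j)) → M) (k l i : ℕ) (hist : List (List Bool))
    (ρ : Op (Fin (A.mem i))) :
    interact send A F (k + l) i hist ρ =
      interact send A (fun j hist ρ => interact send A F l j hist ρ) k i hist ρ := by
  induction k generalizing i hist with
  | zero => rw [Nat.zero_add]; rfl
  | succ k ih =>
    rw [Nat.succ_add]
    exact Finset.sum_congr rfl fun b _ => ih _ _ _

theorem interact_congr {send : List (List Bool) → List Bool} (A : Adversary σ pub)
    {F F' : ∀ j, List (List Bool) → Op (Fin (A.mem j)) → M} (k i N : ℕ) (hN : i + k = N)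
    (hF : ∀ l ρ, F N l ρ = F' N l ρ) (hist : List (List Bool)) (ρ : Op (Fin (A.mem i))) :
    interact send A F k i hist ρ = interact send A F' k i hist ρ := by
  induction k generalizing i hist with
  | zero => subst hN; exact hF _ _
  | succ k ih => exact Finset.sum_congr rfl fun b _ => ih _ (by omega) _ _

/-- Additive maps commute with the sum over the messages. -/
theorem map_interact {M' : Type*} [AddCommMonoid M'] (φ : M →+ M')
    (send : List (List Bool) → List Bool) (A : Adversary σ pub)
    (F : ∀ j, List (List Bool) → Op (Fin (A.mem j)) → M) (k i : ℕ) (hist : List (List Bool))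
    (ρ : Op (Fin (A.mem i))) :
    φ (interact send A F k i hist ρ) =
      interact send A (fun j hist ρ => φ (F j hist ρ)) k i hist ρ := by
  induction k generalizing i hist with
  | zero => rfl
  | succ k ih =>
    simp only [interact]
    rw [map_sum]
    exact Finset.sum_congr rfl fun b _ => ih _ _ _

theorem eff_step_message (A : Adversary σ pub) (i : ℕ) (y : Bits (Fin (σ.sendLen i))) :
    Eff (fun ρ => (A.step i).apply (tensor ρ (basisState y)))
      ((A.step i).size + σ.sendLen i) :=
  ((A.step i).eff.comp (Eff.id.then_tensor (isDensity_basisState y))).mono (by simp; omega)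

theorem interact_trace (send : List (List Bool) → List Bool) (A : Adversary σ pub) (k i : ℕ)
    (hist : List (List Bool)) (ρ : Op (Fin (A.mem i))) :
    interact send A (fun _ _ ρ => ρ.trace.re) k i hist ρ = ρ.trace.re := by
  induction k generalizing i hist with
  | zero => rfl
  | succ k ih =>
    simp only [interact, ih]
    rw [← Complex.re_sum, sum_trace_outcome, (eff_step_message A i _).trace]

theorem interact_le (send : List (List Bool) → List Bool) (A : Adversary σ pub)
    {F F' : ∀ j, List (List Bool) → Op (Fin (A.mem j)) → ℝ} (k i N : ℕ) (hN : i + k = N)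
    (hF : ∀ l τ, τ.PosSemidef → F N l τ ≤ F' N l τ) (hist : List (List Bool))
    {ρ : Op (Fin (A.mem i))} (hρ : ρ.PosSemidef) :
    interact send A F k i hist ρ ≤ interact send A F' k i hist ρ := by
  induction k generalizing i hist with
  | zero => subst hN; exact hF _ _ hρ
  | succ k ih =>
    exact Finset.sum_le_sum fun b _ => ih _ (by omega) _
      (outcome_posSemidef b ((eff_step_message A i _).posSemidef hρ))

theorem acceptFrom_nonneg (C : Client σ) (A : Adversary σ pub) (r : Bits (Fin σ.clientCoins))
    (k i : ℕ) (hist : List (List Bool)) {ρ : Op (Fin (A.mem i))} (hρ : ρ.PosSemidef) :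
    0 ≤ acceptFrom C A r k i hist ρ := by
  induction k generalizing i hist with
  | zero =>
    rw [acceptFrom]
    split_ifs
    exacts [trace_re_nonneg hρ, le_rfl]
  | succ k ih =>
    exact Finset.sum_nonneg fun b _ => ih _ _
      (outcome_posSemidef b ((eff_step_message A i _).posSemidef hρ))

theorem acceptFrom_le_trace (C : Client σ) (A : Adversary σ pub) (r : Bits (Fin σ.clientCoins))
    (k i : ℕ) (hist : List (List Bool)) {ρ : Op (Fin (A.mem i))} (hρ : ρ.PosSemidef) :
    acceptFrom C A r k i hist ρ ≤ ρ.trace.re := by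
  rw [acceptFrom_eq_interact, ← interact_trace (C.send r) A k i hist ρ]
  refine interact_le _ _ _ _ _ rfl (fun l τ hτ => ?_) _ hρ
  split_ifs
  exacts [le_rfl, trace_re_nonneg hτ]

theorem acceptFrom_add (C : Client σ) (A : Adversary σ pub) (r : Bits (Fin σ.clientCoins))
    (k i : ℕ) (hist : List (List Bool)) (ρ τ : Op (Fin (A.mem i))) :
    acceptFrom C A r k i hist (ρ + τ) =
      acceptFrom C A r k i hist ρ + acceptFrom C A r k i hist τ := by
  induction k generalizing i hist with
  | zero =>
    rw [acceptFrom, acceptFrom, acceptFrom]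
    split_ifs <;> simp [Matrix.trace_add]
  | succ k ih =>
    rw [acceptFrom, acceptFrom, acceptFrom, ← Finset.sum_add_distrib]
    refine Finset.sum_congr rfl fun b _ => ?_
    rw [← ih, ← outcome_add]
    exact congrArg (fun M => acceptFrom C A r k (i + 1) _ (outcome b M))
      ((eff_step_message A i _).add ρ τ)

theorem acceptFrom_smul (C : Client σ) (A : Adversary σ pub) (r : Bits (Fin σ.clientCoins))
    (k i : ℕ) (hist : List (List Bool)) (c : ℝ) (ρ : Op (Fin (A.mem i))) :
    acceptFrom C A r k i hist ((c : ℂ) • ρ) = c * acceptFrom C A r k i hist ρ := by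
  induction k generalizing i hist with
  | zero =>
    rw [acceptFrom, acceptFrom]
    split_ifs
    exacts [trace_re_smul c ρ, (mul_zero c).symm]
  | succ k ih =>
    rw [acceptFrom, acceptFrom, Finset.mul_sum]
    refine Finset.sum_congr rfl fun b _ => ?_
    rw [← ih, ← outcome_smul]
    exact congrArg (fun M => acceptFrom C A r k (i + 1) _ (outcome b M))
      ((eff_step_message A i _).smul _ ρ)

section AcceptProb

variable [Fintype pub] [DecidableEq pub]

theorem eff_load (A : Adversary σ pub) (p : Bits pub) :
    Eff (fun ρ => A.load.apply (tensor ρ (basisState p))) (A.load.size + Fintype.card pub) :=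
  (A.load.eff.comp (Eff.id.then_tensor (isDensity_basisState p))).mono (by omega)

theorem acceptProb_add (C : Client σ) (A : Adversary σ pub) (p : Bits pub)
    (ρ τ : Op (Fin A.reg)) :
    acceptProb C A p (ρ + τ) = acceptProb C A p ρ + acceptProb C A p τ := by
  rw [acceptProb, acceptProb, acceptProb, ← average_add]
  congr 1
  funext r
  rw [← acceptFrom_add]
  exact congrArg _ ((eff_load A p).add ρ τ)

theorem acceptProb_smul (C : Client σ) (A : Adversary σ pub) (p : Bits pub) (c : ℝ)
    (ρ : Op (Fin A.reg)) :
    acceptProb C A p ((c : ℂ) • ρ) = c * acceptProb C A p ρ := by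
  rw [acceptProb, acceptProb, ← average_const_mul]
  congr 1
  funext r
  rw [← acceptFrom_smul]
  exact congrArg _ ((eff_load A p).smul c ρ)

theorem acceptProb_le_trace (C : Client σ) (A : Adversary σ pub) (p : Bits pub)
    {ρ : Op (Fin A.reg)} (hρ : ρ.PosSemidef) : acceptProb C A p ρ ≤ ρ.trace.re := by
  rw [← average_const (ι := Fin σ.clientCoins) ρ.trace.re]
  refine average_mono fun r => (acceptFrom_le_trace C A r _ _ _
    ((eff_load A p).posSemidef hρ)).trans_eq ?_
  rw [(eff_load A p).trace]

theorem acceptProb_nonneg (C : Client σ) (A : Adversary σ pub) (p : Bits pub)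
    {ρ : Op (Fin A.reg)} (hρ : ρ.PosSemidef) : 0 ≤ acceptProb C A p ρ := by
  rw [← average_const (ι := Fin σ.clientCoins) 0]
  exact average_mono fun r => acceptFrom_nonneg C A r _ _ _ ((eff_load A p).posSemidef hρ)

end AcceptProb

end Interaction

/-! ### A part of an interaction as an interaction of its own -/

section Window

theorem nonempty_qop (ι ο : Type) [Fintype ι] [DecidableEq ι] [Fintype ο] [DecidableEq ο] :
    Nonempty (QOp ι ο) :=
  let ⟨Q, _⟩ := ((Eff.id (ι := ι)).then_tensor (isDensity_basisState fun _ : ο => false)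
    |>.then_relabel (Equiv.sumComm ι ο)).then_ptr
  ⟨Q⟩

/-- A step of a server with message lengths replaced by equal ones. -/
def castStep {a b s s' t t' : ℕ} (hs : s = s') (ht : t = t') (Q : QOp (Fin a ⊕ Fin s)
    (Fin b ⊕ Fin t)) : QOp (Fin a ⊕ Fin s') (Fin b ⊕ Fin t') :=
  hs ▸ ht ▸ Q

theorem size_castStep {a b s s' t t' : ℕ} (hs : s = s') (ht : t = t') (Q : QOp (Fin a ⊕ Fin s)
    (Fin b ⊕ Fin t)) : (castStep hs ht Q).size = Q.size := by
  subst hs ht; rfl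

theorem sum_castStep {M : Type*} [AddCommMonoid M] {a b s s' t t' : ℕ} (hs : s = s')
    (ht : t = t') (Q : QOp (Fin a ⊕ Fin s) (Fin b ⊕ Fin t)) (ρ : Op (Fin a)) (l : List Bool)
    (G : List Bool → Op (Fin b) → M) :
    ∑ z : Bits (Fin t), G (List.ofFn z) (outcome z (Q.apply (tensor ρ (basisState (toBits s l))))) =
      ∑ z : Bits (Fin t'), G (List.ofFn z) (outcome z ((castStep hs ht Q).apply
        (tensor ρ (basisState (toBits s' l))))) := by
  subst hs ht; rfl

variable {σ σ' : Shape} {pub : Type} {pub' : Type} [Fintype pub'] [DecidableEq pub']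

theorem exists_discard_input (a : ℕ) : ∃ Q : QOp (Fin a ⊕ pub') (Fin a),
    Q.size ≤ 0 ∧ ∀ (p : Bits pub') ρ, Q.apply (tensor ρ (basisState p)) = ρ :=
  (EffC.of_eff Eff.id).exists_qop

/-- The server that plays the rounds of `A` from round `o` on; its initial register is the memory
of `A` before these rounds. -/
noncomputable def window (A : Adversary σ pub) (o : ℕ) (σ' : Shape) (pub' : Type) [Fintype pub']
    [DecidableEq pub'] : Adversary σ' pub' where
  reg := A.mem o
  mem i := A.mem (o + i)
  load := (exists_discard_input (A.mem o)).choose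
  step i := if h : σ.sendLen (o + i) = σ'.sendLen i ∧ σ.recvLen (o + i) = σ'.recvLen i then
    castStep h.1 h.2 (A.step (o + i)) else Classical.choice (nonempty_qop _ _)

theorem window_load (A : Adversary σ pub) (o : ℕ) (p : Bits pub') (ρ : Op (Fin (A.mem o))) :
    (window A o σ' pub').load.apply (tensor ρ (basisState p)) = ρ :=
  (exists_discard_input (A.mem o)).choose_spec.2 p ρ

theorem window_size_le (A : Adversary σ pub) (o : ℕ)
    (hlen : ∀ i < σ'.rounds, σ.sendLen (o + i) = σ'.sendLen i ∧ σ.recvLen (o + i) = σ'.recvLen i)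
    (ho : o + σ'.rounds ≤ σ.rounds) : (window A o σ' pub').size ≤ A.mem o + A.size := by
  have h1 : (window A o σ' pub').load.size ≤ 0 :=
    (exists_discard_input (A.mem o)).choose_spec.1
  have h2 : ∑ i ∈ Finset.range σ'.rounds, ((window A o σ' pub').step i).size =
      ∑ i ∈ Finset.range σ'.rounds, (A.step (o + i)).size := by
    refine Finset.sum_congr rfl fun i hi => ?_
    rw [window]
    dsimp only
    rw [dif_pos (hlen i (Finset.mem_range.1 hi)), size_castStep]
  have h3 : ∑ i ∈ Finset.range σ'.rounds, (A.step (o + i)).size ≤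
      ∑ i ∈ Finset.range σ.rounds, (A.step i).size := by
    refine le_trans ?_ (Finset.sum_le_sum_of_subset (Finset.range_subset_range.2 ho))
    rw [Finset.sum_range_add]
    omega
  have h4 : (window A o σ' pub').reg ≤ A.mem o := le_rfl
  rw [Adversary.size, h2, Adversary.size]
  omega

/-- The rounds from `o` on of an interaction are an interaction with the window of the server. -/
theorem interact_window {M : Type*} [AddCommMonoid M] (A : Adversary σ pub) (o N : ℕ)
    (hlen : ∀ i < N, σ.sendLen (o + i) = σ'.sendLen i ∧ σ.recvLen (o + i) = σ'.recvLen i)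
    {send send' : List (List Bool) → List Bool} (pre : List (List Bool))
    (hsend : ∀ l, l.length < N → send (pre ++ l) = send' l)
    {F : ∀ j, List (List Bool) → Op (Fin (A.mem j)) → M}
    {F' : ∀ j, List (List Bool) → Op (Fin ((window A o σ' pub').mem j)) → M}
    (hF : ∀ l ρ, l.length = N → F (o + N) (pre ++ l) ρ = F' N l ρ)
    (k i : ℕ) (hN : i + k = N) (hist : List (List Bool)) (hi : hist.length = i)
    (ρ : Op (Fin (A.mem (o + i)))) :
    interact send A F k (o + i) (pre ++ hist) ρ =
      interact send' (window A o σ' pub') F' k i hist ρ := by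
  induction k generalizing i hist with
  | zero =>
    subst hN
    exact hF _ _ hi
  | succ k ih =>
    have h := hlen i (by omega)
    have hstep : (window A o σ' pub').step i = castStep h.1 h.2 (A.step (o + i)) := dif_pos h
    have h1 := sum_castStep h.1 h.2 (A.step (o + i)) ρ (send' hist) fun l τ =>
      interact send' (window A o σ' pub') F' k (i + 1) (hist ++ [l]) τ
    refine Eq.trans (Finset.sum_congr rfl fun b _ => ?_) (h1.trans ?_)
    · rw [hsend _ (by omega), List.append_assoc]
      exact ih (i + 1) (by omega) _ (by simp [hi]) _
    · exact Finset.sum_congr rfl fun b _ => congrArg (fun Q : QOp _ _ =>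
        interact send' (window A o σ' pub') F' k (i + 1) (hist ++ [List.ofFn b]) (outcome b
          (Q.apply (tensor ρ (basisState (toBits (σ'.sendLen i) (send' hist)))))))  hstep.symm

end Window

/-! ### Simulating an interaction -/

section Simulation

variable {σ : Shape} {pub γ π : Type} [Fintype γ] [DecidableEq γ] [Fintype π] [DecidableEq π]

/-- The positions in the messages of the first `i` rounds. -/
abbrev Transcript (len : ℕ → ℕ) (i : ℕ) : Type := Σ j : Fin i, Fin (len j)

/-- The messages of the first `i` rounds as a list. -/
def messages {len : ℕ → ℕ} {i : ℕ} (b : Bits (Transcript len i)) : List (List Bool) :=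
  List.ofFn fun j => List.ofFn fun p => b ⟨j, p⟩

/-- The positions in the messages of `i + 1` rounds, as positions in the parameters, the messages
of `i` rounds and the next message. -/
def splitTranscript (γ : Type) (len : ℕ → ℕ) (i : ℕ) :
    γ ⊕ Transcript len (i + 1) → (γ ⊕ Transcript len i) ⊕ Fin (len i) :=
  Sum.elim (fun g => .inl (.inl g)) fun p => Fin.lastCases
    (motive := fun j => Fin (len j) → (γ ⊕ Transcript len i) ⊕ Fin (len i))
    (fun q => .inr q) (fun j q => .inl (.inr ⟨j, q⟩)) p.1 p.2

theorem messages_splitTranscript {len : ℕ → ℕ} {i : ℕ} (g : Bits (γ ⊕ Transcript len i))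
    (b : Bits (Fin (len i))) :
    messages ((Sum.elim g b ∘ splitTranscript γ len i) ∘ Sum.inr) =
      messages (g ∘ Sum.inr) ++ [List.ofFn b] := by
  rw [messages, List.ofFn_succ', List.concat_eq_append]
  congr 1
  · rw [messages]
    congr 1
    funext j
    congr 1
    funext q
    simp [splitTranscript]
  · congr 2
    funext q
    simp [splitTranscript]

/-- An interaction with a client whose messages are computed by circuits, followed by a channel,
is a channel. -/
theorem EffC.interact (A : Adversary σ pub) {send : Bits γ → List (List Bool) → List Bool}
    {K S N : ℕ} (hsend : ∀ i < K, HasCircuit (fun g : Bits (γ ⊕ Transcript σ.recvLen i) =>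
      toBits (σ.sendLen i) (send (g ∘ Sum.inl) (messages (g ∘ Sum.inr)))) S)
    (hS : ∀ i < K, (A.step i).size ≤ S ∧ σ.sendLen i ≤ S ∧ σ.recvLen i ≤ S)
    {Ψ : Bits γ → Op (Fin (A.mem K)) → Op π} (hΨ : EffC Ψ N)
    {F : Bits γ → ∀ j, List (List Bool) → Op (Fin (A.mem j)) → Op π}
    (hF : ∀ g l ρ, F g K l ρ = Ψ g ρ) (k i : ℕ) (hi : i + k = K) :
    EffC (fun (g : Bits (γ ⊕ Transcript σ.recvLen i)) ρ =>
      SuccTest.interact (send (g ∘ Sum.inl)) A (F (g ∘ Sum.inl)) k i (messages (g ∘ Sum.inr)) ρ)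
      (N + 2 * Fintype.card γ + k * (100 * ((K + 1) * (S + 1) + Fintype.card γ))) := by
  induction k generalizing i with
  | zero =>
    obtain rfl : i = K := hi
    refine ((hΨ.precomp (HasCircuit.select (Sum.inl : γ → γ ⊕ Transcript σ.recvLen i))).mono
      (by omega)).congr fun g ρ => ?_
    exact hF _ _ _
  | succ k ih =>
    have hT : ∀ i ≤ K, Fintype.card (Transcript σ.recvLen i) ≤ K * S := by
      intro i hi
      rw [Fintype.card_sigma]
      simp only [Fintype.card_fin]
      refine (Finset.sum_le_card_nsmul _ _ S fun (j : Fin i) _ =>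
        (hS j (j.isLt.trans_le hi)).2.2).trans ?_
      simp only [Finset.card_univ, Fintype.card_fin, smul_eq_mul]
      exact Nat.mul_le_mul_right S hi
    have hstep := (EffC.of_eff (A.step i).eff).comp
      (EffC.append (ι := Fin (A.mem i)) (hsend i (by omega)))
    have h := hstep.bind ((ih (i + 1) (by omega)).precomp
      (HasCircuit.select (splitTranscript γ σ.recvLen i)))
    refine (h.mono ?_).congr fun g ρ => ?_
    · have h1 := hT i (by omega)
      have h2 := hT (i + 1) (by omega)
      have h3 := hS i (by omega)
      simp only [Fintype.card_sum, Fintype.card_fin]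
      have h4 : (K + 1) * (S + 1) = K * S + K + S + 1 := by ring
      rw [add_mul (k) 1, one_mul, h4]
      omega
    · rw [SuccTest.interact]
      refine Finset.sum_congr rfl fun b _ => ?_
      have : (Sum.elim g b ∘ splitTranscript γ σ.recvLen i) ∘ Sum.inl = g ∘ Sum.inl := rfl
      have h2 := messages_splitTranscript g b
      rw [this]
      rw [h2]

end Simulation

/-! ### A server that plays one of two strategies -/

section Switch

variable {γ ι₁ ι₂ ο₁ ο₂ : Type} [Fintype γ] [DecidableEq γ] [Fintype ι₁] [DecidableEq ι₁]
  [Fintype ι₂] [DecidableEq ι₂] [Fintype ο₁] [DecidableEq ο₁] [Fintype ο₂] [DecidableEq ο₂]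

/-- Two channels side by side. -/
theorem EffC.par {Φ₁ : Bits γ → Op ι₁ → Op ο₁} {Φ₂ : Bits γ → Op ι₂ → Op ο₂} {N₁ N₂ : ℕ}
    (h₁ : EffC Φ₁ N₁) (h₂ : EffC Φ₂ N₂) :
    ∃ Ψ : Bits γ → Op (ι₁ ⊕ ι₂) → Op (ο₁ ⊕ ο₂),
      EffC Ψ (N₁ + N₂ + 6 * Fintype.card γ) ∧
      ∀ g ρ τ, Ψ g (tensor ρ τ) = tensor (Φ₁ g ρ) (Φ₂ g τ) := by
  have h := (EffC.of_eff (γ := γ) (Eff.id.then_relabel (Equiv.sumComm ο₂ ο₁))).comp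
    ((h₂.ext (Z := ο₁)).comp ((EffC.of_eff (γ := γ)
      (Eff.id.then_relabel (Equiv.sumComm ο₁ ι₂))).comp (h₁.ext (Z := ι₂))))
  refine ⟨_, h.mono (by omega), fun g ρ τ => ?_⟩
  rw [ext_tensor_left (h₁.eff g).smul, relabel_sumComm_tensor, ext_tensor_left (h₂.eff g).smul,
    relabel_sumComm_tensor]

/-- The memory of two servers and a flag. -/
noncomputable def flagEquiv (a b : ℕ) : (Fin a ⊕ Fin b) ⊕ Unit ≃ Fin (1 + (a + b)) :=
  Fintype.equivFinOfCardEq (by simp [add_comm])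

/-- The memories of two servers, with a flag that tells which of them is active. -/
noncomputable def switchState {a b : ℕ} (f : Bool) (ρ : Op (Fin a)) (τ : Op (Fin b)) :
    Op (Fin (1 + (a + b))) :=
  relabel (flagEquiv a b) (tensor (tensor ρ τ) (basisState fun _ => f))

theorem relabel_flagEquiv_switchState {a b : ℕ} (f : Bool) (ρ : Op (Fin a)) (τ : Op (Fin b)) :
    relabel (flagEquiv a b).symm (switchState f ρ τ) =
      tensor (tensor ρ τ) (basisState fun _ => f) := by
  rw [switchState, relabel_relabel, Equiv.self_trans_symm, relabel_refl]

theorem isDensity_switchState {a b : ℕ} (f : Bool) {ρ : Op (Fin a)} {τ : Op (Fin b)}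
    (hρ : IsDensity ρ) (hτ : IsDensity τ) : IsDensity (switchState f ρ τ) :=
  ((hρ.tensor hτ).tensor (isDensity_basisState _)).relabel _

theorem sum_bits_unit_flag {M : Type*} [AddCommMonoid M] (f : Bool) (F : Bits Unit → M) :
    (∑ b : Bits Unit, if b = (fun _ => f) then F b else 0) = F fun _ => f := by
  rw [Finset.sum_ite_eq' Finset.univ _ F]
  simp

/-- Reading the flag. -/
theorem EffC.readFlag {a b : ℕ} {ο : Type} [Fintype ο] [DecidableEq ο]
    {Ψ : Bits (γ ⊕ Unit) → Op (Fin a ⊕ Fin b) → Op ο} {N : ℕ} (h : EffC Ψ N) :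
    ∃ Q : QOp (Fin (1 + (a + b)) ⊕ γ) ο, Q.size ≤ N + 2 + 2 * Fintype.card γ ∧
      ∀ f ρ τ g, Q.apply (tensor (switchState f ρ τ) (basisState g)) =
        Ψ (Sum.elim g fun _ => f) (tensor ρ τ) := by
  obtain ⟨Q, hQ, hQ'⟩ := (h.read.comp (EffC.of_eff (Eff.id.then_relabel
    (flagEquiv a b).symm))).exists_qop
  refine ⟨Q, hQ.trans (by simp), fun f ρ τ g => ?_⟩
  rw [hQ', relabel_flagEquiv_switchState]
  have : ∀ c : Bits Unit, Ψ (Sum.elim g c) (outcome c (tensor (tensor ρ τ)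
      (basisState fun _ => f))) =
      if c = (fun _ => f) then Ψ (Sum.elim g c) (tensor ρ τ) else 0 := by
    intro c
    rw [outcome_tensor_basisState]
    split_ifs
    · rfl
    · exact (h.eff _).zero
  rw [Finset.sum_congr rfl fun c _ => this c, sum_bits_unit_flag f fun c => Ψ (Sum.elim g c) _]

theorem outcome_relabel_tensor {a b t u : Type} [Fintype a] [DecidableEq a] [Fintype b]
    [DecidableEq b] [Fintype t] [DecidableEq t] [Fintype u] [DecidableEq u] (X : Op (a ⊕ t))
    (Y : Op (b ⊕ u)) (z : Bits t) (z' : Bits u) :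
    outcome (Sum.elim z z') (relabel (Equiv.sumSumSumComm a t b u) (tensor X Y)) =
      tensor (outcome z X) (outcome z' Y) := by
  funext f g
  rw [outcome_apply, relabel_apply, tensor_apply, tensor_apply, outcome_apply, outcome_apply]
  have h1 : ∀ f : Bits (a ⊕ b), (Sum.elim f (Sum.elim z z') ∘ Equiv.sumSumSumComm a t b u) ∘
      Sum.inl = Sum.elim (f ∘ Sum.inl) z := fun f => by ext (_ | _) <;> rfl
  have h2 : ∀ f : Bits (a ⊕ b), (Sum.elim f (Sum.elim z z') ∘ Equiv.sumSumSumComm a t b u) ∘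
      Sum.inr = Sum.elim (f ∘ Sum.inr) z' := fun f => by ext (_ | _) <;> rfl
  rw [h1, h1, h2, h2]

theorem ptr_eq_sum_outcome {ο Z : Type} [Fintype ο] [DecidableEq ο] [Fintype Z] [DecidableEq Z]
    (M : Op (ο ⊕ Z)) : ptr M = ∑ z, outcome z M := by
  funext f g
  rw [ptr_apply, Matrix.sum_apply]
  rfl

theorem sum_switchState_left {a b : ℕ} {κ : Type*} (s : Finset κ) (f : Bool) (ρ : κ → Op (Fin a))
    (τ : Op (Fin b)) : ∑ x ∈ s, switchState f (ρ x) τ = switchState f (∑ x ∈ s, ρ x) τ := by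
  funext u v
  simp only [Matrix.sum_apply, switchState, relabel_apply, tensor_apply, Finset.sum_mul]

theorem sum_switchState_right {a b : ℕ} {κ : Type*} (s : Finset κ) (f : Bool) (ρ : Op (Fin a))
    (τ : κ → Op (Fin b)) : ∑ x ∈ s, switchState f ρ (τ x) = switchState f ρ (∑ x ∈ s, τ x) := by
  funext u v
  simp only [Matrix.sum_apply, switchState, relabel_apply, tensor_apply, Finset.sum_mul,
    Finset.mul_sum]

/-- A step of two servers, of which the active one gives the answer. -/
theorem exists_switchStep {a a' b b' s t : ℕ} (Q₁ : QOp (Fin a ⊕ Fin s) (Fin a' ⊕ Fin t))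
    (Q₂ : QOp (Fin b ⊕ Fin s) (Fin b' ⊕ Fin t)) :
    ∃ Q : QOp (Fin (1 + (a + b)) ⊕ Fin s) (Fin (1 + (a' + b')) ⊕ Fin t),
      Q.size ≤ Q₁.size + Q₂.size + 100 * (1 + s + t) ∧
      ∀ f ρ τ y z, outcome z (Q.apply (tensor (switchState f ρ τ) (basisState y))) =
        if f then switchState f (ptr (Q₁.apply (tensor ρ (basisState y))))
          (outcome z (Q₂.apply (tensor τ (basisState y))))
        else switchState f (outcome z (Q₁.apply (tensor ρ (basisState y))))
          (ptr (Q₂.apply (tensor τ (basisState y)))) := by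
  obtain ⟨Ψ, hΨ, hΨ'⟩ := ((EffC.of_right Q₁.eff).precomp
    (HasCircuit.select (Sum.inl : Fin s → Fin s ⊕ Unit))).par ((EffC.of_right Q₂.eff).precomp
      (HasCircuit.select (Sum.inl : Fin s → Fin s ⊕ Unit)))
  have e1 := (EffC.of_eff (γ := Fin s ⊕ Unit) (Eff.id.then_relabel
    (Equiv.sumSumSumComm (Fin a') (Fin t) (Fin b') (Fin t)))).comp hΨ
  have e2 := (EffC.append (ι := Fin (1 + (a' + b'))) (HasCircuit.mux
    (Sum.inl (Sum.inr ()) : (Fin s ⊕ Unit) ⊕ (Fin t ⊕ Fin t)) (fun j => Sum.inr (Sum.inl j))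
    (fun j => Sum.inr (Sum.inr j)))).comp ((EffC.of_eff
    (Eff.id.then_relabel (flagEquiv a' b'))).comp (EffC.append
    (ι := Fin a' ⊕ Fin b') (HasCircuit.select (fun _ => Sum.inl (Sum.inr ()) :
      Unit → (Fin s ⊕ Unit) ⊕ (Fin t ⊕ Fin t)))))
  obtain ⟨Q, hQ, hQ'⟩ := (e1.bind e2).readFlag
  refine ⟨Q, hQ.trans ?_, fun f ρ τ y z => ?_⟩
  · simp only [Fintype.card_sum, Fintype.card_fin, Fintype.card_unit]
    omega
  · rw [hQ']
    rw [hΨ', outcome_sum, sum_bits_sum]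
    have h : ∀ c d : Bits (Fin t), outcome z (tensor (relabel (flagEquiv a' b') (tensor
        (outcome (Sum.elim c d) (relabel (Equiv.sumSumSumComm (Fin a') (Fin t) (Fin b') (Fin t))
          (tensor (Q₁.apply (tensor ρ (basisState ((Sum.elim y fun _ : Unit => f) ∘ Sum.inl))))
            (Q₂.apply (tensor τ (basisState ((Sum.elim y fun _ : Unit => f) ∘ Sum.inl)))))))
        (basisState (Sum.elim (Sum.elim y fun _ : Unit => f) (Sum.elim c d) ∘
          fun _ : Unit => Sum.inl (Sum.inr ())))))
        (basisState (mux f c d))) = if z = mux f c d then switchState f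
          (outcome c (Q₁.apply (tensor ρ (basisState y))))
          (outcome d (Q₂.apply (tensor τ (basisState y)))) else 0 := by
      intro c d
      rw [outcome_tensor_basisState, outcome_relabel_tensor, Sum.elim_comp_inl]
      rfl
    refine (Finset.sum_congr rfl fun c _ => Finset.sum_congr rfl fun d _ => h c d).trans ?_
    cases f
    · simp only [mux, Bool.false_eq_true, if_false]
      rw [Finset.sum_comm, ptr_eq_sum_outcome, ← sum_switchState_right]
      refine Finset.sum_congr rfl fun d _ => ?_
      rw [Finset.sum_ite_eq]
      simp
    · simp only [mux, if_true]
      rw [ptr_eq_sum_outcome, ← sum_switchState_left]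
      refine Finset.sum_congr rfl fun c _ => ?_
      rw [Finset.sum_ite_eq]
      simp

variable {σ : Shape} {pub : Type} [Fintype pub] [DecidableEq pub]

theorem exists_switchLoad {a a' b b' : ℕ} (Q₁ : QOp (Fin a ⊕ pub) (Fin a'))
    (Q₂ : QOp (Fin b ⊕ pub) (Fin b')) :
    ∃ Q : QOp (Fin (1 + (a + b)) ⊕ pub) (Fin (1 + (a' + b'))),
      Q.size ≤ Q₁.size + Q₂.size + 100 * (1 + Fintype.card pub) ∧
      ∀ f ρ τ p, Q.apply (tensor (switchState f ρ τ) (basisState p)) =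
        switchState f (Q₁.apply (tensor ρ (basisState p)))
          (Q₂.apply (tensor τ (basisState p))) := by
  obtain ⟨Ψ, hΨ, hΨ'⟩ := ((EffC.of_right Q₁.eff).precomp
    (HasCircuit.select (Sum.inl : pub → pub ⊕ Unit))).par ((EffC.of_right Q₂.eff).precomp
      (HasCircuit.select (Sum.inl : pub → pub ⊕ Unit)))
  have e := (EffC.of_eff (γ := pub ⊕ Unit) (Eff.id.then_relabel (flagEquiv a' b'))).comp
    ((EffC.append (ι := Fin a' ⊕ Fin b') (HasCircuit.select (Sum.inr : Unit → pub ⊕ Unit))).comp hΨ)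
  obtain ⟨Q, hQ, hQ'⟩ := e.readFlag
  refine ⟨Q, hQ.trans ?_, fun f ρ τ p => ?_⟩
  · simp only [Fintype.card_sum, Fintype.card_unit]
    omega
  · rw [hQ', hΨ', Sum.elim_comp_inl]
    rfl

/-- The server that plays as `A` if the flag is not set, and as `B` if it is.  Both strategies are
run side by side, and the flag decides whose messages are sent. -/
noncomputable def switch (A B : Adversary σ pub) : Adversary σ pub where
  reg := 1 + (A.reg + B.reg)
  mem i := 1 + (A.mem i + B.mem i)
  load := (exists_switchLoad A.load B.load).choose
  step i := (exists_switchStep (A.step i) (B.step i)).choose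

theorem switch_size_le (A B : Adversary σ pub) {L : ℕ}
    (hL : ∀ i < σ.rounds, σ.sendLen i ≤ L ∧ σ.recvLen i ≤ L) :
    (switch A B).size ≤
      A.size + B.size + 100 * (2 + Fintype.card pub + σ.rounds * (1 + L + L)) := by
  have h1 : (switch A B).load.size ≤ _ := (exists_switchLoad A.load B.load).choose_spec.1
  have h2 : ∀ i, ((switch A B).step i).size ≤ _ := fun i =>
    (exists_switchStep (A.step i) (B.step i)).choose_spec.1
  have h3 : ∑ i ∈ Finset.range σ.rounds, ((switch A B).step i).size ≤
      ∑ i ∈ Finset.range σ.rounds, ((A.step i).size + (B.step i).size + 100 * (1 + L + L)) := by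
    refine Finset.sum_le_sum fun i hi => (h2 i).trans ?_
    have := hL i (Finset.mem_range.1 hi)
    omega
  rw [Finset.sum_add_distrib, Finset.sum_add_distrib, Finset.sum_const, Finset.card_range,
    smul_eq_mul] at h3
  have h4 : (switch A B).reg ≤ 1 + (A.reg + B.reg) := le_rfl
  have h5 : σ.rounds * (100 * (1 + L + L)) = 100 * (σ.rounds * (1 + L + L)) := by ring
  rw [Adversary.size, Adversary.size, Adversary.size]
  omega

/-- The idle server `B` is normalized and is traced out at the end. -/
theorem acceptFrom_switch_false (C : Client σ) (A B : Adversary σ pub)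
    (r : Bits (Fin σ.clientCoins)) (k i : ℕ) (hist : List (List Bool)) (ρ : Op (Fin (A.mem i)))
    (τ : Op (Fin (B.mem i))) (hτ : τ.trace = 1) :
    acceptFrom C (switch A B) r k i hist (switchState false ρ τ) = acceptFrom C A r k i hist ρ := by
  induction k generalizing i hist with
  | zero =>
    have : (switchState false ρ τ).trace.re = ρ.trace.re := by
      rw [switchState, trace_relabel, trace_tensor, trace_tensor, (isDensity_basisState _).2, hτ,
        mul_one, mul_one]
    rw [acceptFrom]
    exact if_congr Iff.rfl this rfl
  | succ k ih =>
    refine Finset.sum_congr rfl fun z _ => ?_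
    have h := (exists_switchStep (A.step i) (B.step i)).choose_spec.2 false ρ τ
      (toBits _ (C.send r hist)) z
    refine (congrArg (acceptFrom C (switch A B) r k (i + 1) (hist ++ [List.ofFn z])) h).trans ?_
    refine ih _ _ _ _ ?_
    rw [trace_ptr, (eff_step_message B i _).trace, hτ]

theorem acceptFrom_switch_true (C : Client σ) (A B : Adversary σ pub)
    (r : Bits (Fin σ.clientCoins)) (k i : ℕ) (hist : List (List Bool)) (ρ : Op (Fin (A.mem i)))
    (τ : Op (Fin (B.mem i))) (hρ : ρ.trace = 1) :
    acceptFrom C (switch A B) r k i hist (switchState true ρ τ) = acceptFrom C B r k i hist τ := by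
  induction k generalizing i hist with
  | zero =>
    have : (switchState true ρ τ).trace.re = τ.trace.re := by
      rw [switchState, trace_relabel, trace_tensor, trace_tensor, (isDensity_basisState _).2, hρ,
        mul_one, one_mul]
    rw [acceptFrom]
    exact if_congr Iff.rfl this rfl
  | succ k ih =>
    refine Finset.sum_congr rfl fun z _ => ?_
    have h := (exists_switchStep (A.step i) (B.step i)).choose_spec.2 true ρ τ
      (toBits _ (C.send r hist)) z
    refine (congrArg (acceptFrom C (switch A B) r k (i + 1) (hist ++ [List.ofFn z])) h).trans ?_
    refine ih _ _ _ _ ?_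
    rw [trace_ptr, (eff_step_message A i _).trace, hρ]

theorem acceptProb_switch (C : Client σ) (A B : Adversary σ pub) (p : Bits pub)
    {ρ : Op (Fin A.reg)} {τ : Op (Fin B.reg)} (hρ : ρ.trace = 1) (hτ : τ.trace = 1) :
    acceptProb C (switch A B) p (switchState false ρ τ) = acceptProb C A p ρ ∧
      acceptProb C (switch A B) p (switchState true ρ τ) = acceptProb C B p τ := by
  have h := (exists_switchLoad A.load B.load).choose_spec.2
  constructor
  · refine congrArg average (funext fun r => ?_)
    refine (congrArg (acceptFrom C (switch A B) r _ _ _) (h false ρ τ p)).trans ?_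
    exact acceptFrom_switch_false C A B r _ _ _ _ _ (by rw [(eff_load B p).trace, hτ])
  · refine congrArg average (funext fun r => ?_)
    refine (congrArg (acceptFrom C (switch A B) r _ _ _) (h true ρ τ p)).trans ?_
    exact acceptFrom_switch_true C A B r _ _ _ _ _ (by rw [(eff_load A p).trace, hρ])

end Switch

/-! ### A classical server as a quantum server -/

section Classical

variable {ι ο : Type} [Fintype ι] [DecidableEq ι] [Fintype ο] [DecidableEq ο]

/-- Evaluation of a classical function, which discards its input. -/
def classical (f : Bits ι → Bits ο) (ρ : Op ι) : Op ο :=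
  ptr (relabel (Equiv.sumComm ι ο) (compute f ρ))

theorem Eff.classical {f : Bits ι → Bits ο} {N : ℕ} (hf : HasCircuit f N) :
    Eff (classical f) (9 * N + 2 * Fintype.card ο) :=
  (((Eff.compute hf).then_relabel (Equiv.sumComm ι ο)).then_ptr).congr fun _ => rfl

theorem classical_basisState (f : Bits ι → Bits ο) (a : Bits ι) :
    classical f (basisState a) = basisState (f a) := by
  funext x y
  rw [classical, ptr_apply, Finset.sum_eq_single a]
  · rw [relabel_apply, compute_apply, basisState_apply, basisState_apply]
    have h1 : ∀ x : Bits ο, (Sum.elim x a ∘ Equiv.sumComm ι ο) ∘ Sum.inl = a := fun _ => rfl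
    have h2 : ∀ x : Bits ο, (Sum.elim x a ∘ Equiv.sumComm ι ο) ∘ Sum.inr = x := fun _ => rfl
    rw [h1, h1, h2, h2]
    simp
  · intro z _ hz
    rw [relabel_apply, compute_apply, basisState_apply]
    have h1 : ∀ x : Bits ο, (Sum.elim x z ∘ Equiv.sumComm ι ο) ∘ Sum.inl = z := fun _ => rfl
    rw [h1]
    simp [hz]
  · simp

theorem relabel_basisState (e : ι ≃ ο) (a : Bits ι) :
    relabel e (basisState a) = basisState (a ∘ e.symm) := by
  funext x y
  rw [relabel_apply, basisState_apply, basisState_apply]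
  have h : ∀ x : Bits ο, x ∘ e = a ↔ x = a ∘ e.symm := fun x =>
    ⟨fun h => by rw [← h]; funext i; simp, fun h => by rw [h]; funext i; simp⟩
  exact if_congr (and_congr (h x) (h y)) rfl rfl

theorem tensor_basisState (a : Bits ι) (b : Bits ο) :
    tensor (basisState a) (basisState b) = basisState (Sum.elim a b) := by
  funext x y
  rw [tensor_apply, basisState_apply, basisState_apply, basisState_apply]
  have h : ∀ x : Bits (ι ⊕ ο), x = Sum.elim a b ↔ x ∘ Sum.inl = a ∧ x ∘ Sum.inr = b := fun x =>
    ⟨fun h => by rw [h]; exact ⟨rfl, rfl⟩, fun h => by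
      rw [← h.1, ← h.2]; exact (Sum.elim_comp_inl_inr x).symm⟩
  simp only [h]
  by_cases h1 : x ∘ Sum.inl = a <;> by_cases h2 : y ∘ Sum.inl = a <;>
    by_cases h3 : x ∘ Sum.inr = b <;> by_cases h4 : y ∘ Sum.inr = b <;> simp [h1, h2, h3, h4]

theorem outcome_basisState (a : Bits (ι ⊕ ο)) (b : Bits ο) :
    outcome b (basisState a) = if b = a ∘ Sum.inr then basisState (a ∘ Sum.inl) else 0 := by
  rw [← outcome_tensor_basisState, tensor_basisState, Sum.elim_comp_inl_inr]

variable {σ : Shape} {pub β : Type} [Fintype pub] [DecidableEq pub] [Fintype β] [DecidableEq β]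

theorem acceptFrom_zero (C : Client σ) (A : Adversary σ pub) (r : Bits (Fin σ.clientCoins))
    (k i : ℕ) (hist : List (List Bool)) : acceptFrom C A r k i hist 0 = 0 := by
  have := acceptFrom_smul C A r k i hist 0 0
  rwa [zero_mul, Complex.ofReal_zero, zero_smul] at this

/-- The memory of a classical server: its private input, the public input, and the messages. -/
noncomputable def memoryEquiv (σ : Shape) (pub β : Type) [Fintype pub] [Fintype β] (i : ℕ) :
    (β ⊕ pub) ⊕ Transcript σ.sendLen i ≃
      Fin (Fintype.card ((β ⊕ pub) ⊕ Transcript σ.sendLen i)) :=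
  Fintype.equivFin _

/-- The content of the memory of a classical server together with the next message, as its
inputs and the messages. -/
noncomputable def receive (σ : Shape) (pub β : Type) [Fintype pub] [Fintype β] (i : ℕ) :
    (β ⊕ pub) ⊕ Transcript σ.sendLen (i + 1) →
      Fin (Fintype.card ((β ⊕ pub) ⊕ Transcript σ.sendLen i)) ⊕ Fin (σ.sendLen i) :=
  Sum.map (memoryEquiv σ pub β i) id ∘ splitTranscript (β ⊕ pub) σ.sendLen i

/-- The step of a classical server, whose answer is `f` of its inputs and the messages. -/
noncomputable def classicalStep (σ : Shape) (pub β : Type) [Fintype pub] [Fintype β] (i : ℕ)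
    (f : Bits ((β ⊕ pub) ⊕ Transcript σ.sendLen (i + 1)) → Bits (Fin (σ.recvLen i)))
    (a : Bits (Fin (Fintype.card ((β ⊕ pub) ⊕ Transcript σ.sendLen i)) ⊕ Fin (σ.sendLen i))) :
    Bits (Fin (Fintype.card ((β ⊕ pub) ⊕ Transcript σ.sendLen (i + 1))) ⊕ Fin (σ.recvLen i)) :=
  Sum.elim (a ∘ (receive σ pub β i ∘ (memoryEquiv σ pub β (i + 1)).symm))
    (f (a ∘ receive σ pub β i))

theorem outcome_classicalStep (i : ℕ)
    (f : Bits ((β ⊕ pub) ⊕ Transcript σ.sendLen (i + 1)) → Bits (Fin (σ.recvLen i)))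
    (a : Bits (β ⊕ pub)) (b : Bits (Transcript σ.sendLen i)) (y : Bits (Fin (σ.sendLen i)))
    (z : Bits (Fin (σ.recvLen i))) :
    outcome z (classical (classicalStep σ pub β i f) (tensor
      (basisState (Sum.elim a b ∘ (memoryEquiv σ pub β i).symm)) (basisState y))) =
      if z = f (Sum.elim (Sum.elim a b) y ∘ splitTranscript (β ⊕ pub) σ.sendLen i) then
        basisState ((Sum.elim (Sum.elim a b) y ∘ splitTranscript (β ⊕ pub) σ.sendLen i) ∘
          (memoryEquiv σ pub β (i + 1)).symm) else 0 := by
  have hrec : Sum.elim (Sum.elim a b ∘ (memoryEquiv σ pub β i).symm) y ∘ receive σ pub β i =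
      Sum.elim (Sum.elim a b) y ∘ splitTranscript (β ⊕ pub) σ.sendLen i := by
    rw [receive, ← Function.comp_assoc]
    congr 1
    funext j
    rcases j with j | j <;> simp
  rw [tensor_basisState, classical_basisState, classicalStep, ← Function.comp_assoc, hrec,
    outcome_basisState, Sum.elim_comp_inr, Sum.elim_comp_inl]

/-- The initial memory of a classical server holds its input, the public input and no messages. -/
theorem exists_classicalLoad (σ : Shape) (pub β : Type) [Fintype pub] [DecidableEq pub] [Fintype β]
    [DecidableEq β] :
    ∃ Q : QOp (Fin (Fintype.card β) ⊕ pub)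
        (Fin (Fintype.card ((β ⊕ pub) ⊕ Transcript σ.sendLen 0))),
      Q.size ≤ 0 ∧ ∀ (u : Bits β) (p : Bits pub),
        Q.apply (tensor (basisState (u ∘ (Fintype.equivFin β).symm)) (basisState p)) =
          basisState
            (Sum.elim (Sum.elim u p) (fun q => q.1.elim0) ∘ (memoryEquiv σ pub β 0).symm) := by
  have : IsEmpty (Transcript σ.sendLen 0) := ⟨fun q => q.1.elim0⟩
  let e : Fin (Fintype.card β) ⊕ pub ≃ Fin (Fintype.card ((β ⊕ pub) ⊕ Transcript σ.sendLen 0)) :=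
    ((Equiv.sumCongr (Fintype.equivFin β).symm (Equiv.refl pub)).trans
      (Equiv.sumEmpty _ _).symm).trans (memoryEquiv σ pub β 0)
  obtain ⟨Q, hQ, hQ'⟩ := Eff.id.then_relabel e
  refine ⟨Q, hQ, fun u p => (hQ' _).trans ?_⟩
  beta_reduce
  rw [tensor_basisState, relabel_basisState]
  congr 1
  have h : Sum.elim (u ∘ (Fintype.equivFin β).symm) p =
      Sum.elim (Sum.elim u p) (fun q => q.1.elim0) ∘ (memoryEquiv σ pub β 0).symm ∘ e := by
    funext i
    rcases i with i | i <;> simp [e]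
  rw [h]
  funext i
  simp

/-- A classical server with efficiently computable answers is an efficient quantum server. -/
noncomputable def classicalAdversary (σ : Shape) (pub β : Type) [Fintype pub] [DecidableEq pub]
    [Fintype β] [DecidableEq β] {N : ℕ}
    {f : ∀ i, Bits ((β ⊕ pub) ⊕ Transcript σ.sendLen (i + 1)) → Bits (Fin (σ.recvLen i))}
    (hf : ∀ i < σ.rounds, HasCircuit (f i) N) : Adversary σ pub where
  reg := Fintype.card β
  mem i := Fintype.card ((β ⊕ pub) ⊕ Transcript σ.sendLen i)
  load := (exists_classicalLoad σ pub β).choose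
  step i := if h : i < σ.rounds then
      (Eff.classical (f := classicalStep σ pub β i (f i))
        ((HasCircuit.select _).pair ((hf i h).precomp _))).choose
    else Classical.choice (nonempty_qop _ _)

variable {N : ℕ} {f : ∀ i, Bits ((β ⊕ pub) ⊕ Transcript σ.sendLen (i + 1)) →
  Bits (Fin (σ.recvLen i))}

theorem classicalAdversary_step (hf : ∀ i < σ.rounds, HasCircuit (f i) N) {i : ℕ}
    (hi : i < σ.rounds) :
    ((classicalAdversary σ pub β hf).step i).size ≤ 9 * (0 + N) + 2 * Fintype.card
        (Fin (Fintype.card ((β ⊕ pub) ⊕ Transcript σ.sendLen (i + 1))) ⊕ Fin (σ.recvLen i)) ∧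
      ∀ ρ, ((classicalAdversary σ pub β hf).step i).apply ρ =
        classical (classicalStep σ pub β i (f i)) ρ := by
  have h := (Eff.classical (f := classicalStep σ pub β i (f i))
        ((HasCircuit.select _).pair ((hf i hi).precomp _))).choose_spec
  have e : (classicalAdversary σ pub β hf).step i = _ := dif_pos hi
  rw [e]
  exact h

theorem classicalAdversary_size_le (hf : ∀ i < σ.rounds, HasCircuit (f i) N) {L : ℕ}
    (hL : ∀ i < σ.rounds, σ.sendLen i ≤ L ∧ σ.recvLen i ≤ L) :
    (classicalAdversary σ pub β hf).size ≤ Fintype.card β + σ.rounds * (9 * N +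
      2 * (Fintype.card β + Fintype.card pub + σ.rounds * L + L)) := by
  have h1 : (classicalAdversary σ pub β hf).load.size ≤ 0 :=
    (exists_classicalLoad σ pub β).choose_spec.1
  have h3 : ∑ i ∈ Finset.range σ.rounds, ((classicalAdversary σ pub β hf).step i).size ≤
      ∑ _i ∈ Finset.range σ.rounds, (9 * N +
        2 * (Fintype.card β + Fintype.card pub + σ.rounds * L + L)) := by
    refine Finset.sum_le_sum fun i hi => ?_
    have hi := Finset.mem_range.1 hi
    refine (classicalAdversary_step hf hi).1.trans ?_
    have hT : Fintype.card (Transcript σ.sendLen (i + 1)) ≤ σ.rounds * L := by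
      rw [Fintype.card_sigma]
      simp only [Fintype.card_fin]
      refine (Finset.sum_le_card_nsmul _ _ L fun (j : Fin (i + 1)) _ =>
        (hL j (by omega)).1).trans ?_
      simp only [Finset.card_univ, Fintype.card_fin, smul_eq_mul]
      exact Nat.mul_le_mul_right L hi
    have := (hL i hi).2
    simp only [Fintype.card_sum, Fintype.card_fin]
    omega
  rw [Finset.sum_const, Finset.card_range, smul_eq_mul] at h3
  have h4 : (classicalAdversary σ pub β hf).reg ≤ Fintype.card β := le_rfl
  rw [Adversary.size]
  omega

theorem acceptFrom_classicalAdversary (hf : ∀ i < σ.rounds, HasCircuit (f i) N) (C : Client σ)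
    (S : Server σ) (r : Bits (Fin σ.clientCoins)) (t : Bits (Fin σ.serverCoins))
    (a : Bits (β ⊕ pub)) (ha : ∀ i < σ.rounds, ∀ b : Bits (Transcript σ.sendLen (i + 1)),
      f i (Sum.elim a b) = toBits (σ.recvLen i) (S.reply t (messages b)))
    (k i : ℕ) (hi : i + k = σ.rounds) (b : Bits (Transcript σ.sendLen i))
    (hb : messages b = (classicalRun C S r t i).2) :
    acceptFrom C (classicalAdversary σ pub β hf) r k i (classicalRun C S r t i).1
      (basisState (Sum.elim a b ∘ (memoryEquiv σ pub β i).symm)) =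
      if C.accept r (classicalRun C S r t σ.rounds).1 then 1 else 0 := by
  induction k generalizing i with
  | zero =>
    obtain rfl : i = σ.rounds := hi
    rw [acceptFrom, (isDensity_basisState _).2, Complex.one_re]
  | succ k ih =>
    have hi' : i < σ.rounds := by omega
    set y := toBits (σ.sendLen i) (C.send r (classicalRun C S r t i).1) with hy
    set a' := Sum.elim (Sum.elim a b) y ∘ splitTranscript (β ⊕ pub) σ.sendLen i with ha'
    have hinl : a' ∘ Sum.inl = a := rfl
    have hinr : messages (a' ∘ Sum.inr) = (classicalRun C S r t (i + 1)).2 := by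
      rw [ha', messages_splitTranscript, Sum.elim_comp_inr, hb]
      rfl
    have hfa : f i a' = toBits (σ.recvLen i) (S.reply t (classicalRun C S r t (i + 1)).2) := by
      rw [← hinr, ← ha i hi', ← hinl, Sum.elim_comp_inl_inr]
    have hterm : ∀ z : Bits (Fin (σ.recvLen i)),
        acceptFrom C (classicalAdversary σ pub β hf) r k (i + 1)
          ((classicalRun C S r t i).1 ++ [List.ofFn z])
          (outcome z (((classicalAdversary σ pub β hf).step i).apply
            (tensor (basisState (Sum.elim a b ∘ (memoryEquiv σ pub β i).symm)) (basisState y)))) =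
        if z = f i a' then (if C.accept r (classicalRun C S r t σ.rounds).1 then 1 else 0)
        else 0 := by
      intro z
      refine (congrArg (fun M => acceptFrom C (classicalAdversary σ pub β hf) r k (i + 1) _
        (outcome z M)) ((classicalAdversary_step hf hi').2 _)).trans ?_
      refine (congrArg (acceptFrom C (classicalAdversary σ pub β hf) r k (i + 1) _)
        (outcome_classicalStep i (f i) a b y z)).trans ?_
      by_cases hz : z = f i a'
      · rw [if_pos hz, if_pos hz]
        have := ih (i + 1) (by omega) (a' ∘ Sum.inr) hinr
        rw [← hinl, Sum.elim_comp_inl_inr] at this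
        rw [hz, hfa]
        exact this
      · rw [if_neg hz, if_neg hz]
        exact acceptFrom_zero _ _ _ _ _ _
    refine (Finset.sum_congr rfl fun z _ => hterm z).trans ?_
    rw [Finset.sum_ite_eq']
    simp

/-- The quantum server that runs a classical server is accepted like the classical server. -/
theorem exists_density_classicalAdversary (hf : ∀ i < σ.rounds, HasCircuit (f i) N) (u : Bits β) :
    ∃ τ, IsDensity τ ∧ ∀ (C : Client σ) (S : Server σ) (t : Bits (Fin σ.serverCoins))
      (p : Bits pub), (∀ i < σ.rounds, ∀ b : Bits (Transcript σ.sendLen (i + 1)),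
        f i (Sum.elim (Sum.elim u p) b) = toBits (σ.recvLen i) (S.reply t (messages b))) →
      acceptProb C (classicalAdversary σ pub β hf) p τ =
        average fun r => if C.accept r (classicalRun C S r t σ.rounds).1 then 1 else 0 := by
  refine ⟨basisState (u ∘ (Fintype.equivFin β).symm), isDensity_basisState _, fun C S t p h => ?_⟩
  refine congrArg average (funext fun r => ?_)
  refine (congrArg (acceptFrom C (classicalAdversary σ pub β hf) r σ.rounds 0 [])
    ((exists_classicalLoad σ pub β).choose_spec.2 u p)).trans ?_
  exact acceptFrom_classicalAdversary hf C S r t _ h σ.rounds 0 (zero_add _) _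
    (by simp [messages]; rfl)

end Classical

/-! ### Extractors whose error is linear in the failure probability -/

section LinearExtractor

theorem average_comm {ι ι' : Type} [Fintype ι] [DecidableEq ι] [Fintype ι'] [DecidableEq ι']
    (p : Bits ι → Bits ι' → ℝ) :
    (average fun r => average fun t => p r t) = average fun t => average fun r => p r t := by
  simp only [average]
  rw [← Finset.sum_div, ← Finset.sum_div, Finset.sum_comm, div_right_comm]

theorem exists_average_le {ι : Type} [Fintype ι] [DecidableEq ι] (p : Bits ι → ℝ) :
    ∃ t, average p ≤ p t := by
  by_contra! h
  have h1 : ∑ t, p t < ∑ _t : Bits ι, average p :=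
    Finset.sum_lt_sum_of_nonempty Finset.univ_nonempty fun t _ => h t
  have h2 : (∑ _t : Bits ι, average p) = 2 ^ Fintype.card ι * average p := by
    simp
  rw [h2, average, mul_div_cancel₀ _ (by positivity)] at h1
  exact lt_irrefl _ h1

variable {P : Protocol .publicInput}

/-- The answers of the honest server, as functions of the witness, its coins, the public input and
the messages. -/
def honestReply (P : Protocol .publicInput) (κ : ℕ) {n m s : ℕ} (R : Relation n m s) (i : ℕ)
    (a : Bits (((Fin m ⊕ Fin (P.shape κ n m s).serverCoins) ⊕ PubIndex .publicInput n m s) ⊕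
      Transcript (P.shape κ n m s).sendLen (i + 1))) : Bits (Fin ((P.shape κ n m s).recvLen i)) :=
  toBits _ ((P.server κ R (fun j => a (.inl (.inr (.inr j))))
    fun j => a (.inl (.inl (.inl j)))).reply (fun j => a (.inl (.inl (.inr j))))
      (messages (a ∘ Sum.inr)))

/-- One polynomial bounds the number of rounds, the numbers of coins, the lengths of the messages
and the sizes of circuits for the messages of both parties, for all relations at once. -/
theorem Protocol.IsEfficient.exists_bound (hP : P.IsEfficient) {n m s : ℕ → ℕ}
    (hn : PolyBounded n) (hm : PolyBounded m) (hs : PolyBounded s) :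
    ∃ B : ℕ → ℕ, PolyBounded B ∧ ∀ κ,
      (P.shape κ (n κ) (m κ) (s κ)).rounds ≤ B κ ∧
      (P.shape κ (n κ) (m κ) (s κ)).clientCoins ≤ B κ ∧
      (P.shape κ (n κ) (m κ) (s κ)).serverCoins ≤ B κ ∧
      (∀ i < (P.shape κ (n κ) (m κ) (s κ)).rounds,
        (P.shape κ (n κ) (m κ) (s κ)).sendLen i ≤ B κ ∧
        (P.shape κ (n κ) (m κ) (s κ)).recvLen i ≤ B κ) ∧
      ∀ R : Relation (n κ) (m κ) (s κ),
        (∀ i < (P.shape κ (n κ) (m κ) (s κ)).rounds, HasCircuit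
          (fun a : Bits ((Fin (n κ) ⊕ Fin (P.shape κ (n κ) (m κ) (s κ)).clientCoins) ⊕
            Transcript (P.shape κ (n κ) (m κ) (s κ)).recvLen i) =>
            toBits ((P.shape κ (n κ) (m κ) (s κ)).sendLen i)
              ((P.client κ R (fun j => a (.inl (.inl j)))).send (fun j => a (.inl (.inr j)))
                (messages (a ∘ Sum.inr)))) (B κ)) ∧
        ∀ i < (P.shape κ (n κ) (m κ) (s κ)).rounds, HasCircuit (honestReply P κ R i) (B κ) := by
  obtain ⟨c, hc⟩ := hP
  refine ⟨fun κ => (κ + n κ + m κ + s κ + 2) ^ c,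
    ((((PolyBounded.id.add hn).add hm).add hs).add (PolyBounded.const 2)).pow c, fun κ => ?_⟩
  obtain ⟨h1, h2, h3, h4, h5⟩ := hc κ (n κ) (m κ) (s κ)
  refine ⟨h1, h2, h3, h4, fun R => ⟨fun i hi => ?_, fun i hi => ?_⟩⟩
  · obtain ⟨t, ht, C, hC⟩ := (h5 R).1 i hi
    have e := (C.hasCircuit.mono ht).precomp (ι' := (Fin (n κ) ⊕ Fin (P.shape κ (n κ) (m κ)
      (s κ)).clientCoins) ⊕ Transcript (P.shape κ (n κ) (m κ) (s κ)).recvLen i)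
      (Sum.elim (fun j => .inl (.inl j)) (Sum.elim (fun j => .inl (.inr j)) .inr))
    refine e.congr fun a => ?_
    rw [messages]
    refine (hC _ _ fun j p => a (.inr ⟨j, p⟩)).symm.trans (congrArg C.eval ?_)
    funext j
    rcases j with j | j | j <;> rfl
  · obtain ⟨t, ht, C, hC⟩ := (h5 R).2.2 i hi
    have e := (C.hasCircuit.mono ht).precomp (ι' := ((Fin (m κ) ⊕ Fin (P.shape κ (n κ) (m κ)
      (s κ)).serverCoins) ⊕ PubIndex .publicInput (n κ) (m κ) (s κ)) ⊕
        Transcript (P.shape κ (n κ) (m κ) (s κ)).sendLen (i + 1))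
      (Sum.elim (fun j => .inl (.inr (.inr j))) (Sum.elim (fun j => .inl (.inl (.inl j)))
        (Sum.elim (fun j => .inl (.inl (.inr j))) .inr)))
    refine e.congr fun a => ?_
    rw [honestReply, messages]
    refine (hC _ _ _ fun j p => a (.inr ⟨j, p⟩)).symm.trans (congrArg C.eval ?_)
    funext j
    rcases j with j | j | j | j <;> rfl

theorem eff_switchState {a b : ℕ} (f : Bool) {τ : Op (Fin b)} (hτ : IsDensity τ) :
    Eff (fun ρ : Op (Fin a) => switchState f ρ τ) (b + 1) :=
  (((Eff.id.then_tensor hτ).then_tensor (isDensity_basisState fun _ : Unit => f)).then_relabel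
    (flagEquiv a b)).mono (by simp)

/-- The numerical core of the reduction: a mixture of an accepted and a given state, with weights
chosen such that the mixture is accepted with probability at least `1 - δ`. -/
theorem fail_le_of_mixture {C δ f p q μ : ℝ} (hδ : 0 < δ) (hf : 0 ≤ f) (hf1 : f ≤ 1)
    (hq : q ≤ 1) (h : 1 - C * δ - μ ≤
      (1 - δ / (2 * (f + δ))) * q + δ / (2 * (f + δ)) * p) :
    1 - p ≤ 2 * C * (δ + f) + 2 * (1 + δ) / δ * |μ| := by
  have hfd : 0 < f + δ := by linarith
  set l := δ / (2 * (f + δ)) with hl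
  have hl0 : 0 < l := by positivity
  have hl1 : l ≤ 1 := by
    rw [hl, div_le_one (by positivity)]
    linarith
  have h1 : l * (1 - p) ≤ C * δ + |μ| := by
    have := mul_le_mul_of_nonneg_left hq (sub_nonneg.2 hl1)
    have := le_abs_self μ
    linarith
  have h2 : 1 - p ≤ (C * δ + |μ|) / l := by
    rw [le_div_iff₀ hl0]
    linarith
  have h3 : (C * δ + |μ|) / l = 2 * C * (δ + f) + 2 * (f + δ) / δ * |μ| := by
    rw [hl]
    field_simp
    ring
  rw [h3] at h2
  refine h2.trans ?_
  have : 2 * (f + δ) / δ ≤ 2 * (1 + δ) / δ := by gcongr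
  have := mul_le_mul_of_nonneg_right this (abs_nonneg μ)
  linarith

/-- One extractor serves all initial states: its error is linear in `δ` and the probability that
the client rejects.  The extractor is the one that soundness at `δ` gives for the server that, as a
flag tells, plays `A` or plays honestly. -/
theorem exists_extractor_of_isDensity (hEff : P.IsEfficient) (hCompl : P.IsComplete) {C : ℝ}
    (hC : 0 < C) (hSound : ∀ δ, 0 < δ → P.IsSound δ (C * δ)) {δ : ℝ} (hδ : 0 < δ)
    {n m s : ℕ → ℕ} (hn : PolyBounded n) (hm : PolyBounded m) (hs : PolyBounded s)
    (R : ∀ κ, Relation (n κ) (m κ) (s κ))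
    (A : ∀ κ, Adversary (P.shape κ (n κ) (m κ) (s κ)) (PubIndex .publicInput (n κ) (m κ) (s κ)))
    (hA : PolyBounded fun κ => (A κ).size) :
    ∃ Ext : ∀ κ, QOp (Fin (A κ).reg ⊕ PubIndex .publicInput (n κ) (m κ) (s κ)) (Fin (m κ)),
      PolyBounded (fun κ => (Ext κ).size) ∧
      ∀ (x : ∀ κ, Bits (Fin (n κ))) (ρ : ∀ κ, Op (Fin (A κ).reg)), (∀ κ, IsDensity (ρ κ)) →
      ∃ μ, Negligible μ ∧ ∀ κ,
        1 - prob ((Ext κ).apply (tensor (ρ κ) (basisState (pubInput .publicInput (R κ) (x κ)))))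
          (fun w => (R κ).Holds (x κ) w) -
        2 * C * (δ + (1 - acceptProb (P.client κ (R κ) (x κ)) (A κ)
          (pubInput .publicInput (R κ) (x κ)) (ρ κ))) ≤ μ κ := by
  obtain ⟨L, hL, hLb⟩ := hEff.exists_bound hn hm hs
  have hcirc := fun κ => ((hLb κ).2.2.2.2 (R κ)).2
  have hpub : PolyBounded fun κ => Fintype.card (PubIndex .publicInput (n κ) (m κ) (s κ)) :=
    ((polyBounded_card_descIndex hn hm hs).add hn).mono fun κ => by
      simp only [PubIndex, Fintype.card_sum, Fintype.card_fin]
      exact le_rfl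
  let B := fun κ => classicalAdversary (P.shape κ (n κ) (m κ) (s κ))
    (PubIndex .publicInput (n κ) (m κ) (s κ))
    (Fin (m κ) ⊕ Fin (P.shape κ (n κ) (m κ) (s κ)).serverCoins) (hcirc κ)
  have hB : PolyBounded fun κ => (B κ).size := by
    have hc := hm.add hL
    refine (hc.add (hL.mul (((PolyBounded.const 9).mul hL).add ((PolyBounded.const 2).mul
      (((hc.add hpub).add (hL.mul hL)).add hL))))).mono fun κ => ?_
    obtain ⟨h1, h2, h3, h4, -⟩ := hLb κ
    refine (classicalAdversary_size_le (hcirc κ) h4).trans ?_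
    simp only [Fintype.card_sum, Fintype.card_fin]
    gcongr
  have hBreg : ∀ κ, (B κ).reg ≤ (B κ).size := fun κ => by
    rw [Adversary.size]; omega
  have hAB : PolyBounded fun κ => (switch (A κ) (B κ)).size := by
    refine ((hA.add hB).add ((PolyBounded.const 100).mul (((PolyBounded.const 2).add hpub).add
      (hL.mul (((PolyBounded.const 1).add hL).add hL))))).mono fun κ => ?_
    obtain ⟨h1, h2, h3, h4, -⟩ := hLb κ
    refine (switch_size_le (A κ) (B κ) h4).trans ?_
    gcongr
  obtain ⟨Ext', hExt', hs'⟩ := hSound δ hδ n m s hn hm hs (fun κ => switch (A κ) (B κ)) hAB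
  obtain ⟨_, -, hs0⟩ := hSound (1 / (2 * C)) (by positivity) n m s hn hm hs A hA
  let τ₀ := fun κ => basisState fun _ : Fin (B κ).reg => false
  have hτ₀ : ∀ κ, IsDensity (τ₀ κ) := fun κ => isDensity_basisState _
  choose Ext hExts hExt using fun κ => ((EffC.of_right (Ext' κ).eff).comp
    (EffC.of_eff (eff_switchState (a := (A κ).reg) false (hτ₀ κ)))).exists_qop
  refine ⟨Ext, (((hB.add (PolyBounded.const 1)).add hExt').add ((PolyBounded.const 2).mul
    hpub)).mono fun κ => (hExts κ).trans ?_, fun x ρ hρ => ?_⟩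
  · have := hBreg κ
    omega
  -- a witness, if there is one
  have hw : ∀ κ, ∃ w, (∃ w', (R κ).Holds (x κ) w') → (R κ).Holds (x κ) w := by
    intro κ
    by_cases h : ∃ w', (R κ).Holds (x κ) w'
    · exact ⟨h.choose, fun _ => h.choose_spec⟩
    · exact ⟨fun _ => false, fun h' => absurd h' h⟩
  choose w hw using hw
  obtain ⟨μ₁, hμ₁, hc⟩ := hCompl n m s hn hm hs R x w
  -- coins of the honest server that are at least as good as the average
  have ht : ∀ κ, ∃ t, classicalAcceptProb (P.client κ (R κ) (x κ))
      (P.server κ (R κ) (Visibility.publicInput.view (x κ)) (w κ)) ≤ average fun r =>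
        if (P.client κ (R κ) (x κ)).accept r (classicalRun (P.client κ (R κ) (x κ))
          (P.server κ (R κ) (Visibility.publicInput.view (x κ)) (w κ)) r t
            (P.shape κ (n κ) (m κ) (s κ)).rounds).1 then 1 else 0 := by
    intro κ
    rw [classicalAcceptProb, average_comm]
    exact exists_average_le _
  choose t ht using ht
  have hτ := fun κ => exists_density_classicalAdversary (pub := PubIndex .publicInput (n κ) (m κ)
    (s κ)) (hcirc κ) (Sum.elim (w κ) (t κ))
  choose τ hτ hacc using hτ
  have hacc' : ∀ κ, acceptProb (P.client κ (R κ) (x κ)) (B κ)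
      (pubInput .publicInput (R κ) (x κ)) (τ κ) = _ := fun κ =>
    hacc κ (P.client κ (R κ) (x κ)) (P.server κ (R κ) (Visibility.publicInput.view (x κ)) (w κ))
      (t κ) (pubInput .publicInput (R κ) (x κ)) fun i hi b => rfl
  let f := fun κ => 1 - acceptProb (P.client κ (R κ) (x κ)) (A κ)
    (pubInput .publicInput (R κ) (x κ)) (ρ κ)
  have hf0 : ∀ κ, 0 ≤ f κ := fun κ => by
    have := acceptProb_le_trace (P.client κ (R κ) (x κ)) (A κ)
      (pubInput .publicInput (R κ) (x κ)) (hρ κ).1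
    rw [(hρ κ).2, Complex.one_re] at this
    exact sub_nonneg.2 this
  have hf1 : ∀ κ, f κ ≤ 1 := fun κ => by
    have := acceptProb_nonneg (P.client κ (R κ) (x κ)) (A κ)
      (pubInput .publicInput (R κ) (x κ)) (hρ κ).1
    exact sub_le_self _ this
  -- the largest weight of `A`, up to a constant, at which the client still accepts the mixture
  -- with probability at least `1 - δ`
  let l := fun κ => δ / (2 * (f κ + δ))
  have hl0 : ∀ κ, 0 ≤ l κ := fun κ => by have := hf0 κ; positivity
  have hl1 : ∀ κ, l κ ≤ 1 := fun κ => by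
    have := hf0 κ
    rw [div_le_one (by positivity)]
    linarith
  let mix := fun κ => ((1 - l κ : ℝ) : ℂ) • switchState true (ρ κ) (τ κ) +
    ((l κ : ℝ) : ℂ) • switchState false (ρ κ) (τ₀ κ)
  have hd1 := fun κ => isDensity_switchState true (hρ κ) (hτ κ)
  have hd0 := fun κ => isDensity_switchState false (hρ κ) (hτ₀ κ)
  have hmix : ∀ κ, IsDensity (mix κ) := by
    intro κ
    refine ⟨((hd1 κ).1.smul (Complex.zero_le_real.2 (sub_nonneg.2 (hl1 κ)))).add
      ((hd0 κ).1.smul (Complex.zero_le_real.2 (hl0 κ))), ?_⟩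
    rw [Matrix.trace_add, Matrix.trace_smul, Matrix.trace_smul, (hd1 κ).2, (hd0 κ).2]
    push_cast
    simp
  obtain ⟨μ₂, hμ₂, h2⟩ := hs' R x mix hmix
  obtain ⟨μ₃, hμ₃, h3⟩ := hs0 R x ρ hρ
  refine ⟨fun κ => 2 * (1 + δ) / δ * |μ₂ κ| + 2 / δ * |μ₁ κ| + 2 * |μ₃ κ|,
    ((hμ₂.abs.const_mul _).add (hμ₁.abs.const_mul _)).add (hμ₃.abs.const_mul _), fun κ => ?_⟩
  set X := prob ((Ext κ).apply (tensor (ρ κ) (basisState (pubInput .publicInput (R κ) (x κ)))))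
    (fun w => (R κ).Holds (x κ) w) with hX
  have hX0 : 0 ≤ X := prob_nonneg ((Ext κ).eff.posSemidef (tensor_posSemidef (hρ κ).1
    (isDensity_basisState _).1)) _
  change 1 - X - 2 * C * (δ + f κ) ≤ _
  have hCδ : 0 < 2 * C * δ := by positivity
  have hCf : 0 ≤ 2 * C * f κ := mul_nonneg (by positivity) (hf0 κ)
  have p1 : 0 ≤ 2 / δ * |μ₁ κ| := by positivity
  have p2 : 0 ≤ 2 * (1 + δ) / δ * |μ₂ κ| := by positivity
  by_cases hex : ∃ w', (R κ).Holds (x κ) w'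
  · -- for the other `κ`, the term `2 / δ * |μ₁ κ|` is at least `1`
    by_cases hsmall : |μ₁ κ| ≤ δ / 2
    · have hcκ := hc κ (hw κ hex)
      have hsw := acceptProb_switch (P.client κ (R κ) (x κ)) (A κ) (B κ)
        (pubInput .publicInput (R κ) (x κ)) (hρ κ).2 (hτ κ).2
      have hsw0 := acceptProb_switch (P.client κ (R κ) (x κ)) (A κ) (B κ)
        (pubInput .publicInput (R κ) (x κ)) (hρ κ).2 (hτ₀ κ).2
      have haccmix : acceptProb (P.client κ (R κ) (x κ)) (switch (A κ) (B κ))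
          (pubInput .publicInput (R κ) (x κ)) (mix κ) =
          (1 - l κ) * acceptProb (P.client κ (R κ) (x κ)) (B κ)
            (pubInput .publicInput (R κ) (x κ)) (τ κ) + l κ * (1 - f κ) := by
        refine (acceptProb_add _ _ _ _ _).trans ?_
        refine congrArg₂ (· + ·) ((acceptProb_smul _ _ _ _ _).trans (congrArg _ hsw.2))
          ((acceptProb_smul _ _ _ _ _).trans (congrArg _ (hsw0.1.trans ?_)))
        exact (sub_sub_cancel 1 _).symm
      have hBacc : 1 - δ / 2 ≤ acceptProb (P.client κ (R κ) (x κ)) (B κ)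
            (pubInput .publicInput (R κ) (x κ)) (τ κ) := by
        rw [hacc' κ]
        have := ht κ
        have := le_abs_self (μ₁ κ)
        linarith
      have hlf : l κ * f κ ≤ δ / 2 := by
        have hfd : 0 < f κ + δ := by have := hf0 κ; linarith
        have : l κ * f κ = δ / 2 * (f κ / (f κ + δ)) := by
          simp only [l]
          field_simp
        rw [this]
        have : f κ / (f κ + δ) ≤ 1 := by
          rw [div_le_one hfd]; linarith
        nlinarith
      have h2κ := h2 κ (by
        refine le_trans ?_ haccmix.ge
        have := mul_le_mul_of_nonneg_left hBacc (sub_nonneg.2 (hl1 κ))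
        have := mul_nonneg (hl0 κ) hδ.le
        linarith)
      set Y := prob ((Ext' κ).apply (tensor (switchState true (ρ κ) (τ κ))
        (basisState (pubInput .publicInput (R κ) (x κ))))) (fun w => (R κ).Holds (x κ) w) with hY
      have hlin : prob ((Ext' κ).apply (tensor (mix κ)
          (basisState (pubInput .publicInput (R κ) (x κ))))) (fun w => (R κ).Holds (x κ) w) =
          (1 - l κ) * Y + l κ * X := by
        have hE := (Ext' κ).eff.comp (Eff.id.then_tensor (ι := Fin (switch (A κ) (B κ)).reg)
          (isDensity_basisState (pubInput .publicInput (R κ) (x κ))))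
        refine (congrArg (fun M => prob M _) (hE.add _ _)).trans ?_
        rw [prob_add]
        refine congrArg₂ (· + ·) ?_ ?_
        · exact (congrArg (fun M => prob M _) (hE.smul _ _)).trans (prob_smul _ _ _)
        · refine ((congrArg (fun M => prob M _) (hE.smul _ _)).trans (prob_smul _ _ _)).trans ?_
          rw [hX, hExt]
      have hY1 : Y ≤ 1 := by
        have hE := (Ext' κ).eff.comp (Eff.id.then_tensor (ι := Fin (switch (A κ) (B κ)).reg)
          (isDensity_basisState (pubInput .publicInput (R κ) (x κ))))
        refine (prob_le_trace (hE.posSemidef (hd1 κ).1) _).trans_eq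
          ((congrArg Complex.re (hE.trace _)).trans ?_)
        exact (congrArg Complex.re (hd1 κ).2).trans Complex.one_re
      have := fail_le_of_mixture hδ (hf0 κ) (hf1 κ) hY1 (h2κ.trans_eq hlin)
      have := abs_nonneg (μ₃ κ)
      linarith
    · have : 1 ≤ 2 / δ * |μ₁ κ| := by
        rw [div_mul_eq_mul_div, le_div_iff₀ hδ]
        linarith
      have := abs_nonneg (μ₃ κ)
      linarith
  · -- soundness at `1 / (2 * C)` asserts extraction with probability at least `1 / 2`, up to a
    -- negligible error, which is absurd without a witness
    by_cases hle : f κ ≤ 1 / (2 * C)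
    · have h3κ := h3 κ (by
        have : f κ = 1 - acceptProb (P.client κ (R κ) (x κ)) (A κ)
          (pubInput .publicInput (R κ) (x κ)) (ρ κ) := rfl
        linarith)
      rw [Finset.sum_eq_zero fun w _ => if_neg fun h => hex ⟨w, h⟩] at h3κ
      have e : C * (1 / (2 * C)) = 1 / 2 := by field_simp
      rw [e] at h3κ
      have := le_abs_self (μ₃ κ)
      linarith
    · have : 1 ≤ 2 * C * f κ := by
        have h := (not_le.1 hle).le
        rw [div_le_iff₀ (by positivity)] at h
        linarith
      have := abs_nonneg (μ₃ κ)
      linarith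

/-- The same for unnormalized states, with an error term that is uniform in the instances. -/
theorem exists_linear_extractor (hEff : P.IsEfficient) (hCompl : P.IsComplete) {C : ℝ}
    (hC : 0 < C) (hSound : ∀ δ, 0 < δ → P.IsSound δ (C * δ)) {δ : ℝ} (hδ : 0 < δ)
    {n m s : ℕ → ℕ} (hn : PolyBounded n) (hm : PolyBounded m) (hs : PolyBounded s)
    (R : ∀ κ, Relation (n κ) (m κ) (s κ))
    (A : ∀ κ, Adversary (P.shape κ (n κ) (m κ) (s κ)) (PubIndex .publicInput (n κ) (m κ) (s κ)))
    (hA : PolyBounded fun κ => (A κ).size) :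
    ∃ Ext : ∀ κ, QOp (Fin (A κ).reg ⊕ PubIndex .publicInput (n κ) (m κ) (s κ)) (Fin (m κ)),
      PolyBounded (fun κ => (Ext κ).size) ∧
      ∃ μ, Negligible μ ∧ ∀ κ (x : Bits (Fin (n κ))) (ρ : Op (Fin (A κ).reg)), ρ.PosSemidef →
        ρ.trace.re - prob ((Ext κ).apply
          (tensor ρ (basisState (pubInput .publicInput (R κ) x)))) (fun w => (R κ).Holds x w) ≤
        2 * C * (δ * ρ.trace.re + (ρ.trace.re - acceptProb (P.client κ (R κ) x) (A κ)
          (pubInput .publicInput (R κ) x) ρ)) + μ κ * ρ.trace.re := by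
  obtain ⟨Ext, hExt, h⟩ := exists_extractor_of_isDensity hEff hCompl hC hSound hδ hn hm hs R A hA
  have : ∀ κ, Nonempty (Bits (Fin (n κ)) × {ρ : Op (Fin (A κ).reg) // IsDensity ρ}) :=
    fun κ => ⟨⟨fun _ => false, _, isDensity_basisState fun _ => false⟩⟩
  obtain ⟨μ, hμ, -, hV⟩ := exists_negligible_bound
    (fun κ (z : Bits (Fin (n κ)) × {ρ : Op (Fin (A κ).reg) // IsDensity ρ}) =>
      1 - prob ((Ext κ).apply (tensor z.2.1 (basisState (pubInput .publicInput (R κ) z.1))))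
          (fun w => (R κ).Holds z.1 w) -
        2 * C * (δ + (1 - acceptProb (P.client κ (R κ) z.1) (A κ)
          (pubInput .publicInput (R κ) z.1) z.2.1))) 1
    (fun κ z => by
      have h1 := acceptProb_le_trace (P.client κ (R κ) z.1) (A κ)
        (pubInput .publicInput (R κ) z.1) z.2.2.1
      rw [z.2.2.2, Complex.one_re] at h1
      have h2 := prob_nonneg ((Ext κ).eff.posSemidef (tensor_posSemidef z.2.2.1
        (isDensity_basisState (pubInput .publicInput (R κ) z.1)).1)) (fun w => (R κ).Holds z.1 w)
      have h3 : 0 ≤ 2 * C * (δ + (1 - acceptProb (P.client κ (R κ) z.1) (A κ)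
          (pubInput .publicInput (R κ) z.1) z.2.1)) := mul_nonneg (by positivity) (by linarith)
      linarith)
    (fun z => h (fun κ => (z κ).1) (fun κ => (z κ).2.1) fun κ => (z κ).2.2)
  refine ⟨Ext, hExt, μ, hμ, fun κ x ρ hρ => ?_⟩
  have hE := (Ext κ).eff.comp (Eff.id.then_tensor (ι := Fin (A κ).reg)
    (isDensity_basisState (pubInput .publicInput (R κ) x)))
  have htr : ρ.trace = ((ρ.trace.re : ℝ) : ℂ) := by
    have := (Complex.le_def.1 hρ.trace_nonneg).2
    exact Complex.ext rfl (by rw [Complex.ofReal_im]; exact this.symm)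
  set c := ρ.trace.re with hc
  have hc0 : 0 ≤ c := trace_re_nonneg hρ
  rcases hc0.eq_or_lt with h0 | hpos
  · have hzero : ρ = 0 := by
      rw [← hρ.trace_eq_zero_iff, htr, ← h0, Complex.ofReal_zero]
    have e1 : acceptProb (P.client κ (R κ) x) (A κ) (pubInput .publicInput (R κ) x) ρ = 0 := by
      have := acceptProb_smul (P.client κ (R κ) x) (A κ) (pubInput .publicInput (R κ) x) 0 ρ
      rw [zero_mul, Complex.ofReal_zero, zero_smul] at this
      rw [hzero, this]
    have e2 := prob_nonneg (hE.posSemidef hρ) (fun w => (R κ).Holds x w)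
    rw [e1, ← h0]
    linarith
  · have hd : IsDensity (((c⁻¹ : ℝ) : ℂ) • ρ) := by
      refine ⟨hρ.smul (Complex.zero_le_real.2 (by positivity)), ?_⟩
      rw [Matrix.trace_smul, htr, smul_eq_mul, ← Complex.ofReal_mul, inv_mul_cancel₀ hpos.ne',
        Complex.ofReal_one]
    have := hV κ ⟨x, _, hd⟩
    dsimp only at this
    rw [acceptProb_smul] at this
    have e := (congrArg (fun M => prob M fun w => (R κ).Holds x w)
      (hE.smul ((c⁻¹ : ℝ) : ℂ) ρ)).trans (prob_smul _ _ _)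
    have h1 := mul_le_mul_of_nonneg_left this hpos.le
    have e' : prob ((Ext κ).apply (tensor (((c⁻¹ : ℝ) : ℂ) • ρ) (basisState
      (pubInput .publicInput (R κ) x)))) (fun w => (R κ).Holds x w) = _ := e
    rw [e'] at h1
    have hcc : c * c⁻¹ = 1 := mul_inv_cancel₀ hpos.ne'
    have e3 : ∀ a b : ℝ, c * (1 - c⁻¹ * a - 2 * C * (δ + (1 - c⁻¹ * b))) =
        c - a - 2 * C * (δ * c + (c - b)) := by
      intro a b
      linear_combination (-a + 2 * C * b) * hcc
    rw [e3] at h1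
    linarith

end LinearExtractor

/-! ### The rounds of the succinct testing protocol -/

section TestProtocol

theorem toBits_ofFn {k : ℕ} (b : Bits (Fin k)) : toBits k (List.ofFn b) = b := by
  funext j
  simp [toBits]

theorem average_fin_add {a b : ℕ} (p : Bits (Fin a) → Bits (Fin b) → ℝ) :
    (average fun r : Bits (Fin (a + b)) => p (fun j => r (Fin.castAdd b j))
      fun j => r (Fin.natAdd a j)) = average fun r => average fun t => p r t := by
  simp only [average, Fintype.card_fin]
  rw [← (bitsEquiv (finSumFinEquiv (m := a) (n := b)).symm).sum_comp, sum_bits_sum,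
    ← Finset.sum_div, div_div, pow_add, mul_comm]
  congr 1
  refine Finset.sum_congr rfl fun r _ => Finset.sum_congr rfl fun t _ => ?_
  congr 1 <;> · funext j; simp [bitsEquiv]

section AtRound

variable {σ : Shape} {pub : Type} {M : Type*} [AddCommMonoid M]

/-- A function of the history and the memory of a server in round `N`, extended by `0` to the
other rounds. -/
def atRound (A : Adversary σ pub) (N : ℕ) (G : List (List Bool) → Op (Fin (A.mem N)) → M) (j : ℕ)
    (l : List (List Bool)) (τ : Op (Fin (A.mem j))) : M :=
  if h : j = N then G l (h ▸ τ) else 0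

theorem atRound_self (A : Adversary σ pub) (N : ℕ)
    (G : List (List Bool) → Op (Fin (A.mem N)) → M) (l : List (List Bool))
    (τ : Op (Fin (A.mem N))) : atRound A N G N l τ = G l τ := dif_pos rfl

theorem interact_zero (send : List (List Bool) → List Bool) (A : Adversary σ pub) (k i : ℕ)
    (hist : List (List Bool)) (ρ : Op (Fin (A.mem i))) :
    interact send A (fun _ _ _ => (0 : M)) k i hist ρ = 0 := by
  induction k generalizing i hist with
  | zero => rfl
  | succ k ih => exact Finset.sum_eq_zero fun b _ => ih _ _ _

theorem interact_linear (send : List (List Bool) → List Bool) (A : Adversary σ pub) (a b : ℝ)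
    (F F' : ∀ j, List (List Bool) → Op (Fin (A.mem j)) → ℝ) (k i : ℕ)
    (hist : List (List Bool)) (ρ : Op (Fin (A.mem i))) :
    interact send A (fun j l τ => a * F j l τ + b * F' j l τ) k i hist ρ =
      a * interact send A F k i hist ρ + b * interact send A F' k i hist ρ := by
  induction k generalizing i hist with
  | zero => rfl
  | succ k ih =>
    rw [interact, interact, interact, Finset.mul_sum, Finset.mul_sum, ← Finset.sum_add_distrib]
    exact Finset.sum_congr rfl fun b _ => ih _ _ _

theorem average_sum {κ : Type*} {ν : Type} [Fintype ν] [DecidableEq ν] (s : Finset κ)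
    (p : Bits ν → κ → ℝ) :
    (average fun r => ∑ x ∈ s, p r x) = ∑ x ∈ s, average fun r => p r x := by
  simp only [average]
  rw [Finset.sum_comm, Finset.sum_div]

theorem average_interact {ν : Type} [Fintype ν] [DecidableEq ν]
    (send : List (List Bool) → List Bool) (A : Adversary σ pub)
    (F : Bits ν → ∀ j, List (List Bool) → Op (Fin (A.mem j)) → ℝ) (k i : ℕ)
    (hist : List (List Bool)) (ρ : Op (Fin (A.mem i))) :
    (average fun r => interact send A (F r) k i hist ρ) =
      interact send A (fun j l τ => average fun r => F r j l τ) k i hist ρ := by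
  induction k generalizing i hist with
  | zero => rfl
  | succ k ih =>
    simp only [interact]
    rw [average_sum]
    exact Finset.sum_congr rfl fun b _ => ih _ _ _

end AtRound

variable (H : HashFamily) (P : Protocol .publicInput)

/-- The format of the argument of knowledge for `h(w) = c`. -/
abbrev commitFormat (κ m : ℕ) : Shape :=
  P.shape κ (H.descLen m κ + κ) m (H.evalSize m κ + 0 + (κ + κ))

/-- The format of the argument of knowledge for `R(x, w) = 1 ∧ h(w) = c`. -/
abbrev openFormat (κ n m s : ℕ) : Shape :=
  P.shape κ (n + (H.descLen m κ + κ)) m (s + (H.evalSize m κ + 0 + (κ + κ)) + 1)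

/-- The positions of the public input of the argument of knowledge for `h(w) = c`. -/
abbrev CommitIndex (κ m : ℕ) : Type :=
  PubIndex .publicInput (H.descLen m κ + κ) m (H.evalSize m κ + 0 + (κ + κ))

/-- The positions of the public input of the argument of knowledge for
`R(x, w) = 1 ∧ h(w) = c`. -/
abbrev OpenIndex (κ n m s : ℕ) : Type :=
  PubIndex .publicInput (n + (H.descLen m κ + κ)) m (s + (H.evalSize m κ + 0 + (κ + κ)) + 1)

variable {κ n m s : ℕ}

theorem testShape_len_zero : (testShape H P κ n m s).sendLen 0 = H.descLen m κ ∧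
    (testShape H P κ n m s).recvLen 0 = κ := ⟨rfl, rfl⟩

theorem testShape_len_commit (i : ℕ) (hi : i < (commitFormat H P κ m).rounds) :
    (testShape H P κ n m s).sendLen (1 + i) = (commitFormat H P κ m).sendLen i ∧
      (testShape H P κ n m s).recvLen (1 + i) = (commitFormat H P κ m).recvLen i := by
  have h1 : ¬ 1 + i = 0 := by omega
  have h2 : 1 + i ≤ (commitShape H P κ m).rounds := by
    change 1 + i ≤ (commitFormat H P κ m).rounds; omega
  have h3 : 1 + i - 1 = i := by omega
  simp only [testShape, h1, h2, if_true, if_false, h3]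
  exact ⟨rfl, rfl⟩

theorem testShape_len_reveal :
    (testShape H P κ n m s).sendLen (1 + (commitFormat H P κ m).rounds) = n ∧
      (testShape H P κ n m s).recvLen (1 + (commitFormat H P κ m).rounds) = 0 := by
  have h1 : ¬ 1 + (commitShape H P κ m).rounds = 0 := by omega
  have h2 : ¬ 1 + (commitShape H P κ m).rounds ≤ (commitShape H P κ m).rounds := by omega
  have h3 : 1 + (commitShape H P κ m).rounds = (commitShape H P κ m).rounds + 1 := by omega
  exact ⟨(if_neg h1).trans ((if_neg h2).trans (if_pos h3)),
    (if_neg h1).trans ((if_neg h2).trans (if_pos h3))⟩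

theorem testShape_len_open (i : ℕ) :
    (testShape H P κ n m s).sendLen (1 + (commitFormat H P κ m).rounds + 1 + i) =
        (openFormat H P κ n m s).sendLen i ∧
      (testShape H P κ n m s).recvLen (1 + (commitFormat H P κ m).rounds + 1 + i) =
        (openFormat H P κ n m s).recvLen i := by
  have h1 : ¬ 1 + (commitShape H P κ m).rounds + 1 + i = 0 := by omega
  have h2 : ¬ 1 + (commitShape H P κ m).rounds + 1 + i ≤ (commitShape H P κ m).rounds := by omega
  have h3 : ¬ 1 + (commitShape H P κ m).rounds + 1 + i = (commitShape H P κ m).rounds + 1 := by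
    omega
  have h4 : 1 + (commitShape H P κ m).rounds + 1 + i - ((commitShape H P κ m).rounds + 2) = i := by
    omega
  exact ⟨(if_neg h1).trans ((if_neg h2).trans ((if_neg h3).trans
      (congrArg (openShape H P κ n m s).sendLen h4))),
    (if_neg h1).trans ((if_neg h2).trans ((if_neg h3).trans
      (congrArg (openShape H P κ n m s).recvLen h4)))⟩

/-- The hash function that the client samples. -/
def sampledHash (r : Bits (Fin (testShape H P κ n m s).clientCoins)) :
    Bits (Fin (H.descLen m κ)) :=
  (H.sample m κ).eval fun j => r (Fin.castAdd _ j)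

/-- The client's coins for the first argument. -/
def commitCoins (r : Bits (Fin (testShape H P κ n m s).clientCoins)) :
    Bits (Fin (commitFormat H P κ m).clientCoins) :=
  fun j => r (Fin.natAdd _ (Fin.castAdd _ j))

/-- The client's coins for the second argument. -/
def openCoins (r : Bits (Fin (testShape H P κ n m s).clientCoins)) :
    Bits (Fin (openFormat H P κ n m s).clientCoins) :=
  fun j => r (Fin.natAdd _ (Fin.natAdd _ j))

/-- The client of the first argument. -/
abbrev commitClient (h : Bits (Fin (H.descLen m κ))) (c : Bits (Fin κ)) :
    Client (commitFormat H P κ m) :=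
  P.client κ (commitRelation H m κ) (Fin.append h c)

/-- The client of the second argument. -/
abbrev openClient (R : Relation n m s) (x : Bits (Fin n)) (h : Bits (Fin (H.descLen m κ)))
    (c : Bits (Fin κ)) : Client (openFormat H P κ n m s) :=
  P.client κ (openRelation H κ R) (Fin.append x (Fin.append h c))

variable (R : Relation n m s) (x : Bits (Fin n))
  (r : Bits (Fin (testShape H P κ n m s).clientCoins))

theorem testClient_send_commit (c : Bits (Fin κ)) (l : List (List Bool))
    (hl : l.length < (commitFormat H P κ m).rounds) :
    (testClient H P κ R x).send r ([List.ofFn c] ++ l) =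
      (commitClient H P (sampledHash H P r) c).send (commitCoins H P r) l := by
  have h1 : ¬ ([List.ofFn c] ++ l).length = 0 := by simp
  have h2 : ([List.ofFn c] ++ l).length ≤ (commitShape H P κ m).rounds := by
    have : l.length < (commitShape H P κ m).rounds := hl
    simp; omega
  have hc : toBits κ (([List.ofFn c] ++ l).getD 0 []) = c := toBits_ofFn c
  simp only [testClient, h1, h2, if_true, if_false, hc]
  rfl

theorem testClient_send_reveal (l : List (List Bool))
    (hl : l.length = 1 + (commitFormat H P κ m).rounds) :
    (testClient H P κ R x).send r l = List.ofFn x := by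
  have hl : l.length = 1 + (commitShape H P κ m).rounds := hl
  have h1 : ¬ l.length = 0 := by omega
  have h2 : ¬ l.length ≤ (commitShape H P κ m).rounds := by omega
  have h3 : l.length = (commitShape H P κ m).rounds + 1 := by omega
  exact (if_neg h1).trans ((if_neg h2).trans (if_pos h3))

theorem testClient_send_open (c : Bits (Fin κ)) (l l' : List (List Bool)) (b : List Bool)
    (hl : l.length = (commitFormat H P κ m).rounds) :
    (testClient H P κ R x).send r (([List.ofFn c] ++ l ++ [b]) ++ l') =
      (openClient H P R x (sampledHash H P r) c).send (openCoins H P r) l' := by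
  have hl : l.length = (commitShape H P κ m).rounds := hl
  have hlen : (([List.ofFn c] ++ l ++ [b]) ++ l').length =
      (commitShape H P κ m).rounds + 2 + l'.length := by
    simp; omega
  have h1 : ¬ (([List.ofFn c] ++ l ++ [b]) ++ l').length = 0 := by omega
  have h2 : ¬ (([List.ofFn c] ++ l ++ [b]) ++ l').length ≤ (commitShape H P κ m).rounds := by omega
  have h3 : ¬ (([List.ofFn c] ++ l ++ [b]) ++ l').length = (commitShape H P κ m).rounds + 1 := by
    omega
  have h4 : (([List.ofFn c] ++ l ++ [b]) ++ l').drop ((commitShape H P κ m).rounds + 2) = l' :=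
    List.drop_left' (by simp; omega)
  have hc : toBits κ ((([List.ofFn c] ++ l ++ [b]) ++ l').getD 0 []) = c := toBits_ofFn c
  simp only [testClient]
  rw [if_neg h1, if_neg h2, if_neg h3, h4, hc]
  rfl

theorem testClient_accept (c : Bits (Fin κ)) (l l' : List (List Bool)) (b : List Bool)
    (hl : l.length = (commitFormat H P κ m).rounds) :
    (testClient H P κ R x).accept r (([List.ofFn c] ++ l ++ [b]) ++ l') =
      ((commitClient H P (sampledHash H P r) c).accept (commitCoins H P r) l &&
        (openClient H P R x (sampledHash H P r) c).accept (openCoins H P r) l') := by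
  have hl : l.length = (commitShape H P κ m).rounds := hl
  have h4 : (([List.ofFn c] ++ l ++ [b]) ++ l').drop ((commitShape H P κ m).rounds + 2) = l' :=
    List.drop_left' (by simp; omega)
  have h5 : ((([List.ofFn c] ++ l ++ [b]) ++ l').drop 1).take (commitShape H P κ m).rounds = l := by
    have : (([List.ofFn c] ++ l ++ [b]) ++ l').drop 1 = l ++ ([b] ++ l') := by simp
    rw [this]
    exact List.take_left' hl
  have hc : toBits κ ((([List.ofFn c] ++ l ++ [b]) ++ l').getD 0 []) = c := toBits_ofFn c
  simp only [testClient]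
  rw [h4, h5, hc]
  rfl

variable {pub : Type} (A : Adversary (testShape H P κ n m s) pub)

/-- The step of the server that produces the commitment. -/
def commitStep : QOp (Fin (A.mem 0) ⊕ Fin (H.descLen m κ)) (Fin (A.mem 1) ⊕ Fin κ) :=
  castStep (testShape_len_zero H P).1 (testShape_len_zero H P).2 (A.step 0)

/-- The step of the server that receives `x`. -/
def revealStep : QOp (Fin (A.mem (1 + (commitFormat H P κ m).rounds)) ⊕ Fin n)
    (Fin (A.mem (1 + (commitFormat H P κ m).rounds + 1)) ⊕ Fin 0) :=
  castStep (testShape_len_reveal H P).1 (testShape_len_reveal H P).2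
    (A.step (1 + (commitFormat H P κ m).rounds))

/-- The server in the first argument. -/
noncomputable abbrev commitAdversary : Adversary (commitFormat H P κ m) (CommitIndex H κ m) :=
  window A 1 _ _

/-- The server in the second argument. -/
noncomputable abbrev openAdversary : Adversary (openFormat H P κ n m s) (OpenIndex H κ n m s) :=
  window A (1 + (commitFormat H P κ m).rounds + 1) _ _

/-- The acceptance probability, as that of the first argument and then the second one. -/
theorem acceptFrom_testClient (ρ : Op (Fin (A.mem 0))) :
    acceptFrom (testClient H P κ R x) A r (testShape H P κ n m s).rounds 0 [] ρ =
      ∑ c, interact ((commitClient H P (sampledHash H P r) c).send (commitCoins H P r))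
        (commitAdversary H P A)
        (atRound (commitAdversary H P A) (commitFormat H P κ m).rounds fun l τ =>
          if (commitClient H P (sampledHash H P r) c).accept (commitCoins H P r) l then
            acceptFrom (openClient H P R x (sampledHash H P r) c) (openAdversary H P A)
              (openCoins H P r) (openFormat H P κ n m s).rounds 0 []
              (ptr ((revealStep H P A).apply (tensor τ (basisState x))))
          else 0)
        (commitFormat H P κ m).rounds 0 []
        (outcome c ((commitStep H P A).apply (tensor ρ (basisState (sampledHash H P r))))) := by
  have hr : (testShape H P κ n m s).rounds =
    1 + (commitFormat H P κ m).rounds + 1 + (openFormat H P κ n m s).rounds := rfl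
  rw [acceptFrom_eq_interact, hr, interact_add, interact_add, interact_add]
  set C := testClient H P κ R x with hC
  set Facc : ∀ j, List (List Bool) → Op (Fin (A.mem j)) → ℝ :=
    fun _ hist ρ => if C.accept r hist then ρ.trace.re else 0 with hFacc
  have h0 : toBits (H.descLen m κ) (C.send r []) = sampledHash H P r := toBits_ofFn _
  have e0 := sum_castStep (testShape_len_zero H P).1 (testShape_len_zero H P).2 (A.step 0) ρ
    (C.send r []) fun l τ => interact (C.send r) A (fun j hist ρ => interact (C.send r) A
      (fun j hist ρ => interact (C.send r) A Facc (openFormat H P κ n m s).rounds j hist ρ)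
        1 j hist ρ) (commitFormat H P κ m).rounds (0 + 1) ([] ++ [l]) τ
  refine e0.trans ?_
  rw [h0]
  refine Finset.sum_congr rfl fun c _ => ?_
  refine interact_window A 1 _ (testShape_len_commit H P) [List.ofFn c]
    (fun l hl => testClient_send_commit H P R x r c l hl) (fun l τ hl => ?_)
    _ 0 (zero_add _) [] rfl _
  refine Eq.trans ?_ (atRound_self (commitAdversary H P A) (commitFormat H P κ m).rounds (fun l τ =>
    if (commitClient H P (sampledHash H P r) c).accept (commitCoins H P r) l then
      acceptFrom (openClient H P R x (sampledHash H P r) c) (openAdversary H P A)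
        (openCoins H P r) (openFormat H P κ n m s).rounds 0 []
        (ptr ((revealStep H P A).apply (tensor τ (basisState x))))
    else 0) l τ).symm
  have hlen : ([List.ofFn c] ++ l).length = 1 + (commitFormat H P κ m).rounds := by
    simp; omega
  have e1 := sum_castStep (testShape_len_reveal H P).1 (testShape_len_reveal H P).2
    (A.step (1 + (commitFormat H P κ m).rounds)) τ (C.send r ([List.ofFn c] ++ l)) fun l' τ =>
      interact (C.send r) A Facc (openFormat H P κ n m s).rounds
        (1 + (commitFormat H P κ m).rounds + 1) ([List.ofFn c] ++ l ++ [l']) τ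
  have hptr : ∀ (z : Bits (Fin 0))
      (M : Op (Fin (A.mem (1 + (commitFormat H P κ m).rounds + 1)) ⊕ Fin 0)),
      outcome z M = ptr M := fun z M => by
    rw [ptr_eq_sum_outcome, Fintype.sum_subsingleton _ z]
  have e2 : ∀ (z : Bits (Fin 0)) (τ' : Op (Fin (A.mem (1 + (commitFormat H P κ m).rounds + 1)))),
      interact (C.send r) A Facc (openFormat H P κ n m s).rounds
        (1 + (commitFormat H P κ m).rounds + 1) ([List.ofFn c] ++ l ++ [List.ofFn z]) τ' =
      if (commitClient H P (sampledHash H P r) c).accept (commitCoins H P r) l then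
        acceptFrom (openClient H P R x (sampledHash H P r) c) (openAdversary H P A)
          (openCoins H P r) (openFormat H P κ n m s).rounds 0 [] τ'
      else 0 := by
    intro z τ'
    have e2 := interact_window (F := Facc) (F' := fun _ l' τ => if
          ((commitClient H P (sampledHash H P r) c).accept (commitCoins H P r) l &&
          (openClient H P R x (sampledHash H P r) c).accept (openCoins H P r) l') then τ.trace.re
          else 0) (pub' := OpenIndex H κ n m s) A (1 + (commitFormat H P κ m).rounds + 1)
      (openFormat H P κ n m s).rounds (fun i _ => testShape_len_open H P i)
      ([List.ofFn c] ++ l ++ [List.ofFn z])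
      (fun l' _ => testClient_send_open H P R x r c l l' _ hl)
      (fun l' τ _ => congrArg (fun b : Bool => if b then τ.trace.re else 0)
        (testClient_accept H P R x r c l l' _ hl))
      (openFormat H P κ n m s).rounds 0 (zero_add _) [] rfl τ'
    rw [List.append_nil] at e2
    refine e2.trans ?_
    by_cases hacc : (commitClient H P (sampledHash H P r) c).accept (commitCoins H P r) l
    · rw [if_pos hacc]
      refine Eq.trans ?_ (acceptFrom_eq_interact _ _ _ _ _ _ _).symm
      simp only [hacc, Bool.true_and]
    · rw [if_neg hacc]
      simp only [hacc, Bool.false_and, Bool.false_eq_true, if_false]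
      exact interact_zero _ _ _ _ _ _
  refine e1.trans ?_
  rw [testClient_send_reveal H P R x r _ hlen, toBits_ofFn]
  exact (Fintype.sum_subsingleton _ Fin.elim0).trans ((e2 _ _).trans (congrArg (fun τ' =>
    if (commitClient H P (sampledHash H P r) c).accept (commitCoins H P r) l then
      acceptFrom (openClient H P R x (sampledHash H P r) c) (openAdversary H P A)
        (openCoins H P r) (openFormat H P κ n m s).rounds 0 [] τ'
    else 0) (hptr _ _)))

end TestProtocol

/-! ### Two arguments in a row -/

section TwoPhase

theorem average_const_add_mul {ν : Type} [Fintype ν] [DecidableEq ν] (a b : ℝ) (p : Bits ν → ℝ) :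
    average (fun r => a + b * p r) = a + b * average p := by
  rw [average_add, average_const, average_const_mul]

theorem prob_average {ν ο : Type} [Fintype ν] [DecidableEq ν] [Fintype ο] [DecidableEq ο]
    (Φ : Bits ν → Op ο) (p : Bits ο → Prop) [DecidablePred p] :
    prob (((2 : ℂ) ^ Fintype.card ν)⁻¹ • ∑ r, Φ r) p = average fun r => prob (Φ r) p := by
  have h : ((2 : ℂ) ^ Fintype.card ν)⁻¹ = (((2 : ℝ) ^ Fintype.card ν)⁻¹ : ℝ) := by
    push_cast; rfl
  rw [h, prob_smul, prob_sum, average, div_eq_inv_mul]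

variable {σ σ' : Shape} {pub pub' : Type} [Fintype pub] [DecidableEq pub] [Fintype pub']
  [DecidableEq pub'] {π γ : Type} [Fintype π] [DecidableEq π] [Fintype γ] [DecidableEq γ]

/-- The state after an interaction with the client `C`, followed by the channel `X`. -/
noncomputable def runThen (C : Client σ) (A : Adversary σ pub)
    (X : Op (Fin (A.mem σ.rounds)) → Op π) (ρ : Op (Fin (A.mem 0))) : Op π :=
  ((2 : ℂ) ^ Fintype.card (Fin σ.clientCoins))⁻¹ • ∑ r : Bits (Fin σ.clientCoins),
    interact (C.send r) A (atRound A σ.rounds fun _ τ => X τ) σ.rounds 0 [] ρ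

theorem EffC.runThen (A : Adversary σ pub) {C : Bits γ → Client σ} {S N : ℕ}
    (hsend : ∀ i < σ.rounds, HasCircuit
      (fun a : Bits ((γ ⊕ Fin σ.clientCoins) ⊕ Transcript σ.recvLen i) =>
        toBits (σ.sendLen i) ((C (fun j => a (.inl (.inl j)))).send (fun j => a (.inl (.inr j)))
          (messages (a ∘ Sum.inr)))) S)
    (hS : ∀ i < σ.rounds, (A.step i).size ≤ S ∧ σ.sendLen i ≤ S ∧ σ.recvLen i ≤ S)
    {X : Bits γ → Op (Fin (A.mem σ.rounds)) → Op π} (hX : EffC X N) :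
    EffC (fun g ρ => SuccTest.runThen (C g) A (X g) ρ)
      (N + 8 * Fintype.card γ + 7 * σ.clientCoins +
        σ.rounds * (100 * ((σ.rounds + 1) * (S + 1) + (Fintype.card γ + σ.clientCoins)))) := by
  have h1 := EffC.interact (γ := γ ⊕ Fin σ.clientCoins) A (K := σ.rounds)
    (send := fun a => (C (a ∘ Sum.inl)).send (a ∘ Sum.inr)) hsend hS
    (hX.precomp (HasCircuit.select (Sum.inl : γ → γ ⊕ Fin σ.clientCoins)))
    (F := fun a => atRound A σ.rounds fun _ τ => X (a ∘ Sum.inl) τ)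
    (fun g l ρ => atRound_self _ _ _ _ _) σ.rounds 0 (zero_add _)
  have h2 := h1.precomp (HasCircuit.select (Sum.elim (fun j => j) fun q => q.1.elim0 :
    (γ ⊕ Fin σ.clientCoins) ⊕ Transcript σ.recvLen 0 → γ ⊕ Fin σ.clientCoins))
  have h3 : Fintype.card (Transcript σ.recvLen 0) = 0 :=
    Fintype.card_eq_zero_iff.2 ⟨fun q => q.1.elim0⟩
  refine (h2.random.mono ?_).congr fun g ρ => ?_
  · simp only [Fintype.card_sum, Fintype.card_fin, h3]
    omega
  · rfl

theorem prob_runThen (C : Client σ) (A : Adversary σ pub)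
    (X : Op (Fin (A.mem σ.rounds)) → Op π) (ρ : Op (Fin (A.mem 0))) (p : Bits π → Prop)
    [DecidablePred p] :
    prob (runThen C A X ρ) p = average fun r =>
      interact (C.send r) A (atRound A σ.rounds fun _ τ => prob (X τ) p) σ.rounds 0 [] ρ := by
  rw [runThen, prob_average]
  congr 1
  funext r
  let φ : Op π →+ ℝ := ⟨⟨fun τ => prob τ p, by simp [prob]⟩, fun τ τ' => prob_add τ τ' p⟩
  refine (map_interact φ _ A _ _ _ _ ρ).trans
    (interact_congr A _ _ _ (zero_add _) (fun l τ => ?_) _ _)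
  rw [atRound_self, atRound_self]
  rfl

/-- The probability that two clients accept one after the other, given their random bits, when
the memory of the first server is handed to the second one by `L`. -/
noncomputable def acceptBoth (C : Client σ) (C' : Client σ') (A : Adversary σ pub)
    (A' : Adversary σ' pub') (L : Op (Fin (A.mem σ.rounds)) → Op (Fin A'.reg)) (p' : Bits pub')
    (r : Bits (Fin σ.clientCoins)) (r' : Bits (Fin σ'.clientCoins)) (ρ : Op (Fin (A.mem 0))) : ℝ :=
  interact (C.send r) A (atRound A σ.rounds fun l τ => if C.accept r l then
    acceptFrom C' A' r' σ'.rounds 0 [] (A'.load.apply (tensor (L τ) (basisState p'))) else 0)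
    σ.rounds 0 [] ρ

variable (C : Client σ) (C' : Client σ') (A : Adversary σ pub) (A' : Adversary σ' pub')
  {L : Op (Fin (A.mem σ.rounds)) → Op (Fin A'.reg)} {N : ℕ} (p' : Bits pub')

theorem acceptBoth_le_left (hL : Eff L N) (r : Bits (Fin σ.clientCoins))
    (r' : Bits (Fin σ'.clientCoins)) {ρ : Op (Fin (A.mem 0))} (hρ : ρ.PosSemidef) :
    acceptBoth C C' A A' L p' r r' ρ ≤ acceptFrom C A r σ.rounds 0 [] ρ := by
  rw [acceptFrom_eq_interact]
  refine interact_le _ _ _ _ _ (zero_add _) (fun l τ hτ => ?_) _ hρ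
  rw [atRound_self]
  split_ifs
  · refine (acceptFrom_le_trace _ _ _ _ _ _
      ((eff_load A' p').posSemidef (hL.posSemidef hτ))).trans_eq ?_
    rw [(eff_load A' p').trace, hL.trace]
  · exact le_rfl

theorem average_acceptBoth_le (hL : Eff L N) (r : Bits (Fin σ.clientCoins))
    {ρ : Op (Fin (A.mem 0))} (hρ : ρ.PosSemidef) :
    (average fun r' => acceptBoth C C' A A' L p' r r' ρ) ≤
      interact (C.send r) A (atRound A σ.rounds fun _ τ => acceptProb C' A' p' (L τ))
        σ.rounds 0 [] ρ := by
  simp only [acceptBoth]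
  rw [average_interact]
  refine interact_le _ _ _ _ _ (zero_add _) (fun l τ hτ => ?_) _ hρ
  simp only [atRound_self]
  refine average_mono fun r' => ?_
  split_ifs
  · exact le_rfl
  · exact acceptFrom_nonneg _ _ _ _ _ _ ((eff_load A' p').posSemidef (hL.posSemidef hτ))

/-- An extractor for the second argument, run after a simulation of the first argument, fails
only if one of the two arguments is rejected. -/
theorem trace_sub_prob_runThen_le (hL : Eff L N) {X : Op (Fin A'.reg) → Op π}
    {good : Bits π → Prop} [DecidablePred good] {K δ μ : ℝ} (hK : 0 ≤ K)
    (hX : ∀ τ, τ.PosSemidef → τ.trace.re - prob (X τ) good ≤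
      K * (δ * τ.trace.re + (τ.trace.re - acceptProb C' A' p' τ)) + μ * τ.trace.re)
    {ρ : Op (Fin (A.mem 0))} (hρ : ρ.PosSemidef) :
    ρ.trace.re - prob (runThen C A (fun τ => X (L τ)) ρ) good ≤
      K * (δ * ρ.trace.re + (ρ.trace.re - average fun r => average fun r' =>
        acceptBoth C C' A A' L p' r r' ρ)) + μ * ρ.trace.re := by
  have h : (1 - K * (δ + 1) - μ) * ρ.trace.re + K * (average fun r => average fun r' =>
      acceptBoth C C' A A' L p' r r' ρ) ≤ prob (runThen C A (fun τ => X (L τ)) ρ) good := by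
    rw [prob_runThen, ← average_const_add_mul]
    refine average_mono fun r => ?_
    refine (add_le_add le_rfl (mul_le_mul_of_nonneg_left
      (average_acceptBoth_le C C' A A' p' hL r hρ) hK)).trans ?_
    rw [← interact_trace (C.send r) A σ.rounds 0 [] ρ, ← interact_linear]
    refine interact_le _ _ _ _ _ (zero_add _) (fun l τ hτ => ?_) _ hρ
    rw [atRound_self, atRound_self]
    have := hX (L τ) (hL.posSemidef hτ)
    rw [hL.trace] at this
    linarith
  linarith

end TwoPhase

section Memory

theorem QOp.card_out_le {ι ο : Type} [Fintype ι] [Fintype ο] (Q : QOp ι ο) :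
    Fintype.card ο ≤ Fintype.card ι + Q.aux := by
  simpa using Fintype.card_le_of_embedding Q.out

/-- The memory of a server is bounded by its size and the lengths of its inputs. -/
theorem Adversary.mem_le {σ : Shape} {pub : Type} [Fintype pub] (A : Adversary σ pub) {B : ℕ}
    (hB : ∀ i < σ.rounds, σ.sendLen i ≤ B) (i : ℕ) (hi : i ≤ σ.rounds) :
    A.mem i ≤ A.size + Fintype.card pub + i * B := by
  have h : A.mem i ≤ A.reg + A.load.size + Fintype.card pub +
      ∑ j ∈ Finset.range i, (A.step j).size + i * B := by
    induction i with
    | zero =>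
      have := A.load.card_out_le
      simp only [Fintype.card_sum, Fintype.card_fin] at this
      rw [QOp.size]
      simp
      omega
    | succ i ih =>
      have h1 := ih (by omega)
      have h2 := (A.step i).card_out_le
      have h3 := hB i (by omega)
      simp only [Fintype.card_sum, Fintype.card_fin] at h2
      rw [Finset.sum_range_succ, add_mul, one_mul]
      have h4 : (A.step i).aux ≤ (A.step i).size := Nat.le_add_right _ _
      omega
  have h2 : ∑ j ∈ Finset.range i, (A.step j).size ≤ ∑ j ∈ Finset.range σ.rounds, (A.step j).size :=
    Finset.sum_le_sum_of_subset (Finset.range_mono hi)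
  rw [Adversary.size]
  omega

end Memory

/-! ### The acceptance probability of the succinct testing protocol -/

section TestProtocol

variable (H : HashFamily) (P : Protocol .publicInput) {κ n m s : ℕ} (R : Relation n m s)
  (x : Bits (Fin n)) {pub : Type} (A : Adversary (testShape H P κ n m s) pub)

theorem Adversary.size_step_le {σ : Shape} {pub : Type} (A : Adversary σ pub) (i : ℕ)
    (hi : i < σ.rounds) : (A.step i).size ≤ A.size := by
  have := Finset.single_le_sum (f := fun i => (A.step i).size) (fun _ _ => Nat.zero_le _)
    (Finset.mem_range.2 hi)
  rw [Adversary.size]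
  exact this.trans (Nat.le_add_left _ _)

/-- The production of the commitment. -/
noncomputable def committed (h : Bits (Fin (H.descLen m κ))) (ρ : Op (Fin (A.mem 0))) :
    Op (Fin (commitAdversary H P A).reg ⊕ Fin κ) :=
  (commitStep H P A).apply (tensor ρ (basisState h))

theorem effC_committed : EffC (committed H P A) A.size := by
  refine (EffC.of_right (commitStep H P A).eff).mono ?_
  rw [commitStep, size_castStep]
  exact A.size_step_le 0 (by simp only [testShape]; omega)

/-- The initial memory of the server in the first argument. -/
noncomputable def commitStart (ρ : Op (Fin (commitAdversary H P A).reg)) :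
    Op (Fin ((commitAdversary H P A).mem 0)) := ρ

theorem eff_commitStart : Eff (commitStart H P A) 0 := Eff.id

theorem commitAdversary_load (p : Bits (CommitIndex H κ m))
    (ρ : Op (Fin (commitAdversary H P A).reg)) :
    (commitAdversary H P A).load.apply (tensor ρ (basisState p)) = commitStart H P A ρ :=
  window_load A 1 p ρ

/-- The transition from the first argument to the second one, in which `x` is revealed. -/
noncomputable def reveal
    (τ : Op (Fin ((commitAdversary H P A).mem (commitFormat H P κ m).rounds))) :
    Op (Fin (openAdversary H P A).reg) :=
  ptr ((revealStep H P A).apply (tensor τ (basisState x)))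

theorem eff_reveal : Eff (reveal H P x A) (A.size + n) := by
  have h := ((revealStep H P A).eff.comp (Eff.id.then_tensor (isDensity_basisState x))).then_ptr
  refine h.mono ?_
  have h1 : (revealStep H P A).size ≤ A.size := by
    rw [revealStep, size_castStep]
    exact A.size_step_le _ (by
      change _ < 1 + (commitFormat H P κ m).rounds + 1 + (openFormat H P κ n m s).rounds
      omega)
  simp only [Fintype.card_fin]
  omega

theorem size_commitAdversary_le : (commitAdversary H P A).size ≤ A.mem 1 + A.size :=
  window_size_le A 1 (testShape_len_commit H P) (by
    change _ ≤ 1 + (commitFormat H P κ m).rounds + 1 + (openFormat H P κ n m s).rounds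
    omega)

theorem size_openAdversary_le :
    (openAdversary H P A).size ≤ A.mem (1 + (commitFormat H P κ m).rounds + 1) + A.size :=
  window_size_le A _ (fun i _ => testShape_len_open H P i) le_rfl

/-- The public input of the first argument. -/
abbrev commitInput (h : Bits (Fin (H.descLen m κ))) (c : Bits (Fin κ)) :
    Bits (CommitIndex H κ m) :=
  pubInput .publicInput (commitRelation H m κ) (Fin.append h c)

/-- The public input of the second argument. -/
abbrev openInput (h : Bits (Fin (H.descLen m κ))) (c : Bits (Fin κ)) :
    Bits (OpenIndex H κ n m s) :=
  pubInput .publicInput (openRelation H κ R) (Fin.append x (Fin.append h c))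

/-- The probability that both arguments are accepted, on a state of the memory of the server after
the commitment `c` for the hash function `h`. -/
noncomputable def acceptCommitted (h : Bits (Fin (H.descLen m κ))) (c : Bits (Fin κ))
    (r₁ : Bits (Fin (commitFormat H P κ m).clientCoins))
    (r₂ : Bits (Fin (openFormat H P κ n m s).clientCoins))
    (ρ : Op (Fin (commitAdversary H P A).reg)) : ℝ :=
  acceptBoth (commitClient H P h c) (openClient H P R x h c) (commitAdversary H P A)
    (openAdversary H P A) (reveal H P x A) (openInput H R x h c) r₁ r₂ (commitStart H P A ρ)

theorem acceptFrom_testClient_eq (r : Bits (Fin (testShape H P κ n m s).clientCoins))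
    (ρ : Op (Fin (A.mem 0))) :
    acceptFrom (testClient H P κ R x) A r (testShape H P κ n m s).rounds 0 [] ρ =
      ∑ c, acceptCommitted H P R x A (sampledHash H P r) c (commitCoins H P r) (openCoins H P r)
        (outcome c (committed H P A (sampledHash H P r) ρ)) := by
  rw [acceptFrom_testClient]
  refine Finset.sum_congr rfl fun c _ => ?_
  refine interact_congr (commitAdversary H P A) _ _ _ (zero_add _) (fun l τ => ?_) _ _
  refine (atRound_self (commitAdversary H P A) _ _ _ _).trans
    (Eq.trans ?_ (atRound_self (commitAdversary H P A) _ _ _ _).symm)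
  refine congrArg (fun τ' => if (commitClient H P (sampledHash H P r) c).accept
    (commitCoins H P r) l then acceptFrom (openClient H P R x (sampledHash H P r) c)
      (openAdversary H P A) (openCoins H P r) (openFormat H P κ n m s).rounds 0 [] τ' else 0) ?_
  exact (window_load A (1 + (commitFormat H P κ m).rounds + 1) _ (reveal H P x A τ)).symm

theorem acceptProb_testClient [Fintype pub] [DecidableEq pub] (p : Bits pub)
    (ρ : Op (Fin A.reg)) :
    acceptProb (testClient H P κ R x) A p ρ = average fun r => ∑ c, average fun r₁ =>
      average fun r₂ => acceptCommitted H P R x A ((H.sample m κ).eval r) c r₁ r₂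
        (outcome c (committed H P A ((H.sample m κ).eval r)
          (A.load.apply (tensor ρ (basisState p))))) := by
  set σ := A.load.apply (tensor ρ (basisState p)) with hσ
  have h1 := average_fin_add fun (r : Bits (Fin (H.coins m κ)))
    (t : Bits (Fin ((commitFormat H P κ m).clientCoins + (openFormat H P κ n m s).clientCoins))) =>
      ∑ c, acceptCommitted H P R x A ((H.sample m κ).eval r) c (fun j => t (Fin.castAdd _ j))
        (fun j => t (Fin.natAdd _ j)) (outcome c (committed H P A ((H.sample m κ).eval r) σ))
  have h2 : ∀ r : Bits (Fin (H.coins m κ)), (average fun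
      t : Bits (Fin ((commitFormat H P κ m).clientCoins + (openFormat H P κ n m s).clientCoins)) =>
      ∑ c, acceptCommitted H P R x A ((H.sample m κ).eval r) c (fun j => t (Fin.castAdd _ j))
        (fun j => t (Fin.natAdd _ j)) (outcome c (committed H P A ((H.sample m κ).eval r) σ))) =
      ∑ c, average fun r₁ => average fun r₂ =>
        acceptCommitted H P R x A ((H.sample m κ).eval r) c r₁ r₂
          (outcome c (committed H P A ((H.sample m κ).eval r) σ)) := by
    intro r
    rw [average_sum]
    exact Finset.sum_congr rfl fun c _ => average_fin_add fun r₁ r₂ =>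
      acceptCommitted H P R x A ((H.sample m κ).eval r) c r₁ r₂
        (outcome c (committed H P A ((H.sample m κ).eval r) σ))
  refine Eq.trans ?_ (h1.trans (congrArg average (funext h2)))
  exact congrArg average (funext fun r => acceptFrom_testClient_eq H P R x A r σ)

/-- The probability that both arguments are accepted is at most that for the first argument. -/
theorem average_acceptCommitted_le (h : Bits (Fin (H.descLen m κ))) (c : Bits (Fin κ))
    {ρ : Op (Fin (commitAdversary H P A).reg)} (hρ : ρ.PosSemidef) :
    (average fun r₁ => average fun r₂ => acceptCommitted H P R x A h c r₁ r₂ ρ) ≤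
      acceptProb (commitClient H P h c) (commitAdversary H P A) (commitInput H h c) ρ := by
  refine average_mono fun r₁ => ?_
  rw [commitAdversary_load, ← average_const (ι := Fin (openFormat H P κ n m s).clientCoins)
    (acceptFrom _ _ _ _ _ _ _)]
  exact average_mono fun r₂ => acceptBoth_le_left _ _ _ _ _ (eff_reveal H P x A) _ _
    ((eff_commitStart H P A).posSemidef hρ)

end TestProtocol

/-! ### The extractors -/

section Extractors

variable {γ ι ο : Type} [Fintype γ] [DecidableEq γ] [Fintype ι] [DecidableEq ι] [Fintype ο]
  [DecidableEq ο]

/-- A quantum operation whose public input has a fixed relation and an instance that consists of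
constants and parameters. -/
theorem EffC.of_pubInput {n m s : ℕ} (Q : QOp (ι ⊕ PubIndex .publicInput n m s) ο)
    (R : Relation n m s) {f : Bits γ → Bits (Fin n)} (hf : HasCircuit f 0) :
    EffC (fun g ρ => Q.apply (tensor ρ (basisState (pubInput .publicInput R (f g)))))
      (Q.size + 2 * Fintype.card (PubIndex .publicInput n m s)) :=
  ((EffC.of_right Q.eff).precomp ((HasCircuit.const R.desc).pair hf)).mono (by omega)

variable (H : HashFamily) {κ n m s : ℕ}

/-- The instance `(h, c)` of the first argument. -/
def commitInstance (g : Bits (Fin (H.descLen m κ) ⊕ Fin κ)) : Bits (Fin (H.descLen m κ + κ)) :=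
  g ∘ finSumFinEquiv.symm

/-- The instance `(x, h, c)` of the second argument. -/
def openInstance (x : Bits (Fin n)) (g : Bits (Fin (H.descLen m κ) ⊕ Fin κ)) :
    Bits (Fin (n + (H.descLen m κ + κ))) :=
  Fin.append x (commitInstance H g)

theorem hasCircuit_commitInstance : HasCircuit (commitInstance H (m := m) (κ := κ)) 0 :=
  HasCircuit.select _

theorem hasCircuit_openInstance (x : Bits (Fin n)) :
    HasCircuit (openInstance H (m := m) (κ := κ) x) 0 := by
  refine (HasCircuit.wires (Fin.append (fun j => .inl (x j))
    fun j => .inr (finSumFinEquiv.symm j))).congr fun g => ?_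
  funext j
  refine Fin.addCases (fun j => ?_) (fun j => ?_) j
  · simp [openInstance]
  · simp [openInstance, commitInstance]

theorem commitInstance_elim (h : Bits (Fin (H.descLen m κ))) (c : Bits (Fin κ)) :
    commitInstance H (Sum.elim h c) = Fin.append h c := elim_comp_finSumFinEquiv_symm h c

/-- The test of an opening. -/
def openTest (R : Relation n m s) (x : Bits (Fin n))
    (a : Bits ((Fin (H.descLen m κ) ⊕ Fin κ) ⊕ Fin m)) : Bits Unit :=
  (openRelation H κ R).eval (Sum.elim (openInstance H x (a ∘ Sum.inl)) (a ∘ Sum.inr))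

theorem hasCircuit_openTest (R : Relation n m s) (x : Bits (Fin n)) :
    HasCircuit (openTest H (κ := κ) R x) (s + (H.evalSize m κ + 0 + (κ + κ)) + 1) :=
  ((openRelation H κ R).hasCircuit.comp (((hasCircuit_openInstance H x).precomp Sum.inl).pair
    (HasCircuit.select Sum.inr))).mono (by omega)

theorem openTest_eq_true_iff (R : Relation n m s) (x : Bits (Fin n))
    (h : Bits (Fin (H.descLen m κ))) (c : Bits (Fin κ)) (w : Bits (Fin m)) :
    openTest H R x (Sum.elim (Sum.elim h c) w) () = true ↔ R.Holds x w ∧ H.hash h w = c := by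
  rw [← openRelation_holds, ← commitInstance_elim]
  rfl

end Extractors

/-! ### Soundness of the succinct testing protocol -/

section Soundness

variable (H : HashFamily) (P : Protocol .publicInput)

theorem testShape_sendLen_le {κ n m s B : ℕ}
    (h₁ : ∀ i < (commitFormat H P κ m).rounds, (commitFormat H P κ m).sendLen i ≤ B)
    (h₂ : ∀ i < (openFormat H P κ n m s).rounds, (openFormat H P κ n m s).sendLen i ≤ B) (i : ℕ)
    (hi : i < (testShape H P κ n m s).rounds) :
    (testShape H P κ n m s).sendLen i ≤ H.descLen m κ + n + B := by
  have hi : i < 1 + (commitShape H P κ m).rounds + 1 + (openShape H P κ n m s).rounds := hi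
  simp only [testShape]
  split_ifs with h3 h4 h5
  · omega
  · have := h₁ (i - 1) (by change _ < (commitShape H P κ m).rounds; omega)
    exact this.trans (by omega)
  · omega
  · have := h₂ (i - ((commitShape H P κ m).rounds + 2))
      (by change _ < (openShape H P κ n m s).rounds; omega)
    exact this.trans (by omega)

theorem average_sum_linear {ν β : Type} [Fintype ν] [DecidableEq ν] [Fintype β] (a b : ℝ)
    (p q : Bits ν → β → ℝ) :
    (average fun r => ∑ c, (a * p r c + b * q r c)) =
      a * (average fun r => ∑ c, p r c) + b * average fun r => ∑ c, q r c := by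
  rw [← average_const_mul, ← average_const_mul, ← average_add]
  simp only [Finset.sum_add_distrib, Finset.mul_sum]

/-- The numerical core of the analysis: if two extractors fail with a probability that is linear
in the probability of rejection, and they are consistent, then the first one succeeds. -/
theorem success_of_consistent {ν β : Type} [Fintype ν] [DecidableEq ν] [Fintype β]
    {t α e o g : Bits ν → β → ℝ} {K δ μ₁ μ₂ μ₃ : ℝ} (hK : 0 ≤ K)
    (he : ∀ r c, t r c - e r c ≤ K * (δ * t r c + (t r c - α r c)) + μ₁ * t r c)
    (ho : ∀ r c, t r c - o r c ≤ K * (δ * t r c + (t r c - α r c)) + μ₂ * t r c)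
    (ht : (average fun r => ∑ c, t r c) = 1) (hα : 1 - δ ≤ average fun r => ∑ c, α r c)
    (h : (average fun r => ∑ c, (t r c - 3 * (t r c - e r c) - 2 * (t r c - o r c))) ≤
      (average fun r => ∑ c, g r c) + μ₃) :
    1 - 10 * K * δ - (3 * μ₁ + 2 * μ₂ + μ₃) ≤ average fun r => ∑ c, g r c := by
  have h1 : (average fun r => ∑ c, ((1 - 5 * K * (δ + 1) - 3 * μ₁ - 2 * μ₂) * t r c +
      5 * K * α r c)) ≤
      average fun r => ∑ c, (t r c - 3 * (t r c - e r c) - 2 * (t r c - o r c)) :=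
    average_mono fun r => Finset.sum_le_sum fun c _ => by linarith [he r c, ho r c]
  rw [average_sum_linear, ht] at h1
  have := mul_le_mul_of_nonneg_left hα (by positivity : 0 ≤ 5 * K)
  linarith

variable {H P}

theorem polyBounded_card_pubIndex (v : Visibility) {n m s : ℕ → ℕ} (hn : PolyBounded n)
    (hm : PolyBounded m) (hs : PolyBounded s) :
    PolyBounded fun κ => Fintype.card (PubIndex v (n κ) (m κ) (s κ)) :=
  ((polyBounded_card_descIndex hn hm hs).add hn).mono fun κ => by
    rw [Fintype.card_sum, Fintype.card_fin]
    cases v <;> simp [Visibility.len]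

theorem polyBounded_mem (hEff : P.IsEfficient) {n m s : ℕ → ℕ} (hn : PolyBounded n)
    (hm : PolyBounded m) (hs : PolyBounded s)
    (A : ∀ κ, Adversary (testShape H P κ (n κ) (m κ) (s κ))
      (PubIndex .clientInput (n κ) (m κ) (s κ)))
    (hA : PolyBounded fun κ => (A κ).size) :
    ∃ M, PolyBounded M ∧ ∀ κ, ∀ i ≤ (testShape H P κ (n κ) (m κ) (s κ)).rounds,
      (A κ).mem i ≤ M κ := by
  have hd := H.polyBounded_descLen m
  have hκ := PolyBounded.id
  have hs₁ := ((H.polyBounded hm).2.2.add (PolyBounded.const 0)).add (hκ.add hκ)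
  obtain ⟨B₁, hB₁, h₁⟩ := hEff.exists_bound (hd.add hκ) hm hs₁
  obtain ⟨B₂, hB₂, h₂⟩ := hEff.exists_bound (hn.add (hd.add hκ)) hm
    ((hs.add hs₁).add (PolyBounded.const 1))
  have hpub := polyBounded_card_pubIndex .clientInput hn hm hs
  refine ⟨_, (hA.add hpub).add (((PolyBounded.const 2).add (hB₁.add hB₂)).mul
    ((hd.add hn).add (hB₁.add hB₂))), fun κ i hi => ?_⟩
  have hr : (testShape H P κ (n κ) (m κ) (s κ)).rounds ≤ 2 + (B₁ κ + B₂ κ) := by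
    have h3 : (commitShape H P κ (m κ)).rounds ≤ B₁ κ := (h₁ κ).1
    have h4 : (openShape H P κ (n κ) (m κ) (s κ)).rounds ≤ B₂ κ := (h₂ κ).1
    simp only [testShape]
    omega
  refine ((A κ).mem_le (testShape_sendLen_le H P (B := B₁ κ + B₂ κ)
    (fun j hj => ((h₁ κ).2.2.2.1 j hj).1.trans (Nat.le_add_right _ _))
    (fun j hj => ((h₂ κ).2.2.2.1 j hj).1.trans (Nat.le_add_left _ _))) i hi).trans ?_
  exact Nat.add_le_add_left (Nat.mul_le_mul_right _ (hi.trans hr)) _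

/-- The extractor of the test samples a hash function, lets the server commit and runs the extractor
of the first argument.  The extractor of the second argument, which depends on the input of the
client, occurs in the analysis only. -/
theorem exists_testExtractor (hH : H.IsCollapsing) (hEff : P.IsEfficient) (hCompl : P.IsComplete)
    {C : ℝ} (hC : 0 < C) (hSound : ∀ δ, 0 < δ → P.IsSound δ (C * δ)) {δ : ℝ} (hδ : 0 < δ)
    {n m s : ℕ → ℕ} (hn : PolyBounded n) (hm : PolyBounded m) (hs : PolyBounded s)
    (A : ∀ κ, Adversary (testShape H P κ (n κ) (m κ) (s κ))
      (PubIndex .clientInput (n κ) (m κ) (s κ)))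
    (hA : PolyBounded fun κ => (A κ).size) :
    ∃ Ext : ∀ κ, QOp (Fin (A κ).reg ⊕ PubIndex .clientInput (n κ) (m κ) (s κ)) (Fin (m κ)),
      PolyBounded (fun κ => (Ext κ).size) ∧
      ∀ (R : ∀ κ, Relation (n κ) (m κ) (s κ)) (x : ∀ κ, Bits (Fin (n κ)))
        (ρ : ∀ κ, Op (Fin (A κ).reg)), (∀ κ, IsDensity (ρ κ)) →
      ∃ μ : ℕ → ℝ, Negligible μ ∧ ∀ κ,
        1 - δ ≤ acceptProb (testClient H P κ (R κ) (x κ)) (A κ) (pubInput .clientInput (R κ) (x κ))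
          (ρ κ) →
        1 - 20 * C * δ - μ κ ≤ prob ((Ext κ).apply (tensor (ρ κ) (basisState
          (pubInput .clientInput (R κ) (x κ))))) fun w => (R κ).Holds (x κ) w := by
  have hd := H.polyBounded_descLen m
  have hκ := PolyBounded.id
  obtain ⟨hcoins, hsample, heval⟩ := H.polyBounded hm
  have hn₁ := hd.add hκ
  have hs₁ := (heval.add (PolyBounded.const 0)).add (hκ.add hκ)
  have hn₂ := hn.add hn₁
  have hs₂ := (hs.add hs₁).add (PolyBounded.const 1)
  obtain ⟨M, hM, hmem⟩ := polyBounded_mem hEff hn hm hs A hA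
  have hr : ∀ κ, (testShape H P κ (n κ) (m κ) (s κ)).rounds = 1 + (commitFormat H P κ (m κ)).rounds
    + 1 + (openFormat H P κ (n κ) (m κ) (s κ)).rounds := fun κ => rfl
  have hA₁ : PolyBounded fun κ => (commitAdversary H P (A κ)).size :=
    (hM.add hA).mono fun κ => (size_commitAdversary_le H P (A κ)).trans
      (Nat.add_le_add_right (hmem κ 1 (by rw [hr]; omega)) _)
  have hA₂ : PolyBounded fun κ => (openAdversary H P (A κ)).size :=
    (hM.add hA).mono fun κ => (size_openAdversary_le H P (A κ)).trans
      (Nat.add_le_add_right (hmem κ _ (by rw [hr]; omega)) _)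
  obtain ⟨Ext₁, hExt₁, μ₁, hμ₁, h₁⟩ := exists_linear_extractor hEff hCompl hC hSound hδ hn₁ hm hs₁
    (fun κ => commitRelation H (m κ) κ) (fun κ => commitAdversary H P (A κ)) hA₁
  have hE := fun κ => EffC.of_pubInput (Ext₁ κ) (commitRelation H (m κ) κ)
    (hasCircuit_commitInstance H)
  have hcard₁ := polyBounded_card_pubIndex .publicInput hn₁ hm hs₁
  have hcard₂ := polyBounded_card_pubIndex .publicInput hn₂ hm hs₂
  -- the extractor: sample a hash function, let the server commit, run the first extractor
  have hExt := fun κ => (((((effC_committed H P (A κ)).bind (hE κ)).precomp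
    ((H.sample (m κ) κ).hasCircuit.precomp (Sum.inr :
      _ → PubIndex .clientInput (n κ) (m κ) (s κ) ⊕ Fin (H.coins (m κ) κ)))).random).comp
    (EffC.of_right (A κ).load.eff)).exists_qop
  choose Ext hsize hExt using hExt
  refine ⟨Ext, ?_, fun R x ρ hρ => ?_⟩
  · have hcard := polyBounded_card_pubIndex .clientInput hn hm hs
    refine ((PolyBounded.const 100).mul (((((hA.add hExt₁).add hcard₁).add hn₁).add
      (hsample.add hcoins)).add hcard)).mono fun κ => (hsize κ).trans ?_
    have hload : (A κ).load.size ≤ (A κ).size := by rw [Adversary.size]; omega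
    simp only [Fintype.card_sum, Fintype.card_fin]
    omega
  obtain ⟨B₁, hB₁, hcirc⟩ := hEff.exists_bound hn₁ hm hs₁
  obtain ⟨Ext₂, hExt₂, μ₂, hμ₂, h₂⟩ := exists_linear_extractor hEff hCompl hC hSound hδ hn₂ hm hs₂
    (fun κ => openRelation H κ (R κ)) (fun κ => openAdversary H P (A κ)) hA₂
  -- the second extractor, after a simulation of the first argument and the revelation of `x`
  have hX := fun κ => (EffC.of_pubInput (Ext₂ κ) (openRelation H κ (R κ))
    (hasCircuit_openInstance H (x κ))).comp (EffC.of_eff (eff_reveal H P (x κ) (A κ)))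
  have hT := fun κ => (EffC.runThen (commitAdversary H P (A κ))
    (C := fun g => P.client κ (commitRelation H (m κ) κ) (commitInstance H g))
    (S := (commitAdversary H P (A κ)).size + B₁ κ)
    (fun i hi => ((((hcirc κ).2.2.2.2 (commitRelation H (m κ) κ)).1 i hi).precomp
      (Sum.map (Sum.map finSumFinEquiv.symm (fun j => j)) (fun j => j))).mono
        (Nat.le_add_left _ _))
    (fun i hi => ⟨((commitAdversary H P (A κ)).size_step_le i hi).trans (Nat.le_add_right _ _),
      ((hcirc κ).2.2.2.1 i hi).1.trans (Nat.le_add_left _ _),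
      ((hcirc κ).2.2.2.1 i hi).2.trans (Nat.le_add_left _ _)⟩) (hX κ)).comp
    (EffC.of_eff (eff_commitStart H P (A κ)))
  have hσ : ∀ κ, IsDensity ((A κ).load.apply (tensor (ρ κ) (basisState
      (pubInput .clientInput (R κ) (x κ))))) := fun κ =>
    ⟨(eff_load (A κ) _).posSemidef (hρ κ).1, ((eff_load (A κ) _).trace _).trans (hρ κ).2⟩
  have hrounds : PolyBounded fun κ => (commitFormat H P κ (m κ)).rounds :=
    hB₁.mono fun κ => (hcirc κ).1
  have hclient : PolyBounded fun κ => (commitFormat H P κ (m κ)).clientCoins :=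
    hB₁.mono fun κ => (hcirc κ).2.1
  have hN := ((((hA.add hM).add (hExt₁.add (hcard₁.add hcard₁))).add (((hExt₂.add hcard₂).add
    (hcard₂.add (hA.add hn))).add ((PolyBounded.const 20).mul (hn₁.add hclient)))).add
    (hrounds.mul ((PolyBounded.const 100).mul (((hrounds.add (PolyBounded.const 1)).mul
      ((hA₁.add hB₁).add (PolyBounded.const 1))).add (hn₁.add hclient))))).add hs₂
  obtain ⟨μ₃, hμ₃, h₃⟩ := hH.consistent hm hN
    (fun κ => (effC_committed H P (A κ)).mono (by omega)) hσ
    (fun κ => by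
      have := hmem κ 0 (Nat.zero_le _)
      rw [Fintype.card_fin]
      omega)
    (fun κ => (hE κ).mono (by omega))
    (fun κ => (hT κ).mono (by simp only [Fintype.card_sum, Fintype.card_fin]; omega))
    (fun κ => (hasCircuit_openTest H (R κ) (x κ)).mono (by omega))
    (fun κ h c w hw => ((openTest_eq_true_iff H (R κ) (x κ) h c w).1 hw).2)
  refine ⟨_, ((hμ₁.const_mul 3).add (hμ₂.const_mul 2)).add hμ₃, fun κ hacc => ?_⟩
  rw [acceptProb_testClient] at hacc
  have hτ : ∀ r c, (outcome c (committed H P (A κ) ((H.sample (m κ) κ).eval r) ((A κ).load.apply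
      (tensor (ρ κ) (basisState (pubInput .clientInput (R κ) (x κ))))))).PosSemidef := fun r c =>
    posSemidef_outcome_eff (effC_committed H P (A κ)) _ (hσ κ).1 c
  have hK : 0 ≤ 2 * C := by positivity
  -- `t` is the probability of the commitment, `α` that of acceptance, `e` and `o` those of a good
  -- string from the first and from the second extractor, `g` that of a good opening from the first
  have key := success_of_consistent (μ₁ := μ₁ κ) (μ₂ := μ₂ κ) hK (fun r c => ?_) (fun r c => ?_)
    ?_ hacc (h₃ κ)
  · refine le_trans ?_ (key.trans ?_)
    · exact le_of_eq (by ring)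
    · rw [hExt, prob_average]
      refine average_mono fun r => ?_
      rw [prob_sum]
      refine Finset.sum_le_sum fun c _ => ?_
      exact prob_mono (((hE κ).eff _).posSemidef (hτ r c)) fun w hw =>
        ((openTest_eq_true_iff H (R κ) (x κ) _ c w).1 hw).1
  · have h := h₁ κ (Fin.append ((H.sample (m κ) κ).eval r) c) _ (hτ r c)
    rw [prob_congr fun w => commitRelation_holds H (m κ) κ _ c w] at h
    have h' := mul_le_mul_of_nonneg_left (average_acceptCommitted_le H P (R κ) (x κ) (A κ)
      ((H.sample (m κ) κ).eval r) c (hτ r c)) hK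
    rw [commitInstance_elim]
    linarith
  · have h := trace_sub_prob_runThen_le (commitClient H P ((H.sample (m κ) κ).eval r) c)
      (openClient H P (R κ) (x κ) ((H.sample (m κ) κ).eval r) c) (commitAdversary H P (A κ))
      (openAdversary H P (A κ)) (openInput H (R κ) (x κ) ((H.sample (m κ) κ).eval r) c)
      (eff_reveal H P (x κ) (A κ)) hK
      (h₂ κ (Fin.append (x κ) (Fin.append ((H.sample (m κ) κ).eval r) c)))
      ((eff_commitStart H P (A κ)).posSemidef (hτ r c))
    rw [(eff_commitStart H P (A κ)).trace] at h
    rw [openInstance, commitInstance_elim]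
    refine Eq.trans_le (congrArg _ (prob_congr fun w => ?_)) h
    rw [openTest_eq_true_iff, openRelation_holds]
  · refine (congrArg average (funext fun r => ?_)).trans (average_const 1)
    rw [← Complex.re_sum, sum_trace_outcome, (effC_committed H P (A κ)).trace, (hσ κ).2,
      Complex.one_re]

theorem succTest_isSound (hH : H.IsCollapsing) (hEff : P.IsEfficient) (hCompl : P.IsComplete)
    {C : ℝ} (hC : 0 < C) (hSound : ∀ δ, 0 < δ → P.IsSound δ (C * δ)) {δ : ℝ} (hδ : 0 < δ) :
    (succTest H P).IsSound δ (20 * C * δ) :=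
  fun _ _ _ hn hm hs A hA => exists_testExtractor hH hEff hCompl hC hSound hδ hn hm hs A hA

end Soundness

end SuccTest

theorem theorem5p1
    (Hash : SuccTest.HashFamily) (hHash : Hash.IsCollapsing)
    (SAoK : SuccTest.Protocol .publicInput) (hEfficient : SAoK.IsEfficient)
    (hComplete : SAoK.IsComplete) (hSound : SAoK.IsLinearlySound) :
    ∃ C : ℝ, 0 < C ∧ ∀ δ : ℝ, 0 < δ →
      (SuccTest.succTest Hash SAoK).IsSound δ (C * δ) := by
  obtain ⟨C, hC, hS⟩ := hSound
  exact ⟨20 * C, by positivity, fun δ hδ =>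
    SuccTest.succTest_isSound hHash hEfficient hComplete hC hS hδ⟩
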